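/- **Setting.** Let $F=\mathfrak{siso}(1,3)[1]$ be the graded supermanifold with coordinates $\xi^a$, $\rho^{ab}=-\rho^{ba}$, $\psi^\alpha$ ($a,b,\alpha=0,\dots,3$), all of ghost degree $1$, where $\xi^a,\rho^{ab}$ are odd and $\psi^\alpha$ (a Majorana spinor) is even with respect to the total Grassmann parity, and let $$\omega^F=\epsilon_{abcd}\,\xi^d\,d\xi^a\,d\rho^{bc}-2i(\gamma_5\gamma_a)_{\alpha\beta}\,\xi^a\,d\psi^\alpha d\psi^\beta+2i(\gamma_5\gamma_a)_{\alpha\beta}\,\psi^\alpha d\psi^\beta d\xi^a ,$$ where $\eta=\mathrm{diag}(1,-1,-1,-1)$, $\epsilon_{0123}=1$, $\gamma_5=i\gamma^0\gamma^1\gamma^2\gamma^3$, spinor indices are lowered with the charge conjugation matrix $C$, and forms commute according to the sign given by the sum of Grassmann parity and form degree. Let $\bar F$ be the finite-dimensional graded supermanifold of supermaps $T_x[1]X\to F$, where $\dim X=4$ and $\theta^\mu$ are the (odd, ghost degree $1$) coordinates of $T_x[1]X$. Its coordinates are the coefficients $\Psi^I_{\mu_1\dots\mu_k}$, $0\le k\le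 4$, of the general supermap $\Psi^I\mapsto\sum_k\frac1{k!}\Psi^I_{\mu_1\dots\mu_k}\theta^{\mu_1}\cdots\theta^{\mu_k}$, where $\Psi^I\in\{\xi^a,\rho^{ab},\psi^\alpha\}$; they have ghost degree $1-k$ and parity $|\Psi^I|+k$. The body of $\bar F$ has coordinates $e^a_\mu$ and $\omega^{ab}_\mu$ (the coefficients of $\theta^\mu$ in the images of $\xi^a$ and $\rho^{ab}$), at a point of the body all other coordinates vanish, and functions on $\bar F$ are formal power series in the even coordinates of nonzero ghost degree and polynomials in the odd coordinates, with coefficients smooth on the body. Let $\bar\omega=\int_{T_x[1]X}ev^*\omega^F$ be the two-form on $\bar F$ induced by the evaluation map $ev:\bar F\times T_x[1]X\to F$ and the Berezin integral over $\theta$. Restrict $\bar F$ to the admissible part of the body, where the frame $e^a_\mu$ is invertible. A distribution is a submodule of the module of vector fields over the functions; it is regular if it is locally freely generated (by homogeneous vector fields). Let $\bar{\mathcal K}=\{V: i_V\bar\omega=0\}$ be the kernel distribution of $\bar\omega$, and for $p$ in the body let $\bar{\mathcal K}_p\subset T_p\bar F$ be the kernel of $\bar\omega_p$. **Proposition.**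 There exists a regular distribution $\bar{\mathcal K}'\subset\bar{\mathcal K}$ on (the admissible part of) $\bar F$ such that for every point $p$ of the body with invertible frame the set of values at $p$ of the vector fields in $\bar{\mathcal K}'$ is $\bar{\mathcal K}_p$. -/

import Mathlib

open scoped Manifold ContDiff TensorProduct
open TopologicalSpace

namespace Sugra

/-! ### The graded manifold `F = siso(1,3)[1]` and its presymplectic form -/

/-- The six index pairs `a < b` of the independent Lorentz coordinates `ρ^{ab} = -ρ^{ba}`. -/
abbrev LorentzPair : Type := {q : Fin 4 × Fin 4 // q.1 < q.2}

/-- The coordinates `ξ^a`, `ρ^{ab}` (`a < b`), `ψ^α` of `F`. All of them have ghost degree `1`. -/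
abbrev TargetCoord : Type := Fin 4 ⊕ LorentzPair ⊕ Fin 4

abbrev xi (a : Fin 4) : TargetCoord := Sum.inl a

abbrev rho (q : LorentzPair) : TargetCoord := Sum.inr (Sum.inl q)

abbrev psi (α : Fin 4) : TargetCoord := Sum.inr (Sum.inr α)

/-- Total Grassmann parity of the coordinates of `F`: `ξ` and `ρ` are odd, `ψ` is even. -/
def targetParity : TargetCoord → ZMod 2 :=
  Sum.elim (fun _ => 1) (Sum.elim (fun _ => 1) (fun _ => 0))

/-- The Levi-Civita symbol, with `ε_{0123} = 1`. -/
noncomputable def leviCivita (a b c d : Fin 4) : ℝ :=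
  Matrix.det (Matrix.of fun i j : Fin 4 => if ![a, b, c, d] i = j then (1 : ℝ) else 0)

/-- The Minkowski metric `diag(1,-1,-1,-1)`. -/
def minkowski (a : Fin 4) : ℂ := if a = 0 then 1 else -1

/-- Identity and Pauli matrices `σ^a = (1, σ^i)`. -/
def pauli : Fin 4 → Matrix (Fin 2) (Fin 2) ℂ :=
  ![!![1, 0; 0, 1], !![0, 1; 1, 0], !![0, -Complex.I; Complex.I, 0], !![1, 0; 0, -1]]

/-- The gamma matrices `γ^a`, with off-diagonal blocks `σ^a` and `(1, -σ^i)`. -/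
def gammaUp (a : Fin 4) : Matrix (Fin 4) (Fin 4) ℂ :=
  (Matrix.fromBlocks 0 (pauli a) (minkowski a • pauli a) 0).reindex finSumFinEquiv finSumFinEquiv

theorem gammaUp_explicit :
    gammaUp 0 = !![0, 0, 1, 0; 0, 0, 0, 1; 1, 0, 0, 0; 0, 1, 0, 0] ∧
    gammaUp 1 = !![0, 0, 0, 1; 0, 0, 1, 0; 0, -1, 0, 0; -1, 0, 0, 0] ∧
    gammaUp 2 = !![0, 0, 0, -Complex.I; 0, 0, Complex.I, 0; 0, Complex.I, 0, 0;
      -Complex.I, 0, 0, 0] ∧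
    gammaUp 3 = !![0, 0, 1, 0; 0, 0, 0, -1; -1, 0, 0, 0; 0, 1, 0, 0] := by
  refine ⟨?_, ?_, ?_, ?_⟩ <;> ext i j <;> fin_cases i <;> fin_cases j <;>
    simp [gammaUp, pauli, minkowski, Matrix.fromBlocks, finSumFinEquiv, Fin.addCases, Fin.subNat,
      Fin.castLT]

/-- `γ_a = η_{ab} γ^b`. -/
def gammaDown (a : Fin 4) : Matrix (Fin 4) (Fin 4) ℂ := minkowski a • gammaUp a

/-- `γ_5 = i γ^0 γ^1 γ^2 γ^3`. -/
def gammaFive : Matrix (Fin 4) (Fin 4) ℂ :=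
  Complex.I • (gammaUp 0 * gammaUp 1 * gammaUp 2 * gammaUp 3)

theorem gammaFive_explicit :
    gammaFive = !![-1, 0, 0, 0; 0, -1, 0, 0; 0, 0, 1, 0; 0, 0, 0, 1] := by
  obtain ⟨h0, h1, h2, h3⟩ := gammaUp_explicit
  rw [gammaFive, h0, h1, h2, h3]
  simp [Matrix.vecHead, Matrix.vecTail, Matrix.smul_of]

/-- The charge conjugation matrix `C_{αβ}`, with diagonal blocks `iσ^2` and `-iσ^2`. -/
def chargeConj : Matrix (Fin 4) (Fin 4) ℂ :=
  !![0, 1, 0, 0; -1, 0, 0, 0; 0, 0, 0, -1; 0, 0, 1, 0]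

/-- Real linear coordinates `r` on the space of Majorana spinors: the spinor with coordinates `r`
is `majorana *ᵥ r`; its upper two components are `r₀ + i r₁` and `r₂ + i r₃`, and the lower two are
fixed by the Majorana condition, see `majorana_condition`. -/
def majorana : Matrix (Fin 4) (Fin 4) ℂ :=
  !![1, Complex.I, 0, 0; 0, 0, 1, Complex.I; 0, 0, -1, Complex.I; 1, -Complex.I, 0, 0]

/-- The Majorana condition `ψ† γ^0 = ψᵀ C` for `ψ = majorana *ᵥ r` with `r` real. -/
theorem majorana_condition (r : Fin 4 → ℝ) :
    Matrix.vecMul (star (majorana.mulVec (fun i => (r i : ℂ)))) (gammaUp 0) =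
      Matrix.vecMul (majorana.mulVec (fun i => (r i : ℂ))) chargeConj := by
  rw [gammaUp_explicit.1]
  ext i
  fin_cases i <;>
    simp [majorana, chargeConj, Matrix.vecMul, Matrix.mulVec, dotProduct, Fin.sum_univ_four] <;>
    ring

/-- The matrices `-2i (γ_5 γ_a)_{αβ} = -2i (C γ_5 γ_a)_{αβ}` in the real spinor coordinates. -/
noncomputable def spinMatrixC (a : Fin 4) : Matrix (Fin 4) (Fin 4) ℂ :=
  (-2 * Complex.I) • (majorana.transpose * (chargeConj * (gammaFive * gammaDown a)) * majorana)

theorem spinMatrixC_explicit :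
    spinMatrixC 0 = !![0, 4, 0, 0; -4, 0, 0, 0; 0, 0, 0, 4; 0, 0, -4, 0] ∧
    spinMatrixC 1 = !![0, 0, 0, 4; 0, 0, -4, 0; 0, 4, 0, 0; -4, 0, 0, 0] ∧
    spinMatrixC 2 = !![0, 0, -4, 0; 0, 0, 0, -4; 4, 0, 0, 0; 0, 4, 0, 0] ∧
    spinMatrixC 3 = !![0, 4, 0, 0; -4, 0, 0, 0; 0, 0, 0, -4; 0, 0, 4, 0] := by
  obtain ⟨h0, h1, h2, h3⟩ := gammaUp_explicit
  refine ⟨?_, ?_, ?_, ?_⟩ <;>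
    simp only [spinMatrixC, gammaFive_explicit, gammaDown, h0, h1, h2, h3, majorana, chargeConj] <;>
    (ext i j; fin_cases i <;> fin_cases j <;>
      simp [Matrix.mul_apply, Fin.sum_univ_four, minkowski] <;> ring_nf <;> simp)

/-- The matrices `-2i (γ_5 γ_a)_{αβ}` in the real spinor coordinates have real entries, see
`spinMatrix_ofReal`. -/
noncomputable def spinMatrix (a α β : Fin 4) : ℝ := (spinMatrixC a α β).re

theorem spinMatrix_ofReal (a α β : Fin 4) : (spinMatrix a α β : ℂ) = spinMatrixC a α β := by
  obtain ⟨h0, h1, h2, h3⟩ := spinMatrixC_explicit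
  rw [spinMatrix, Complex.ext_iff]
  refine ⟨by simp, ?_⟩
  rw [Complex.ofReal_im]
  fin_cases a <;> simp only [h0, h1, h2, h3, Fin.zero_eta, Fin.mk_one, Fin.reduceFinMk] <;>
    fin_cases α <;> fin_cases β <;> simp

/-- Extension of the independent components `t_{ab}`, `a < b`, to all pairs by antisymmetry. -/
def antisymm {A : Type*} [AddGroup A] (t : LorentzPair → A) (a b : Fin 4) : A :=
  if h : a < b then t ⟨(a, b), h⟩ else if h : b < a then -t ⟨(b, a), h⟩ else 0

/-- The presymplectic two-form
`ω^F = ε_{abcd} ξ^d dξ^a dρ^{bc} - 2i (γ_5γ_a)_{αβ} ξ^a dψ^α dψ^β + 2i (γ_5γ_a)_{αβ} ψ^α dψ^β dξ^a`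
of `F`, as an expression in the coordinates `Ψ` of `F` and their differentials `dΨ` that can be
evaluated in any algebra; its pullback along a map is obtained by inserting the pullbacks of the
coordinates and of their differentials. -/
noncomputable def omegaF {A : Type*} [Ring A] [Algebra ℝ A] (Ψ dΨ : TargetCoord → A) : A :=
  (∑ a, ∑ b, ∑ c, ∑ d, leviCivita a b c d •
      (Ψ (xi d) * dΨ (xi a) * antisymm (fun q => dΨ (rho q)) b c))
    + (∑ a, ∑ α, ∑ β, spinMatrix a α β • (Ψ (xi a) * dΨ (psi α) * dΨ (psi β)))
    - (∑ a, ∑ α, ∑ β, spinMatrix a α β • (Ψ (psi α) * dΨ (psi β) * dΨ (xi a)))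

/-! ### The graded supermanifold `F̄` of supermaps `T_x[1]X → F` -/

/-- The coordinates of `F̄`: the pair `(I, {μ₁ < ... < μ_k})` is the coefficient of
`θ^{μ₁} ⋯ θ^{μ_k}` in the general supermap `Ψ^I ↦ Ψ^I + Ψ^I_μ θ^μ + ½ Ψ^I_{μν} θ^μ θ^ν + ...`. -/
abbrev Coord : Type := TargetCoord × Finset (Fin 4)

/-- Ghost degree of a coordinate of `F̄` (each `θ^μ` has ghost degree `1`). -/
def gh (x : Coord) : ℤ := 1 - (x.2.card : ℤ)

/-- Total Grassmann parity of a coordinate of `F̄` (each `θ^μ` is odd). -/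
def par (x : Coord) : ZMod 2 := targetParity x.1 + (x.2.card : ZMod 2)

/-- The bidegree (ghost degree, total parity). -/
def wt (x : Coord) : ℤ × ZMod 2 := (gh x, par x)

/-- The coordinates of the body of `F̄`: these are `e^a_μ` and `ω^{ab}_μ`. -/
abbrev BodyCoord : Type := {x : Coord // gh x = 0 ∧ par x = 0}

/-- The remaining even coordinates; functions are formal power series in them. -/
abbrev FormalCoord : Type := {x : Coord // gh x ≠ 0 ∧ par x = 0}

abbrev EvenCoord : Type := {x : Coord // par x = 0}

abbrev OddCoord : Type := {x : Coord // par x ≠ 0}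

/-- The body of `F̄`. -/
abbrev Body : Type := BodyCoord → ℝ

theorem body_xi (a μ : Fin 4) : gh (xi a, {μ}) = 0 ∧ par (xi a, {μ}) = 0 := by
  refine ⟨by simp [gh], ?_⟩
  simp only [par, targetParity, xi, Sum.elim_inl, Finset.card_singleton]
  rfl

/-- The frame `e^a_μ` at a point of the body. -/
def frame (p : Body) : Matrix (Fin 4) (Fin 4) ℝ :=
  Matrix.of fun a μ => p ⟨(xi a, {μ}), body_xi a μ⟩

theorem isOpen_admissible : IsOpen {p : Body | (frame p).det ≠ 0} := by
  refine isOpen_ne.preimage (Continuous.matrix_det ?_)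
  exact continuous_matrix fun a μ => continuous_apply _

/-- The admissible part of the body, where the frame is invertible. -/
def admissible : Opens Body := ⟨{p | (frame p).det ≠ 0}, isOpen_admissible⟩

/-- Smooth functions on an open part of the body. -/
abbrev Smooth (U : Opens Body) : Type := C^∞⟮𝓘(ℝ, Body), U; 𝓘(ℝ, ℝ), ℝ⟯

/-- Functions on the part of `F̄` over `U`: formal power series in the even coordinates of nonzero
ghost degree, with coefficients in the exterior algebra on the odd coordinates over the smooth
functions on `U`. -/
abbrev Fun (U : Opens Body) : Type :=
  MvPowerSeries FormalCoord (Smooth U ⊗[ℝ] ExteriorAlgebra ℝ (OddCoord → ℝ))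

/-- A coordinate of the body as a smooth function. -/
noncomputable def bodyCoord (U : Opens Body) (x : BodyCoord) : Smooth U :=
  ⟨fun p => (p : Body) x,
    ((ContinuousLinearMap.proj (R := ℝ) (φ := fun _ : BodyCoord => ℝ) x).contMDiff).comp
      contMDiff_subtype_val⟩

/-- The coordinate functions of `F̄`. -/
noncomputable def coord (U : Opens Body) (x : Coord) : Fun U :=
  if h : par x = 0 then
    if h' : gh x = 0 then MvPowerSeries.C (bodyCoord U ⟨x, h', h⟩ ⊗ₜ[ℝ] 1)
    else MvPowerSeries.X ⟨x, h', h⟩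
  else MvPowerSeries.C (1 ⊗ₜ[ℝ] ExteriorAlgebra.ι ℝ (Pi.single (⟨x, h⟩ : OddCoord) (1 : ℝ)))

/-- Restriction of smooth functions. -/
noncomputable def smoothRes {U W : Opens Body} (h : W ≤ U) : Smooth U →ₐ[ℝ] Smooth W :=
  { ContMDiffMap.restrictRingHom 𝓘(ℝ, Body) 𝓘(ℝ, ℝ) ℝ h with commutes' := fun _ => rfl }

/-- Restriction of functions on `F̄` to the part of `F̄` over a smaller open set. -/
noncomputable def funRes {U W : Opens Body} (h : W ≤ U) : Fun U →+* Fun W :=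
  MvPowerSeries.map (Algebra.TensorProduct.map (smoothRes h) (AlgHom.id ℝ _)).toRingHom

/-- Evaluation of smooth functions at a point. -/
noncomputable def smoothEval {U : Opens Body} (p : U) : Smooth U →ₐ[ℝ] ℝ :=
  { ContMDiffMap.evalRingHom p with commutes' := fun _ => rfl }

/-- The value of a function on `F̄` at a point of the body: all coordinates other than those of the
body are set to zero. -/
noncomputable def funEval {U : Opens Body} (p : U) : Fun U →+* ℝ :=
  (Algebra.TensorProduct.lift (smoothEval p) ExteriorAlgebra.algebraMapInv
    (fun _ _ => Commute.all _ _)).toRingHom.comp MvPowerSeries.constantCoeff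

/-- The span of the products of odd coordinates of bidegree `w`. -/
noncomputable def oddPart (w : ℤ × ZMod 2) : Submodule ℝ (ExteriorAlgebra ℝ (OddCoord → ℝ)) :=
  Submodule.span ℝ {y | ∃ l : List OddCoord, (l.map fun x => wt x.1).sum = w ∧
    y = (l.map fun x => ExteriorAlgebra.ι ℝ (Pi.single x (1 : ℝ))).prod}

/-- `f` is homogeneous of bidegree `w` (ghost degree, parity). -/
def IsHomogeneousFun {U : Opens Body} (f : Fun U) (w : ℤ × ZMod 2) : Prop :=
  ∀ m : FormalCoord →₀ ℕ, MvPowerSeries.coeff m f ∈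
    LinearMap.range (LinearMap.lTensor (Smooth U)
      (oddPart (w - m.sum fun x k => k • wt x.1)).subtype)

/-! ### Vector fields and distributions on `F̄` -/

/-- Vector fields `V = V^x ∂/∂x`, given by their components; a left module over the functions. -/
abbrev VectorField (U : Opens Body) : Type := Coord → Fun U

/-- `V` is homogeneous of bidegree `w`: it maps functions of bidegree `v` to bidegree `v + w`. -/
def IsHomogeneousField {U : Opens Body} (V : VectorField U) (w : ℤ × ZMod 2) : Prop :=
  ∀ x, IsHomogeneousFun (V x) (wt x + w)

/-- The tangent space of `F̄` at a point of the body. -/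
abbrev Tangent : Type := Coord → ℝ

/-- The value of a vector field at a point of the body. -/
noncomputable def fieldEval {U : Opens Body} (p : U) (V : VectorField U) : Tangent :=
  fun x => funEval p (V x)

/-- Distributions are submodules of the module of vector fields. -/
abbrev Distribution (U : Opens Body) : Type := Submodule (Fun U) (VectorField U)

/-- The restriction of a distribution to a smaller open set. -/
noncomputable def Distribution.res {U W : Opens Body} (h : W ≤ U) (D : Distribution U) :
    Distribution W :=
  Submodule.span (Fun W) ((fun V : VectorField U => fun x => funRes h (V x)) '' (D : Set _))

/-- A distribution is regular if it is locally freely generated (by homogeneous vector fields). -/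
def Distribution.IsRegular {U : Opens Body} (D : Distribution U) : Prop :=
  ∀ p ∈ U, ∃ (W : Opens Body) (h : W ≤ U), p ∈ W ∧
    ∃ (n : ℕ) (V : Fin n → VectorField W), (∀ i, ∃ w, IsHomogeneousField (V i) w) ∧
      LinearIndependent (Fun W) V ∧ Submodule.span (Fun W) (Set.range V) = D.res h

/-! ### Differential forms on `F̄ × T_x[1]X` along `F̄`

Differential forms are functions of the coordinates `x` and their differentials `dx`, where `dx`
has parity opposite to that of `x`, and all generators commute according to their total parity. -/

/-- The odd generators: odd coordinates `x` of `F̄`, the differentials `dx` of the even coordinates,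
and `θ^0, ..., θ^3`. -/
abbrev OddGen : Type := OddCoord ⊕ EvenCoord ⊕ Fin 4

/-- Forms on `F̄` (over `U`) with coefficients in the functions of `θ`: power series in the even
generators `dx`, `x` odd, with coefficients which are power series in the even coordinates of
nonzero ghost degree with coefficients in the exterior algebra on the odd generators. -/
abbrev Form (U : Opens Body) : Type :=
  MvPowerSeries OddCoord
    (MvPowerSeries FormalCoord (Smooth U ⊗[ℝ] ExteriorAlgebra ℝ (OddGen → ℝ)))

/-- Functions on `F̄` as forms. -/
noncomputable def ofFun (U : Opens Body) : Fun U →+* Form U :=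
  MvPowerSeries.C.comp (MvPowerSeries.map (Algebra.TensorProduct.map (AlgHom.id ℝ (Smooth U))
    (ExteriorAlgebra.map (LinearMap.pi (Sum.elim
      (fun x => (LinearMap.proj x : (OddCoord → ℝ) →ₗ[ℝ] ℝ)) (fun _ => 0))))).toRingHom)

/-- An odd generator as a form. -/
noncomputable def oddGen (U : Opens Body) (j : OddGen) : Form U :=
  MvPowerSeries.C (MvPowerSeries.C
    (1 ⊗ₜ[ℝ] ExteriorAlgebra.ι ℝ (Pi.single j (1 : ℝ))))

noncomputable def theta (U : Opens Body) (μ : Fin 4) : Form U := oddGen U (Sum.inr (Sum.inr μ))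

/-- The differential `dx` of a coordinate of `F̄`. -/
noncomputable def dcoord (U : Opens Body) (x : Coord) : Form U :=
  if h : par x = 0 then oddGen U (Sum.inr (Sum.inl ⟨x, h⟩)) else MvPowerSeries.X ⟨x, h⟩

/-- The left derivative of the exterior algebra with respect to an odd generator. -/
noncomputable def extDeriv (j : OddGen) :
    ExteriorAlgebra ℝ (OddGen → ℝ) →ₗ[ℝ] ExteriorAlgebra ℝ (OddGen → ℝ) :=
  CliffordAlgebra.contractLeft (Q := (0 : QuadraticForm ℝ (OddGen → ℝ)))
    (LinearMap.proj j : (OddGen → ℝ) →ₗ[ℝ] ℝ)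

/-- The left derivative with respect to an odd generator. -/
noncomputable def oddDeriv {U : Opens Body} (j : OddGen) (f : Form U) : Form U :=
  fun m => fun n => LinearMap.lTensor (Smooth U) (extDeriv j)
    (MvPowerSeries.coeff n (MvPowerSeries.coeff m f))

/-- The left derivative `∂/∂(dx)`, i.e. the interior product with the coordinate vector field. -/
noncomputable def formDeriv {U : Opens Body} (x : Coord) (f : Form U) : Form U :=
  if h : par x = 0 then oddDeriv (Sum.inr (Sum.inl ⟨x, h⟩)) f else MvPowerSeries.pderivFun ⟨x, h⟩ f

/-- The interior product `i_V = V^x ∂/∂(dx)`. -/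
noncomputable def interior {U : Opens Body} (V : VectorField U) (f : Form U) : Form U :=
  ∑ x, ofFun U (V x) * formDeriv x f

/-- The Berezin integral over `T_x[1]X`: the coefficient of `θ^0 θ^1 θ^2 θ^3`. -/
noncomputable def berezin {U : Opens Body} (f : Form U) : Form U :=
  oddDeriv (Sum.inr (Sum.inr 3)) (oddDeriv (Sum.inr (Sum.inr 2))
    (oddDeriv (Sum.inr (Sum.inr 1)) (oddDeriv (Sum.inr (Sum.inr 0)) f)))

/-- The monomial `θ^{μ₁} ⋯ θ^{μ_k}` for `S = {μ₁ < ... < μ_k}`. -/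
noncomputable def thetaMon (U : Opens Body) (S : Finset (Fin 4)) : Form U :=
  ((S.sort (· ≤ ·)).map (theta U)).prod

/-- The pullback of a coordinate of `F` along the evaluation map `F̄ × T_x[1]X → F`. -/
noncomputable def ev (U : Opens Body) (I : TargetCoord) : Form U :=
  ∑ S : Finset (Fin 4), ofFun U (coord U (I, S)) * thetaMon U S

/-- The pullback of the differential of a coordinate of `F` along the evaluation map (components
along `F̄`). -/
noncomputable def evd (U : Opens Body) (I : TargetCoord) : Form U :=
  ∑ S : Finset (Fin 4), dcoord U (I, S) * thetaMon U S

/-- The induced presymplectic form `ω̄ = ∫ ev^* ω^F` of `F̄`. -/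
noncomputable def omegaBar (U : Opens Body) : Form U := berezin (omegaF (ev U) (evd U))

/-- The kernel distribution of `ω̄`. -/
noncomputable def kernel (U : Opens Body) : Distribution U where
  carrier := {V | interior V (omegaBar U) = 0}
  add_mem' := by
    intro V W hV hW
    have h : interior (V + W) (omegaBar U) = interior V (omegaBar U) + interior W (omegaBar U) := by
      simp [interior, add_mul, Finset.sum_add_distrib]
    rw [Set.mem_ofPred_eq] at hV hW ⊢
    rw [h, hV, hW, add_zero]
  zero_mem' := by simp [interior]
  smul_mem' := by
    intro f V hV
    have h : interior (f • V) (omegaBar U) = ofFun U f * interior V (omegaBar U) := by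
      simp [interior, Finset.mul_sum, mul_assoc]
    rw [Set.mem_ofPred_eq] at hV ⊢
    rw [h, hV, mul_zero]

/-- Forms at a point of the body. -/
abbrev PointForm : Type := MvPowerSeries OddCoord (ExteriorAlgebra ℝ (OddGen → ℝ))

/-- The value of a form at a point of the body: the coordinates (but not their differentials) other
than those of the body are set to zero. -/
noncomputable def formEval {U : Opens Body} (p : U) : Form U →+* PointForm :=
  MvPowerSeries.map (((Algebra.TensorProduct.lid ℝ (ExteriorAlgebra ℝ (OddGen → ℝ))).toAlgHom.comp
    (Algebra.TensorProduct.map (smoothEval p) (ExteriorAlgebra.map (LinearMap.pi (Sum.elim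
      (fun _ => 0) (fun j => (LinearMap.proj (Sum.inr j) : (OddGen → ℝ) →ₗ[ℝ] ℝ))))))).toRingHom.comp
    MvPowerSeries.constantCoeff)

/-- The kernel of `ω̄_p` in the tangent space at a point `p` of the body. -/
noncomputable def kernelAt {U : Opens Body} (p : U) : Submodule ℝ Tangent where
  carrier := {v | ∑ x, v x • formEval p (formDeriv x (omegaBar U)) = 0}
  add_mem' := by
    intro v w hv hw
    rw [Set.mem_ofPred_eq] at hv hw ⊢
    simp only [Pi.add_apply, add_smul, Finset.sum_add_distrib, hv, hw, add_zero]
  zero_mem' := by simp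
  smul_mem' := by
    intro r v hv
    rw [Set.mem_ofPred_eq] at hv ⊢
    simp only [Pi.smul_apply, smul_eq_mul, mul_smul, ← Finset.smul_sum, hv, smul_zero]

end Sugra

namespace Sugra

/-! ### Involution and contraction on exterior algebras and power series -/

theorem contractLeft_mul {R M : Type*} [CommRing R] [AddCommGroup M] [Module R M]
    {Q : QuadraticForm R M} (d : Module.Dual R M) (a b : CliffordAlgebra Q) :
    CliffordAlgebra.contractLeft d (a * b) =
      CliffordAlgebra.contractLeft d a * b +
        CliffordAlgebra.involute a * CliffordAlgebra.contractLeft d b := by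
  induction a using CliffordAlgebra.induction generalizing b with
  | algebraMap r => simp [CliffordAlgebra.contractLeft_algebraMap_mul]
  | ι v =>
    simp [CliffordAlgebra.contractLeft_ι_mul, Algebra.smul_def, sub_eq_add_neg]
  | mul a a' ha ha' => rw [mul_assoc, ha, ha', ha a', map_mul]; noncomm_ring
  | add a a' ha ha' => rw [add_mul, map_add, map_add, map_add, ha, ha']; noncomm_ring

theorem contractLeft_involute {R M : Type*} [CommRing R] [AddCommGroup M] [Module R M]
    {Q : QuadraticForm R M} (d : Module.Dual R M) (a : CliffordAlgebra Q) :
    CliffordAlgebra.contractLeft d (CliffordAlgebra.involute a) =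
      -CliffordAlgebra.involute (CliffordAlgebra.contractLeft d a) := by
  induction a using CliffordAlgebra.induction with
  | algebraMap r => simp
  | ι v => simp
  | mul a a' ha ha' =>
    rw [map_mul, contractLeft_mul, contractLeft_mul, ha, ha', map_add, map_mul, map_mul]
    noncomm_ring
  | add a a' ha ha' => simp only [map_add, ha, ha', neg_add]

theorem ι_mul_eq_involute_mul {R M : Type*} [CommRing R] [AddCommGroup M] [Module R M]
    (v : M) (a : ExteriorAlgebra R M) :
    ExteriorAlgebra.ι R v * a =
      CliffordAlgebra.involute (Q := (0 : QuadraticForm R M)) a * ExteriorAlgebra.ι R v := by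
  induction a using CliffordAlgebra.induction with
  | algebraMap r => rw [AlgHom.commutes]; exact (Algebra.commutes r _).symm
  | ι w =>
    rw [CliffordAlgebra.involute_ι, neg_mul]
    exact eq_neg_of_add_eq_zero_left (ExteriorAlgebra.ι_add_mul_swap v w)
  | mul a a' ha ha' => rw [map_mul, ← mul_assoc, ha, mul_assoc, ha', mul_assoc]
  | add a a' ha ha' => rw [mul_add, map_add, add_mul, ha, ha']

theorem contractLeft_map {R M N : Type*} [CommRing R] [AddCommGroup M] [Module R M]
    [AddCommGroup N] [Module R N] (f : M →ₗ[R] N) (d : Module.Dual R N) (a : ExteriorAlgebra R M) :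
    CliffordAlgebra.contractLeft (Q := (0 : QuadraticForm R N)) d (ExteriorAlgebra.map f a) =
      ExteriorAlgebra.map f
        (CliffordAlgebra.contractLeft (Q := (0 : QuadraticForm R M)) (d ∘ₗ f) a) := by
  induction a using CliffordAlgebra.left_induction with
  | algebraMap r =>
    rw [AlgHom.commutes, CliffordAlgebra.contractLeft_algebraMap]
    erw [CliffordAlgebra.contractLeft_algebraMap]
    simp
  | ι_mul a m ha =>
    have h : ExteriorAlgebra.map f (CliffordAlgebra.ι (0 : QuadraticForm R M) m) =
      CliffordAlgebra.ι (0 : QuadraticForm R N) (f m) := ExteriorAlgebra.map_apply_ι f m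
    rw [map_mul, h, CliffordAlgebra.contractLeft_ι_mul, CliffordAlgebra.contractLeft_ι_mul, ha,
      map_sub, map_smul, map_mul, h]
    rfl
  | add a b ha hb => rw [map_add, map_add, map_add, map_add, ha, hb]

section PowerSeries

variable {σ B : Type*} [Ring B]

/-- An additive map applied to all coefficients of a power series. -/
noncomputable def mapCoeff (D : B →+ B) : MvPowerSeries σ B →+ MvPowerSeries σ B where
  toFun f := fun m => D (MvPowerSeries.coeff m f)
  map_zero' := by ext m; exact map_zero D
  map_add' f g := by ext m; exact map_add D _ _

theorem coeff_mapCoeff (D : B →+ B) (f : MvPowerSeries σ B) (m : σ →₀ ℕ) :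
    MvPowerSeries.coeff m (mapCoeff D f) = D (MvPowerSeries.coeff m f) := rfl

theorem mapCoeff_mul (D : B →+ B) (s : B →+* B) (h : ∀ a b, D (a * b) = D a * b + s a * D b)
    (f g : MvPowerSeries σ B) :
    mapCoeff D (f * g) = mapCoeff D f * g + MvPowerSeries.map s f * mapCoeff D g := by
  classical
  ext m
  simp only [coeff_mapCoeff, map_add, MvPowerSeries.coeff_mul, map_sum, h, MvPowerSeries.coeff_map,
    Finset.sum_add_distrib]

theorem mapCoeff_C (D : B →+ B) (b : B) :
    mapCoeff D (MvPowerSeries.C (σ := σ) b) = MvPowerSeries.C (D b) := by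
  classical
  ext m
  simp only [coeff_mapCoeff, MvPowerSeries.coeff_C]
  split_ifs <;> simp

theorem mapCoeff_X (D : B →+ B) (h : D 1 = 0) (i : σ) :
    mapCoeff D (MvPowerSeries.X i) = 0 := by
  classical
  ext m
  simp only [coeff_mapCoeff, MvPowerSeries.coeff_X]
  split_ifs <;> simp [h]

theorem pderivFun_mul_sum (i : σ) (f : MvPowerSeries σ B) (g : (σ →₀ ℕ) → B) (d : σ →₀ ℕ)
    [DecidableEq σ] :
    ∑ x ∈ Finset.HasAntidiagonal.antidiagonal d, MvPowerSeries.coeff x.1 (f.pderivFun i) * g x.2 =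
      ∑ x ∈ Finset.HasAntidiagonal.antidiagonal (d + Finsupp.single i 1),
        MvPowerSeries.coeff x.1 f * (x.1 i : B) * g x.2 := by
  refine Finset.sum_of_injOn (fun x => (x.1 + Finsupp.single i 1, x.2)) ?_ ?_ ?_ ?_
  · rintro ⟨a, b⟩ _ ⟨a', b'⟩ _ h
    simpa using h
  · rintro ⟨a, b⟩ h
    simp only [Finset.mem_coe, Finset.HasAntidiagonal.mem_antidiagonal] at h ⊢
    rw [← h]; abel
  · rintro ⟨a, b⟩ h h'
    by_cases ha : a i = 0
    · simp [ha]
    · refine absurd ?_ h'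
      rw [Finset.HasAntidiagonal.mem_antidiagonal] at h
      have hle : Finsupp.single i 1 ≤ a := by
        rw [Finsupp.single_le_iff]; omega
      refine ⟨(a - Finsupp.single i 1, b), ?_, ?_⟩
      · rw [Finset.mem_coe, Finset.HasAntidiagonal.mem_antidiagonal]
        have : a - Finsupp.single i 1 + Finsupp.single i 1 = a := tsub_add_cancel_of_le hle
        simp only at h ⊢
        rw [← this] at h
        have h2 : a - Finsupp.single i 1 + b + Finsupp.single i 1 = d + Finsupp.single i 1 := by
          rw [← h]; exact add_right_comm _ _ _
        exact add_right_cancel h2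
      · simp [tsub_add_cancel_of_le hle]
  · rintro ⟨a, b⟩ _
    simp [MvPowerSeries.coeff_pderivFun]

theorem pderivFun_mul' (i : σ) (f g : MvPowerSeries σ B) :
    (f * g).pderivFun i = f.pderivFun i * g + f * g.pderivFun i := by
  classical
  ext d
  rw [MvPowerSeries.coeff_pderivFun, map_add, MvPowerSeries.coeff_mul, MvPowerSeries.coeff_mul,
    MvPowerSeries.coeff_mul, pderivFun_mul_sum i f (fun m => MvPowerSeries.coeff m g) d]
  have h2 : ∑ x ∈ Finset.HasAntidiagonal.antidiagonal d,
      MvPowerSeries.coeff x.1 f * MvPowerSeries.coeff x.2 (g.pderivFun i) =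
      ∑ x ∈ Finset.HasAntidiagonal.antidiagonal (d + Finsupp.single i 1),
        MvPowerSeries.coeff x.1 f * (MvPowerSeries.coeff x.2 g * (x.2 i : B)) := by
    refine Finset.sum_of_injOn (fun x => (x.1, x.2 + Finsupp.single i 1)) ?_ ?_ ?_ ?_
    · rintro ⟨a, b⟩ _ ⟨a', b'⟩ _ h
      simpa using h
    · rintro ⟨a, b⟩ h
      simp only [Finset.mem_coe, Finset.HasAntidiagonal.mem_antidiagonal] at h ⊢
      rw [← h]; abel
    · rintro ⟨a, b⟩ h h'
      by_cases ha : b i = 0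
      · simp [ha]
      · refine absurd ?_ h'
        rw [Finset.HasAntidiagonal.mem_antidiagonal] at h
        have hle : Finsupp.single i 1 ≤ b := by
          rw [Finsupp.single_le_iff]; omega
        refine ⟨(a, b - Finsupp.single i 1), ?_, ?_⟩
        · rw [Finset.mem_coe, Finset.HasAntidiagonal.mem_antidiagonal]
          have : b - Finsupp.single i 1 + Finsupp.single i 1 = b := tsub_add_cancel_of_le hle
          simp only at h ⊢
          rw [← this, ← add_assoc] at h
          exact add_right_cancel h
        · simp [tsub_add_cancel_of_le hle]
    · rintro ⟨a, b⟩ _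
      simp [MvPowerSeries.coeff_pderivFun]
  rw [h2, ← Finset.sum_add_distrib, Finset.sum_mul]
  refine Finset.sum_congr rfl ?_
  rintro ⟨a, b⟩ h
  rw [Finset.HasAntidiagonal.mem_antidiagonal] at h
  have h3 : (d i + 1 : B) = (a i : B) + (b i : B) := by
    have := DFunLike.congr_fun h i
    simp only [Finsupp.add_apply, Finsupp.single_eq_same] at this
    exact_mod_cast congrArg (Nat.cast (R := B)) this.symm
  rw [h3, mul_add, mul_assoc, mul_assoc, mul_assoc, Nat.cast_commute (a i)]

theorem pderivFun_X [DecidableEq σ] (i j : σ) :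
    (MvPowerSeries.X j : MvPowerSeries σ B).pderivFun i = if i = j then 1 else 0 := by
  ext d
  rw [MvPowerSeries.coeff_pderivFun, MvPowerSeries.coeff_X]
  by_cases h : i = j
  · subst h
    rw [if_pos rfl, MvPowerSeries.coeff_one]
    by_cases hd : d = 0
    · simp [hd]
    · simp [hd]
  · rw [if_neg h, if_neg, zero_mul, map_zero]
    intro h'
    have := DFunLike.congr_fun h' i
    simp [Ne.symm h] at this

theorem mapCoeff_pderivFun (D : B →+ B) (i : σ) (f : MvPowerSeries σ B) :
    mapCoeff D (f.pderivFun i) = (mapCoeff D f).pderivFun i := by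
  ext d
  rw [coeff_mapCoeff, MvPowerSeries.coeff_pderivFun, MvPowerSeries.coeff_pderivFun, coeff_mapCoeff]
  have h (n : ℕ) (b : B) : D (b * n) = D b * n := by
    rw [← nsmul_eq_mul', map_nsmul, nsmul_eq_mul']
  exact_mod_cast h (d i + 1) _

theorem pderivFun_smul' {R : Type*} [CommSemiring R] [Algebra R B] (i : σ) (r : R)
    (f : MvPowerSeries σ B) : (r • f).pderivFun i = r • f.pderivFun i := by
  ext d
  exact smul_mul_assoc r (MvPowerSeries.coeff (d + Finsupp.single i 1) f) _

theorem X_mul_comm (i : σ) (f : MvPowerSeries σ B) :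
    MvPowerSeries.X i * f = f * MvPowerSeries.X i :=
  (MvPowerSeries.commute_X f i).symm

end PowerSeries

end Sugra

namespace Sugra

/-! ### The calculus of forms: involution, parity and the graded Leibniz rule -/

variable {U : Opens Body}

/-- The coefficient ring of `Form U`. -/
abbrev CoeffRing (U : Opens Body) : Type := Smooth U ⊗[ℝ] ExteriorAlgebra ℝ (OddGen → ℝ)

/-- The grade involution of the coefficients. -/
noncomputable def coeffInvol (U : Opens Body) : CoeffRing U →ₐ[ℝ] CoeffRing U :=
  Algebra.TensorProduct.map (AlgHom.id ℝ (Smooth U))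
    (CliffordAlgebra.involute (Q := (0 : QuadraticForm ℝ (OddGen → ℝ))))

/-- The grade involution of forms: multiplication by `-1` on forms of odd total parity. -/
noncomputable def invol (U : Opens Body) : Form U →+* Form U :=
  MvPowerSeries.map (MvPowerSeries.map (coeffInvol U).toRingHom)

theorem coeffInvol_tmul (s : Smooth U) (a : ExteriorAlgebra ℝ (OddGen → ℝ)) :
    coeffInvol U (s ⊗ₜ a) =
      s ⊗ₜ CliffordAlgebra.involute (Q := (0 : QuadraticForm ℝ (OddGen → ℝ))) a := rfl

theorem coeffInvol_coeffInvol (b : CoeffRing U) : coeffInvol U (coeffInvol U b) = b := by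
  induction b using TensorProduct.induction_on with
  | zero => simp
  | tmul s a => rw [coeffInvol_tmul, coeffInvol_tmul, CliffordAlgebra.involute_involute]
  | add a b ha hb => rw [map_add, map_add, ha, hb]

theorem invol_invol (f : Form U) : invol U (invol U f) = f := by
  ext m n
  exact coeffInvol_coeffInvol _

theorem extDeriv_mul (j : OddGen) (a b : ExteriorAlgebra ℝ (OddGen → ℝ)) :
    extDeriv j (a * b) = extDeriv j a * b +
      CliffordAlgebra.involute (Q := (0 : QuadraticForm ℝ (OddGen → ℝ))) a * extDeriv j b :=
  contractLeft_mul (Q := (0 : QuadraticForm ℝ (OddGen → ℝ))) _ a b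

/-- The left derivative on coefficients. -/
noncomputable def coeffDeriv (U : Opens Body) (j : OddGen) : CoeffRing U →ₗ[ℝ] CoeffRing U :=
  LinearMap.lTensor (Smooth U) (extDeriv j)

theorem coeffDeriv_tmul (j : OddGen) (s : Smooth U) (a : ExteriorAlgebra ℝ (OddGen → ℝ)) :
    coeffDeriv U j (s ⊗ₜ a) = s ⊗ₜ extDeriv j a := rfl

theorem coeffDeriv_mul (j : OddGen) (a b : CoeffRing U) :
    coeffDeriv U j (a * b) = coeffDeriv U j a * b + coeffInvol U a * coeffDeriv U j b := by
  induction a using TensorProduct.induction_on with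
  | zero => simp
  | add a a' ha ha' => rw [add_mul, map_add, map_add, map_add, ha, ha']; noncomm_ring
  | tmul s a =>
    induction b using TensorProduct.induction_on with
    | zero => simp
    | add b b' hb hb' => rw [mul_add, map_add, map_add, hb, hb']; noncomm_ring
    | tmul t b =>
      rw [Algebra.TensorProduct.tmul_mul_tmul, coeffDeriv_tmul, extDeriv_mul, TensorProduct.tmul_add,
        coeffDeriv_tmul, coeffDeriv_tmul, coeffInvol_tmul, Algebra.TensorProduct.tmul_mul_tmul,
        Algebra.TensorProduct.tmul_mul_tmul]

theorem coeffDeriv_coeffInvol (j : OddGen) (a : CoeffRing U) :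
    coeffDeriv U j (coeffInvol U a) = -coeffInvol U (coeffDeriv U j a) := by
  induction a using TensorProduct.induction_on with
  | zero => simp
  | add a a' ha ha' => simp only [map_add, ha, ha', neg_add]
  | tmul s a =>
    rw [coeffInvol_tmul, coeffDeriv_tmul, coeffDeriv_tmul, coeffInvol_tmul, ← TensorProduct.tmul_neg]
    exact congrArg _ (contractLeft_involute (Q := (0 : QuadraticForm ℝ (OddGen → ℝ))) _ a)

theorem coeffDeriv_comm (j k : OddGen) (a : CoeffRing U) :
    coeffDeriv U j (coeffDeriv U k a) = -coeffDeriv U k (coeffDeriv U j a) := by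
  induction a using TensorProduct.induction_on with
  | zero => simp
  | add a a' ha ha' => simp only [map_add, ha, ha', neg_add]
  | tmul s a =>
    simp only [coeffDeriv_tmul, ← TensorProduct.tmul_neg]
    exact congrArg _ (CliffordAlgebra.contractLeft_comm (Q := (0 : QuadraticForm ℝ (OddGen → ℝ))) _ _ a)

/-- `oddDeriv` as an additive map. -/
noncomputable def oddDerivHom (U : Opens Body) (j : OddGen) : Form U →+ Form U :=
  mapCoeff (mapCoeff (coeffDeriv U j).toAddMonoidHom)

theorem oddDeriv_eq (j : OddGen) (f : Form U) : oddDeriv j f = oddDerivHom U j f := rfl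

theorem oddDeriv_mul (j : OddGen) (f g : Form U) :
    oddDeriv j (f * g) = oddDeriv j f * g + invol U f * oddDeriv j g :=
  mapCoeff_mul (σ := OddCoord)
    (mapCoeff (σ := FormalCoord) (coeffDeriv U j).toAddMonoidHom)
    (MvPowerSeries.map (coeffInvol U).toRingHom)
    (mapCoeff_mul (σ := FormalCoord) (coeffDeriv U j).toAddMonoidHom (coeffInvol U).toRingHom
      (coeffDeriv_mul (U := U) j)) f g

theorem oddDeriv_add (j : OddGen) (f g : Form U) :
    oddDeriv j (f + g) = oddDeriv j f + oddDeriv j g := map_add (oddDerivHom U j) f g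

theorem oddDeriv_neg (j : OddGen) (f : Form U) : oddDeriv j (-f) = -oddDeriv j f :=
  map_neg (oddDerivHom U j) f

theorem oddDeriv_zero (j : OddGen) : oddDeriv j (0 : Form U) = 0 := map_zero (oddDerivHom U j)

theorem oddDeriv_invol (j : OddGen) (f : Form U) :
    oddDeriv j (invol U f) = -invol U (oddDeriv j f) := by
  ext m n
  exact coeffDeriv_coeffInvol j _

theorem oddDeriv_comm (j k : OddGen) (f : Form U) :
    oddDeriv j (oddDeriv k f) = -oddDeriv k (oddDeriv j f) := by
  ext m n
  exact coeffDeriv_comm j k _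

theorem oddDeriv_C_C (j : OddGen) (b : CoeffRing U) :
    oddDeriv j (MvPowerSeries.C (MvPowerSeries.C b)) =
      MvPowerSeries.C (MvPowerSeries.C (coeffDeriv U j b)) := by
  rw [oddDeriv_eq, oddDerivHom, mapCoeff_C, mapCoeff_C]; rfl

theorem coeffDeriv_one (j : OddGen) : coeffDeriv U j 1 = 0 := by
  rw [Algebra.TensorProduct.one_def, coeffDeriv_tmul]
  erw [CliffordAlgebra.contractLeft_one]
  simp

theorem oddDeriv_X (j : OddGen) (x : OddCoord) :
    oddDeriv j (MvPowerSeries.X x : Form U) = 0 := by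
  refine mapCoeff_X (B := MvPowerSeries FormalCoord (CoeffRing U))
    (mapCoeff (coeffDeriv U j).toAddMonoidHom) ?_ x
  rw [← map_one (MvPowerSeries.C (σ := FormalCoord) (R := CoeffRing U)), mapCoeff_C]
  exact (congrArg _ (coeffDeriv_one j)).trans (map_zero _)

theorem oddDeriv_oddGen (j k : OddGen) :
    oddDeriv j (oddGen U k) = if j = k then 1 else 0 := by
  have h : extDeriv j (ExteriorAlgebra.ι ℝ (Pi.single k (1 : ℝ))) =
      if j = k then 1 else 0 := by
    refine (CliffordAlgebra.contractLeft_ι (Q := (0 : QuadraticForm ℝ (OddGen → ℝ))) _ _).trans ?_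
    rw [LinearMap.proj_apply, Pi.single_apply]
    split_ifs <;> simp
  rw [oddGen, oddDeriv_C_C, coeffDeriv_tmul, h]
  split_ifs
  · rw [← Algebra.TensorProduct.one_def, map_one, map_one]
  · simp

/-- The inclusion of the odd coordinates among the odd generators. -/
noncomputable def oddIncl : (OddCoord → ℝ) →ₗ[ℝ] (OddGen → ℝ) :=
  LinearMap.pi (Sum.elim (fun x => (LinearMap.proj x : (OddCoord → ℝ) →ₗ[ℝ] ℝ)) (fun _ => 0))

/-- The inclusion of the coefficients of functions into the coefficients of forms. -/
noncomputable def coeffIncl (U : Opens Body) :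
    Smooth U ⊗[ℝ] ExteriorAlgebra ℝ (OddCoord → ℝ) →ₐ[ℝ] CoeffRing U :=
  Algebra.TensorProduct.map (AlgHom.id ℝ (Smooth U)) (ExteriorAlgebra.map oddIncl)

theorem ofFun_apply (f : Fun U) :
    ofFun U f = MvPowerSeries.C (MvPowerSeries.map (coeffIncl U).toRingHom f) := rfl

theorem oddDeriv_ofFun (j : EvenCoord ⊕ Fin 4) (f : Fun U) :
    oddDeriv (Sum.inr j) (ofFun U f) = 0 := by
  have h (b) : coeffDeriv U (Sum.inr j) (coeffIncl U b) = 0 := by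
    induction b using TensorProduct.induction_on with
    | zero => simp
    | add a a' ha ha' => simp only [map_add, ha, ha', add_zero]
    | tmul s a =>
      have h0 : (LinearMap.proj (Sum.inr j) : (OddGen → ℝ) →ₗ[ℝ] ℝ) ∘ₗ oddIncl = 0 := by
        ext; simp [oddIncl]
      have : extDeriv (Sum.inr j) (ExteriorAlgebra.map oddIncl a) = 0 := by
        refine (contractLeft_map oddIncl _ a).trans ?_
        rw [h0, map_zero, LinearMap.zero_apply, map_zero]
      refine (coeffDeriv_tmul _ _ _).trans ?_
      exact (congrArg _ this).trans (TensorProduct.tmul_zero _ _)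
  rw [ofFun_apply, oddDeriv_eq, oddDerivHom, mapCoeff_C]
  have h' : mapCoeff (coeffDeriv U (Sum.inr j)).toAddMonoidHom
      (MvPowerSeries.map (coeffIncl U).toRingHom f) = 0 := by
    ext m; exact h _
  rw [h', map_zero]

theorem coeffInvol_ι (v : OddGen → ℝ) :
    coeffInvol U (1 ⊗ₜ ExteriorAlgebra.ι ℝ v) = -(1 ⊗ₜ ExteriorAlgebra.ι ℝ v) := by
  rw [coeffInvol_tmul, ← TensorProduct.tmul_neg]
  exact congrArg _ (CliffordAlgebra.involute_ι v)

theorem ι_mul_coeff (v : OddGen → ℝ) (b : CoeffRing U) :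
    (1 ⊗ₜ ExteriorAlgebra.ι ℝ v) * b = coeffInvol U b * (1 ⊗ₜ ExteriorAlgebra.ι ℝ v) := by
  induction b using TensorProduct.induction_on with
  | zero => simp
  | add a a' ha ha' => rw [mul_add, map_add, add_mul, ha, ha']
  | tmul s a =>
    rw [coeffInvol_tmul, Algebra.TensorProduct.tmul_mul_tmul, Algebra.TensorProduct.tmul_mul_tmul,
      one_mul, mul_one, ι_mul_eq_involute_mul]

theorem oddGen_mul (j : OddGen) (f : Form U) : oddGen U j * f = invol U f * oddGen U j := by
  ext m n
  rw [oddGen, MvPowerSeries.coeff_C_mul, MvPowerSeries.coeff_C_mul, MvPowerSeries.coeff_mul_C,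
    MvPowerSeries.coeff_mul_C, ι_mul_coeff]
  rfl

theorem invol_C_C (b : CoeffRing U) :
    invol U (MvPowerSeries.C (MvPowerSeries.C b)) =
      MvPowerSeries.C (MvPowerSeries.C (coeffInvol U b)) := by
  rw [invol, MvPowerSeries.map_C, MvPowerSeries.map_C]; rfl

theorem invol_oddGen (j : OddGen) : invol U (oddGen U j) = -oddGen U j := by
  rw [oddGen, invol_C_C, coeffInvol_ι, map_neg, map_neg]

/-- `sg U e` is the identity for `e = 0` and the grade involution for `e = 1`. -/
noncomputable def sg (U : Opens Body) (e : ZMod 2) : Form U →+* Form U :=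
  if e = 0 then RingHom.id _ else invol U

theorem sg_zero (f : Form U) : sg U 0 f = f := rfl

theorem sg_one (f : Form U) : sg U 1 f = invol U f := rfl

theorem ZMod2_cases (e : ZMod 2) : e = 0 ∨ e = 1 := by
  revert e; decide

theorem sg_add (e e' : ZMod 2) (f : Form U) : sg U (e + e') f = sg U e (sg U e' f) := by
  have h2 : (1 + 1 : ZMod 2) = 0 := by decide
  rcases ZMod2_cases e with rfl | rfl <;> rcases ZMod2_cases e' with rfl | rfl <;>
    simp [sg_zero, sg_one, h2, invol_invol]

/-- The sign `(-1)^e`. -/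
def sgn (e : ZMod 2) : ℤ := if e = 0 then 1 else -1

theorem sgn_zero : sgn 0 = 1 := rfl

theorem sgn_one : sgn 1 = -1 := rfl

theorem sgn_add (e e' : ZMod 2) : sgn (e + e') = sgn e * sgn e' := by
  revert e e'; decide

theorem sgn_mul_self (e : ZMod 2) : sgn e * sgn e = 1 := by
  revert e; decide

/-- `f` has total parity `e`, and supercommutes with all forms accordingly. -/
structure HasParity (e : ZMod 2) (f : Form U) : Prop where
  invol_eq : invol U f = sgn e • f
  mul_comm : ∀ g, f * g = sg U e g * f

namespace HasParity

variable {e e' : ZMod 2} {f g : Form U}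

theorem zero : HasParity e (0 : Form U) := ⟨by simp, by simp⟩

theorem one : HasParity 0 (1 : Form U) := ⟨by simp [sgn_zero], by simp [sg_zero]⟩

theorem add (hf : HasParity e f) (hg : HasParity e g) : HasParity e (f + g) :=
  ⟨by
    rw [map_add, hf.invol_eq, hg.invol_eq]
    rcases ZMod2_cases e with rfl | rfl
    · simp only [sgn_zero, one_smul]
    · simp only [sgn_one, neg_smul, one_smul, neg_add],
    fun h => by rw [add_mul, mul_add, hf.mul_comm, hg.mul_comm]⟩

theorem sum {ι : Type*} (s : Finset ι) {f : ι → Form U} (hf : ∀ i ∈ s, HasParity e (f i)) :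
    HasParity e (∑ i ∈ s, f i) := by
  classical
  induction s using Finset.induction_on with
  | empty => simpa using zero
  | insert i s hi ih =>
    rw [Finset.sum_insert hi]
    exact (hf i (by simp)).add (ih fun k hk => hf k (Finset.mem_insert_of_mem hk))

theorem mul (hf : HasParity e f) (hg : HasParity e' g) : HasParity (e + e') (f * g) :=
  ⟨by rw [map_mul, hf.invol_eq, hg.invol_eq, sgn_add, smul_mul_smul_comm],
    fun h => by
      rw [mul_assoc, hg.mul_comm, ← mul_assoc, hf.mul_comm, sg_add, mul_assoc]⟩

theorem cast (hf : HasParity e f) (h : e = e') : HasParity e' f := h ▸ hf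

theorem sg_eq (hf : HasParity e f) (e' : ZMod 2) : sg U e' f = sgn (e' * e) • f := by
  rcases ZMod2_cases e' with rfl | rfl
  · simp [sg_zero, sgn_zero]
  · simp [sg_one, hf.invol_eq]

theorem comm (hf : HasParity e f) (hg : HasParity e' g) : f * g = sgn (e * e') • (g * f) := by
  rw [hf.mul_comm, hg.sg_eq, smul_mul_assoc]

theorem oddGen (j : OddGen) : HasParity 1 (oddGen U j) :=
  ⟨by rw [invol_oddGen, sgn_one, neg_smul, one_smul], fun g => by rw [oddGen_mul, sg_one]⟩

theorem X (x : OddCoord) : HasParity 0 (MvPowerSeries.X x : Form U) :=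
  ⟨by rw [invol, MvPowerSeries.map_X, sgn_zero, one_smul], fun g => X_mul_comm x g⟩

theorem list_prod {l : List (Form U)} (h : ∀ f ∈ l, HasParity 1 f) :
    HasParity (l.length : ZMod 2) l.prod := by
  induction l with
  | nil => simpa using one
  | cons f l ih =>
    rw [List.prod_cons, List.length_cons, Nat.cast_add, add_comm]
    exact (h f (by simp)).mul (ih fun k hk => h k (by simp [hk])) |>.cast (by simp)

end HasParity

theorem HasParity.ofFun_coord (x : Coord) : HasParity (par x) (ofFun U (coord U x)) := by
  by_cases h : par x = 0
  · rw [h]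
    by_cases h' : gh x = 0
    · rw [coord, dif_pos h, dif_pos h', ofFun_apply, MvPowerSeries.map_C]
      have hb : (coeffIncl U).toRingHom (bodyCoord U ⟨x, h', h⟩ ⊗ₜ[ℝ] 1) =
          bodyCoord U ⟨x, h', h⟩ ⊗ₜ[ℝ] 1 := by
        refine (Algebra.TensorProduct.map_tmul _ _ _ _).trans ?_
        rw [map_one]; rfl
      rw [hb]
      refine ⟨?_, fun g => ?_⟩
      · rw [invol_C_C, coeffInvol_tmul, map_one, sgn_zero, one_smul]
      · rw [sg_zero]
        ext m n
        rw [MvPowerSeries.coeff_C_mul, MvPowerSeries.coeff_C_mul, MvPowerSeries.coeff_mul_C,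
          MvPowerSeries.coeff_mul_C]
        generalize (MvPowerSeries.coeff n) ((MvPowerSeries.coeff m) g) = b
        induction b using TensorProduct.induction_on with
        | zero => simp
        | add a a' ha ha' => rw [mul_add, add_mul, ha, ha']
        | tmul s a =>
          rw [Algebra.TensorProduct.tmul_mul_tmul, Algebra.TensorProduct.tmul_mul_tmul, one_mul,
            mul_one, _root_.mul_comm]
    · rw [coord, dif_pos h, dif_neg h', ofFun_apply, MvPowerSeries.map_X]
      refine ⟨?_, fun g => ?_⟩
      · rw [invol, MvPowerSeries.map_C, MvPowerSeries.map_X, sgn_zero, one_smul]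
      · rw [sg_zero]
        ext1 m
        rw [MvPowerSeries.coeff_C_mul, MvPowerSeries.coeff_mul_C, X_mul_comm]
  · rw [(ZMod2_cases (par x)).resolve_left h, coord, dif_neg h, ofFun_apply, MvPowerSeries.map_C]
    have hb : (coeffIncl U).toRingHom (1 ⊗ₜ[ℝ] ExteriorAlgebra.ι ℝ (Pi.single ⟨x, h⟩ (1 : ℝ))) =
        1 ⊗ₜ[ℝ] ExteriorAlgebra.ι ℝ (Pi.single (Sum.inl ⟨x, h⟩) (1 : ℝ)) := by
      refine (Algebra.TensorProduct.map_tmul _ _ _ _).trans ?_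
      rw [ExteriorAlgebra.map_apply_ι]
      congr 2
      ext j
      rcases j with j | j
      · simp [oddIncl, Pi.single_apply]
      · simp [oddIncl]
    rw [hb]
    exact HasParity.oddGen _

theorem HasParity.dcoord (x : Coord) : HasParity (par x + 1) (dcoord U x) := by
  by_cases h : par x = 0
  · rw [Sugra.dcoord, dif_pos h, h, zero_add]
    exact HasParity.oddGen _
  · rw [Sugra.dcoord, dif_neg h, (ZMod2_cases (par x)).resolve_left h]
    exact HasParity.X _

theorem HasParity.thetaMon (S : Finset (Fin 4)) :
    HasParity (S.card : ZMod 2) (thetaMon U S) := by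
  have h := HasParity.list_prod (U := U) (l := (S.sort (· ≤ ·)).map (theta U)) (by
    intro f hf
    obtain ⟨μ, _, rfl⟩ := List.mem_map.1 hf
    exact HasParity.oddGen _)
  rwa [List.length_map, Finset.length_sort] at h

theorem HasParity.ev (I : TargetCoord) : HasParity (targetParity I) (ev U I) := by
  refine HasParity.sum _ fun S _ => ((HasParity.ofFun_coord _).mul (HasParity.thetaMon S)).cast ?_
  rw [par, add_assoc, CharTwo.add_self_eq_zero, add_zero]

theorem HasParity.evd (I : TargetCoord) : HasParity (targetParity I + 1) (evd U I) := by
  refine HasParity.sum _ fun S _ => ((HasParity.dcoord _).mul (HasParity.thetaMon S)).cast ?_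
  rw [par, add_right_comm, add_assoc (targetParity I), CharTwo.add_self_eq_zero, add_zero]

end Sugra

namespace Sugra

/-! ### The interior product with `ω̄` -/

variable {U : Opens Body}

theorem formDeriv_of_even {x : Coord} (h : par x = 0) (f : Form U) :
    formDeriv x f = oddDeriv (Sum.inr (Sum.inl ⟨x, h⟩)) f := dif_pos h

theorem formDeriv_of_odd {x : Coord} (h : par x ≠ 0) (f : Form U) :
    formDeriv x f = MvPowerSeries.pderivFun ⟨x, h⟩ f := dif_neg h

theorem formDeriv_add (x : Coord) (f g : Form U) :
    formDeriv x (f + g) = formDeriv x f + formDeriv x g := by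
  by_cases h : par x = 0
  · simp only [formDeriv_of_even h, oddDeriv_add]
  · simp only [formDeriv_of_odd h, MvPowerSeries.pderivFun_add]

theorem formDeriv_smul (x : Coord) (r : ℝ) (f : Form U) :
    formDeriv x (r • f) = r • formDeriv x f := by
  by_cases h : par x = 0
  · simp only [formDeriv_of_even h]
    ext m n
    exact (coeffDeriv U _).map_smul r _
  · simp only [formDeriv_of_odd h]
    exact pderivFun_smul' (B := MvPowerSeries FormalCoord (CoeffRing U)) (⟨x, h⟩ : OddCoord) r f

theorem formDeriv_mul (x : Coord) (f g : Form U) :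
    formDeriv x (f * g) = formDeriv x f * g + sg U (par x + 1) f * formDeriv x g := by
  by_cases h : par x = 0
  · simp only [formDeriv_of_even h, oddDeriv_mul, h, zero_add, sg_one]
  · have h2 : (1 + 1 : ZMod 2) = 0 := by decide
    simp only [formDeriv_of_odd h, pderivFun_mul', (ZMod2_cases (par x)).resolve_left h, h2, sg_zero]

theorem formDeriv_ofFun (x : Coord) (f : Fun U) : formDeriv x (ofFun U f) = 0 := by
  by_cases h : par x = 0
  · rw [formDeriv_of_even h, oddDeriv_ofFun]
  · rw [formDeriv_of_odd h, ofFun_apply, MvPowerSeries.pderivFun_C]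

theorem formDeriv_one (x : Coord) : formDeriv x (1 : Form U) = 0 := by
  rw [← map_one (ofFun U), formDeriv_ofFun]

theorem formDeriv_theta (x : Coord) (μ : Fin 4) : formDeriv x (theta U μ) = 0 := by
  by_cases h : par x = 0
  · rw [formDeriv_of_even h, theta, oddDeriv_oddGen, if_neg (by simp)]
  · rw [formDeriv_of_odd h, theta, oddGen, MvPowerSeries.pderivFun_C]

theorem formDeriv_thetaMon (x : Coord) (S : Finset (Fin 4)) : formDeriv x (thetaMon U S) = 0 := by
  rw [thetaMon]
  induction S.sort (· ≤ ·) with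
  | nil => exact formDeriv_one x
  | cons μ l ih =>
    rw [List.map_cons, List.prod_cons, formDeriv_mul, formDeriv_theta, ih, zero_mul, mul_zero,
      add_zero]

theorem formDeriv_dcoord (x y : Coord) :
    formDeriv x (dcoord U y) = if x = y then 1 else 0 := by
  classical
  by_cases h : par x = 0 <;> by_cases h' : par y = 0
  · rw [formDeriv_of_even h, dcoord, dif_pos h', oddDeriv_oddGen]
    simp
  · rw [formDeriv_of_even h, dcoord, dif_neg h', oddDeriv_X, if_neg]
    rintro rfl; exact h' h
  · rw [formDeriv_of_odd h, dcoord, dif_pos h', oddGen, MvPowerSeries.pderivFun_C, if_neg]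
    rintro rfl; exact h h'
  · rw [formDeriv_of_odd h, dcoord, dif_neg h', pderivFun_X]
    simp

theorem formDeriv_sum {ι : Type*} (x : Coord) (s : Finset ι) (f : ι → Form U) :
    formDeriv x (∑ i ∈ s, f i) = ∑ i ∈ s, formDeriv x (f i) :=
  map_sum (AddMonoidHom.mk' (formDeriv x : Form U → Form U) (formDeriv_add x)) f s

theorem formDeriv_ev (x : Coord) (I : TargetCoord) : formDeriv x (ev U I) = 0 := by
  rw [ev, formDeriv_sum]
  refine Finset.sum_eq_zero fun S _ => ?_
  rw [formDeriv_mul, formDeriv_ofFun, formDeriv_thetaMon, zero_mul, mul_zero, add_zero]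

theorem formDeriv_evd (x : Coord) (I : TargetCoord) :
    formDeriv x (evd U I) = if x.1 = I then thetaMon U x.2 else 0 := by
  rw [evd, formDeriv_sum]
  simp only [formDeriv_mul, formDeriv_thetaMon, mul_zero, add_zero, formDeriv_dcoord, ite_mul,
    one_mul, zero_mul]
  obtain ⟨J, S⟩ := x
  by_cases h : J = I
  · subst h; simp
  · simp [h]

/-- The generating superfunction in `θ` of the components of a vector field along a coordinate. -/
noncomputable def superfield (V : VectorField U) (I : TargetCoord) : Form U :=
  ∑ S : Finset (Fin 4), ofFun U (V (I, S)) * thetaMon U S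

theorem sg_mul_thetaMon (I : TargetCoord) (S : Finset (Fin 4)) (f : Form U) :
    sg U (par (I, S) + 1) f * thetaMon U S = thetaMon U S * sg U (targetParity I + 1) f := by
  rw [(HasParity.thetaMon S).mul_comm, ← sg_add, par, ← add_assoc, add_comm (targetParity I)]

theorem interior_add (V : VectorField U) (f g : Form U) :
    interior V (f + g) = interior V f + interior V g := by
  simp only [interior, formDeriv_add, mul_add, Finset.sum_add_distrib]

theorem interior_smul (V : VectorField U) (r : ℝ) (f : Form U) :
    interior V (r • f) = r • interior V f := by
  simp only [interior, formDeriv_smul, mul_smul_comm, Finset.smul_sum]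

theorem interior_ev (V : VectorField U) (I : TargetCoord) : interior V (ev U I) = 0 := by
  simp only [interior, formDeriv_ev, mul_zero, Finset.sum_const_zero]

theorem interior_mul_evd (V : VectorField U) (f : Form U) (J : TargetCoord) :
    interior V (f * evd U J) =
      interior V f * evd U J + superfield V J * sg U (targetParity J + 1) f := by
  simp only [interior, formDeriv_mul, mul_add, Finset.sum_add_distrib, Finset.sum_mul, mul_assoc]
  congr 1
  rw [Fintype.sum_prod_type, Finset.sum_eq_single J]
  · simp only [superfield, Finset.sum_mul]
    refine Finset.sum_congr rfl fun S _ => ?_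
    rw [formDeriv_evd, if_pos rfl, sg_mul_thetaMon, mul_assoc]
  · intro I _ hI
    refine Finset.sum_eq_zero fun S _ => ?_
    rw [formDeriv_evd, if_neg hI, mul_zero, mul_zero]
  · simp

theorem mul_antisymm {A : Type*} [Ring A] (f : A) (t : LorentzPair → A) (b c : Fin 4) :
    f * antisymm t b c = antisymm (fun q => f * t q) b c := by
  unfold antisymm
  split_ifs <;> simp

theorem antisymm_mul {A : Type*} [Ring A] (f : A) (t : LorentzPair → A) (b c : Fin 4) :
    antisymm t b c * f = antisymm (fun q => t q * f) b c := by
  unfold antisymm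
  split_ifs <;> simp

theorem antisymm_add {A : Type*} [AddCommGroup A] (s t : LorentzPair → A) (b c : Fin 4) :
    antisymm (fun q => s q + t q) b c = antisymm s b c + antisymm t b c := by
  unfold antisymm
  split_ifs
  · rfl
  · exact neg_add _ _
  · exact (add_zero _).symm

theorem map_antisymm {A B : Type*} [AddCommGroup A] [AddCommGroup B] (φ : A →+ B)
    (t : LorentzPair → A) (b c : Fin 4) :
    φ (antisymm t b c) = antisymm (fun q => φ (t q)) b c := by
  unfold antisymm
  split_ifs <;> simp

theorem interior_mul_antisymm (V : VectorField U) (f : Form U) (b c : Fin 4) :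
    interior V (f * antisymm (fun q => evd U (rho q)) b c) =
      interior V f * antisymm (fun q => evd U (rho q)) b c +
        antisymm (fun q => superfield V (rho q)) b c * f := by
  rw [mul_antisymm, mul_antisymm, antisymm_mul,
    show interior V (antisymm (fun q => f * evd U (rho q)) b c) =
      antisymm (fun q => interior V (f * evd U (rho q))) b c from
      map_antisymm (AddMonoidHom.mk' (interior V : Form U → Form U) (interior_add V)) _ b c,
    ← antisymm_add]
  congr 1
  funext q
  rw [interior_mul_evd]
  rfl

/-! #### The kernel equations -/

section Equations

variable {A : Type*} [Ring A] [Algebra ℝ A]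

/-- The coefficient of `dξ^a` in `i_V ω^F`. -/
noncomputable def eqXi (ξ ψ : Fin 4 → A) (V : TargetCoord → A) (a : Fin 4) : A :=
  (∑ b, ∑ c, ∑ d, leviCivita a b c d • (antisymm (fun q => V (rho q)) b c * ξ d))
    - ∑ α, ∑ β, spinMatrix a α β • (V (psi β) * ψ α)

/-- The coefficient of `dρ^{bc}` in `i_V ω^F`. -/
noncomputable def eqRho (ξ : Fin 4 → A) (V : TargetCoord → A) (b c : Fin 4) : A :=
  ∑ a, ∑ d, leviCivita a b c d • (V (xi a) * ξ d)

/-- The coefficient of `dψ^β` in `i_V ω^F`. -/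
noncomputable def eqPsi (ξ ψ : Fin 4 → A) (V : TargetCoord → A) (β : Fin 4) : A :=
  -((2 : ℝ) • ∑ a, ∑ α, spinMatrix a α β • (V (psi α) * ξ a))
    - ∑ a, ∑ α, spinMatrix a α β • (V (xi a) * ψ α)

end Equations

theorem spinMatrix_swap (a α β : Fin 4) : spinMatrix a α β = -spinMatrix a β α := by
  obtain ⟨h0, h1, h2, h3⟩ := spinMatrixC_explicit
  simp only [spinMatrix]
  fin_cases a <;> simp only [h0, h1, h2, h3, Fin.zero_eta, Fin.mk_one, Fin.reduceFinMk] <;>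
    fin_cases α <;> fin_cases β <;> simp

theorem map_omegaF {A : Type*} [Ring A] [Algebra ℝ A] (D : A →ₗ[ℝ] A)
    (Ψ dΨ V : TargetCoord → A)
    (h1 : ∀ a b c d, D (Ψ (xi d) * dΨ (xi a) * antisymm (fun q => dΨ (rho q)) b c) =
      V (xi a) * Ψ (xi d) * antisymm (fun q => dΨ (rho q)) b c +
        antisymm (fun q => V (rho q)) b c * Ψ (xi d) * dΨ (xi a))
    (h2 : ∀ a α β, D (Ψ (xi a) * dΨ (psi α) * dΨ (psi β)) =
      V (psi β) * Ψ (xi a) * dΨ (psi α) - V (psi α) * Ψ (xi a) * dΨ (psi β))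
    (h3 : ∀ a α β, D (Ψ (psi α) * dΨ (psi β) * dΨ (xi a)) =
      V (psi β) * Ψ (psi α) * dΨ (xi a) + V (xi a) * Ψ (psi α) * dΨ (psi β)) :
    D (omegaF Ψ dΨ) =
      (∑ b, ∑ c, eqRho (fun a => Ψ (xi a)) V b c * antisymm (fun q => dΨ (rho q)) b c)
        + (∑ a, eqXi (fun a => Ψ (xi a)) (fun α => Ψ (psi α)) V a * dΨ (xi a))
        + ∑ β, eqPsi (fun a => Ψ (xi a)) (fun α => Ψ (psi α)) V β * dΨ (psi β) := by
  have e1 : ∑ a, ∑ b, ∑ c, ∑ d, leviCivita a b c d •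
      (V (xi a) * Ψ (xi d) * antisymm (fun q => dΨ (rho q)) b c) =
      ∑ b, ∑ c, eqRho (fun a => Ψ (xi a)) V b c * antisymm (fun q => dΨ (rho q)) b c := by
    simp only [eqRho, Finset.sum_mul, smul_mul_assoc]
    rw [Finset.sum_comm]
    refine Finset.sum_congr rfl fun b _ => ?_
    rw [Finset.sum_comm]
  have e2 : ∑ a, ∑ α, ∑ β, spinMatrix a α β • (V (psi β) * Ψ (xi a) * dΨ (psi α)) =
        -∑ β, ∑ a, ∑ α, spinMatrix a α β • (V (psi α) * Ψ (xi a) * dΨ (psi β)) := by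
    rw [Finset.sum_comm, ← Finset.sum_neg_distrib]
    refine Finset.sum_congr rfl fun a _ => ?_
    rw [← Finset.sum_neg_distrib]
    refine Finset.sum_congr rfl fun α _ => ?_
    rw [← Finset.sum_neg_distrib]
    refine Finset.sum_congr rfl fun β _ => ?_
    rw [spinMatrix_swap α a β, neg_smul]
  have e3 : ∑ a, ∑ α, ∑ β, spinMatrix a α β • (V (psi α) * Ψ (xi a) * dΨ (psi β)) =
        ∑ β, ∑ a, ∑ α, spinMatrix a α β • (V (psi α) * Ψ (xi a) * dΨ (psi β)) := by
    rw [Finset.sum_comm_cycle]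
  have e4 : ∑ a, ∑ α, ∑ β, spinMatrix a α β • (V (xi a) * Ψ (psi α) * dΨ (psi β)) =
        ∑ β, ∑ a, ∑ α, spinMatrix a α β • (V (xi a) * Ψ (psi α) * dΨ (psi β)) := by
    rw [Finset.sum_comm_cycle]
  simp only [omegaF, map_add, map_sub, map_sum, map_smul, h1, h2, h3, smul_add, smul_sub,
    Finset.sum_add_distrib, Finset.sum_sub_distrib, e1, e2, e3, e4]
  simp only [eqXi, eqPsi, sub_mul, neg_mul, Finset.sum_mul, smul_mul_assoc, Finset.sum_sub_distrib,
    Finset.sum_neg_distrib, two_smul, add_mul, Finset.sum_add_distrib]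
  abel

/-- The interior product as a linear map. -/
noncomputable def interiorHom (V : VectorField U) : Form U →ₗ[ℝ] Form U where
  toFun := interior V
  map_add' := interior_add V
  map_smul' := interior_smul V

theorem interior_omegaF (V : VectorField U) :
    interior V (omegaF (ev U) (evd U)) =
      (∑ b, ∑ c, eqRho (fun a => ev U (xi a)) (superfield V) b c *
          antisymm (fun q => evd U (rho q)) b c)
        + (∑ a, eqXi (fun a => ev U (xi a)) (fun α => ev U (psi α)) (superfield V) a * evd U (xi a))
        + ∑ β, eqPsi (fun a => ev U (xi a)) (fun α => ev U (psi α)) (superfield V) β *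
            evd U (psi β) := by
  have hxi (a : Fin 4) : targetParity (xi a) + 1 = 0 := by simp [targetParity]; decide
  have hpsi (a : Fin 4) : targetParity (psi a) + 1 = 1 := by simp [targetParity]
  have ixi (a : Fin 4) : invol U (ev U (xi a)) = -ev U (xi a) := by
    rw [(HasParity.ev _).invol_eq]; simp [targetParity, sgn_one]
  have ipsi (a : Fin 4) : invol U (ev U (psi a)) = ev U (psi a) := by
    rw [(HasParity.ev _).invol_eq]; simp [targetParity, sgn_zero]
  have idpsi (a : Fin 4) : invol U (evd U (psi a)) = -evd U (psi a) := by
    rw [(HasParity.evd _).invol_eq]; simp [targetParity, sgn_one]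
  have h0 {A : Type _} [Ring A] (v w x d d' : A) :
      w * -x * d + v * (-x * -d') = v * x * d' - w * x * d := by noncomm_ring
  refine map_omegaF (interiorHom V) (ev U) (evd U) (superfield V) ?_ ?_ ?_
  · intro a b c d
    change interior V _ = _
    rw [interior_mul_antisymm, interior_mul_evd, interior_ev, zero_mul, zero_add, hxi, sg_zero,
      mul_assoc (antisymm _ _ _)]
  · intro a α β
    change interior V _ = _
    rw [interior_mul_evd, interior_mul_evd, interior_ev, zero_mul, zero_add, hpsi, hpsi, sg_one,
      sg_one, map_mul, ixi, idpsi]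
    exact h0 _ _ _ _ _
  · intro a α β
    change interior V _ = _
    rw [interior_mul_evd, interior_mul_evd, interior_ev, zero_mul, zero_add, hpsi, hxi, sg_one,
      sg_zero, ipsi, mul_assoc (superfield V (xi a))]

/-! #### The Berezin integral -/

theorem berezin_add (f g : Form U) : berezin (f + g) = berezin f + berezin g := by
  simp only [berezin, oddDeriv_add]

theorem berezin_zero : berezin (0 : Form U) = 0 := by
  simp only [berezin, oddDeriv_zero]

theorem berezin_sum {ι : Type*} (s : Finset ι) (f : ι → Form U) :
    berezin (∑ i ∈ s, f i) = ∑ i ∈ s, berezin (f i) :=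
  map_sum (AddMonoidHom.mk' (berezin : Form U → Form U) berezin_add) f s

theorem oddDeriv_formDeriv (x : Coord) (μ : Fin 4) (f : Form U) :
    oddDeriv (Sum.inr (Sum.inr μ)) (formDeriv x f) =
      sgn (par x + 1) • formDeriv x (oddDeriv (Sum.inr (Sum.inr μ)) f) := by
  by_cases h : par x = 0
  · rw [formDeriv_of_even h, formDeriv_of_even h, oddDeriv_comm, h, zero_add, sgn_one, neg_smul,
      one_smul]
  · have h2 : sgn (1 + 1) = 1 := by decide
    rw [formDeriv_of_odd h, formDeriv_of_odd h, (ZMod2_cases (par x)).resolve_left h, h2, one_smul]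
    have h3 := mapCoeff_pderivFun (B := MvPowerSeries FormalCoord (CoeffRing U))
      (mapCoeff (coeffDeriv U (Sum.inr (Sum.inr μ))).toAddMonoidHom) (⟨x, h⟩ : OddCoord) f
    exact h3

theorem berezin_formDeriv (x : Coord) (f : Form U) :
    berezin (formDeriv x f) = formDeriv x (berezin f) := by
  have h (e : ZMod 2) (j : OddGen) (f : Form U) : oddDeriv j (sgn e • f) = sgn e • oddDeriv j f := by
    rcases ZMod2_cases e with rfl | rfl
    · simp only [sgn_zero, one_smul]
    · simp only [sgn_one, neg_smul, one_smul, oddDeriv_neg]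
  simp only [berezin, oddDeriv_formDeriv, h, smul_smul, sgn_mul_self, one_smul]

theorem berezin_mul_of_oddDeriv_eq_zero {f : Form U}
    (hf : ∀ μ, oddDeriv (Sum.inr (Sum.inr μ)) f = 0) (g : Form U) :
    berezin (f * g) = f * berezin g := by
  have h1 (μ : Fin 4) (k : Form U) : oddDeriv (Sum.inr (Sum.inr μ)) (f * k) =
      invol U f * oddDeriv (Sum.inr (Sum.inr μ)) k := by rw [oddDeriv_mul, hf, zero_mul, zero_add]
  have h2 (μ : Fin 4) (k : Form U) : oddDeriv (Sum.inr (Sum.inr μ)) (invol U f * k) =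
      f * oddDeriv (Sum.inr (Sum.inr μ)) k := by
    rw [oddDeriv_mul, oddDeriv_invol, hf, map_zero, neg_zero, zero_mul, zero_add, invol_invol]
  simp only [berezin, h1, h2]

theorem interior_omegaBar (V : VectorField U) :
    interior V (omegaBar U) = berezin (interior V (omegaF (ev U) (evd U))) := by
  simp only [interior, omegaBar, berezin_sum]
  refine Finset.sum_congr rfl fun x _ => ?_
  rw [berezin_mul_of_oddDeriv_eq_zero (fun μ => oddDeriv_ofFun _ _), berezin_formDeriv]

theorem mem_kernel_of_eq_zero (V : VectorField U)
    (h1 : ∀ b c, eqRho (fun a => ev U (xi a)) (superfield V) b c = 0)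
    (h2 : ∀ a, eqXi (fun a => ev U (xi a)) (fun α => ev U (psi α)) (superfield V) a = 0)
    (h3 : ∀ β, eqPsi (fun a => ev U (xi a)) (fun α => ev U (psi α)) (superfield V) β = 0) :
    V ∈ kernel U := by
  change interior V (omegaBar U) = 0
  simp only [interior_omegaBar, interior_omegaF, h1, h2, h3, zero_mul, Finset.sum_const_zero,
    add_zero, berezin_zero]

end Sugra

namespace Sugra

/-! ### Monomials in anticommuting elements -/

section Monomials

variable {A : Type*} [Ring A] {ι : Type*}

theorem prod_map_perm {t : ι → A} (ht : ∀ μ ν, t μ * t ν = -(t ν * t μ)) {l l' : List ι}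
    (h : l.Perm l') : (l.map t).prod = (l'.map t).prod ∨ (l.map t).prod = -(l'.map t).prod := by
  induction h with
  | nil => exact Or.inl rfl
  | cons x _ ih =>
    rcases ih with ih | ih
    · left; simp [ih]
    · right; simp [ih]
  | swap x y l => right; simp [← mul_assoc, ht y x]
  | trans _ _ ih ih' =>
    rcases ih with ih | ih <;> rcases ih' with ih' | ih' <;> simp [ih, ih']

theorem prod_map_mul_of_mem [DecidableEq ι] {t : ι → A} (ht : ∀ μ ν, t μ * t ν = -(t ν * t μ))
    (ht0 : ∀ μ, t μ * t μ = 0) {l : List ι} {μ : ι} (h : μ ∈ l) : (l.map t).prod * t μ = 0 := by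
  have hp : l.Perm (l.erase μ ++ [μ]) :=
    (List.perm_cons_erase h).trans (List.perm_append_singleton μ _).symm
  have h0 : ((l.erase μ ++ [μ]).map t).prod * t μ = 0 := by
    rw [List.map_append, List.prod_append, mul_assoc]
    simp [ht0]
  rcases prod_map_perm ht hp with h1 | h1 <;> rw [h1] <;> simp only [neg_mul, h0, neg_zero]

/-- The ordered monomial in the elements `t μ`, `μ ∈ S`. -/
noncomputable def mon (t : Fin 4 → A) (S : Finset (Fin 4)) : A :=
  ((S.sort (· ≤ ·)).map t).prod

theorem mon_empty (t : Fin 4 → A) : mon t ∅ = 1 := by simp [mon]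

theorem map_mon {B F : Type*} [Ring B] [FunLike F A B] [MonoidHomClass F A B] (φ : F)
    (t : Fin 4 → A) (S : Finset (Fin 4)) : φ (mon t S) = mon (fun μ => φ (t μ)) S := by
  rw [mon, map_list_prod, List.map_map]
  rfl

variable {t : Fin 4 → A}

theorem prod_map_eq_mon (ht : ∀ μ ν, t μ * t ν = -(t ν * t μ))
    {l : List (Fin 4)} (hl : l.Nodup) :
    (l.map t).prod = mon t l.toFinset ∨ (l.map t).prod = -mon t l.toFinset := by
  refine prod_map_perm ht ?_
  rw [List.perm_iff_count]
  intro a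
  have h1 := Finset.sort_nodup l.toFinset (· ≤ ·)
  rw [hl.count, h1.count]
  simp

theorem mon_mul_of_notMem (ht : ∀ μ ν, t μ * t ν = -(t ν * t μ))
    {S : Finset (Fin 4)} {μ : Fin 4} (h : μ ∉ S) :
    mon t S * t μ = mon t (insert μ S) ∨ mon t S * t μ = -mon t (insert μ S) := by
  have hn : (S.sort (· ≤ ·) ++ [μ]).Nodup := by
    rw [List.nodup_append]
    refine ⟨Finset.sort_nodup _ _, by simp, ?_⟩
    intro a ha b hb
    rw [List.mem_singleton] at hb
    rintro rfl
    exact h (by simpa [hb] using ha)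
  have h1 := prod_map_eq_mon ht hn
  have h2 : (S.sort (· ≤ ·) ++ [μ]).toFinset = insert μ S := by
    ext a; simp
  rw [h2] at h1
  simpa [mon] using h1

theorem mon_mul_of_mem (ht : ∀ μ ν, t μ * t ν = -(t ν * t μ))
    (ht0 : ∀ μ, t μ * t μ = 0) {S : Finset (Fin 4)} {μ : Fin 4} (h : μ ∈ S) :
    mon t S * t μ = 0 :=
  prod_map_mul_of_mem ht ht0 (by simpa using h)

theorem mon_mul_mon (ht : ∀ μ ν, t μ * t ν = -(t ν * t μ))
    (ht0 : ∀ μ, t μ * t μ = 0) (S T : Finset (Fin 4)) :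
    (Disjoint S T ∧ (mon t S * mon t T = mon t (S ∪ T) ∨ mon t S * mon t T = -mon t (S ∪ T))) ∨
      (¬ Disjoint S T ∧ mon t S * mon t T = 0) := by
  have h0 : mon t S * mon t T = ((S.sort (· ≤ ·) ++ T.sort (· ≤ ·)).map t).prod := by
    rw [List.map_append, List.prod_append]; rfl
  by_cases h : Disjoint S T
  · refine Or.inl ⟨h, ?_⟩
    have hn : (S.sort (· ≤ ·) ++ T.sort (· ≤ ·)).Nodup := by
      rw [List.nodup_append]
      refine ⟨Finset.sort_nodup _ _, Finset.sort_nodup _ _, ?_⟩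
      rintro a ha b hb rfl
      rw [Finset.mem_sort] at ha hb
      exact Finset.disjoint_left.1 h ha hb
    have h2 : (S.sort (· ≤ ·) ++ T.sort (· ≤ ·)).toFinset = S ∪ T := by
      ext a; simp
    rw [h0, ← h2]
    exact prod_map_eq_mon ht hn
  · refine Or.inr ⟨h, ?_⟩
    obtain ⟨μ, hS, hT⟩ := Finset.not_disjoint_iff.1 h
    have hmem : μ ∈ T.sort (· ≤ ·) := by simpa using hT
    have hp : (T.sort (· ≤ ·)).Perm (μ :: (T.sort (· ≤ ·)).erase μ) := List.perm_cons_erase hmem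
    have h3 : mon t S * ((μ :: (T.sort (· ≤ ·)).erase μ).map t).prod = 0 := by
      rw [List.map_cons, List.prod_cons, ← mul_assoc, mon_mul_of_mem ht ht0 hS, zero_mul]
    change mon t S * ((T.sort (· ≤ ·)).map t).prod = 0
    rcases prod_map_perm ht hp with h1 | h1 <;> rw [h1]
    · exact h3
    · rw [mul_neg, h3, neg_zero]

end Monomials

/-! ### The exterior algebra on four generators -/

/-- The exterior algebra on four generators. -/
abbrev Ext4 : Type := ExteriorAlgebra ℝ (Fin 4 → ℝ)

/-- The generators of the exterior algebra. -/
noncomputable def gen (μ : Fin 4) : Ext4 := ExteriorAlgebra.ι ℝ (Pi.single μ 1)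

theorem gen_mul_gen (μ ν : Fin 4) : gen μ * gen ν = -(gen ν * gen μ) :=
  eq_neg_of_add_eq_zero_left (ExteriorAlgebra.ι_add_mul_swap _ _)

theorem gen_mul_self (μ : Fin 4) : gen μ * gen μ = 0 := ExteriorAlgebra.ι_sq_zero _

theorem ι_eq_sum_gen (v : Fin 4 → ℝ) : ExteriorAlgebra.ι ℝ v = ∑ μ, v μ • gen μ := by
  conv_lhs => rw [pi_eq_sum_univ' v, map_sum]
  refine Finset.sum_congr rfl fun μ _ => ?_
  rw [map_smul, gen]

/-- The homogeneous elements of degree `k`. -/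
abbrev deg (k : ℕ) : Submodule ℝ Ext4 := LinearMap.range (ExteriorAlgebra.ι ℝ) ^ k

theorem gen_mem (μ : Fin 4) : gen μ ∈ deg 1 := by
  rw [deg, pow_one]; exact LinearMap.mem_range_self _ _

theorem mul_mem_deg {x y : Ext4} {j k : ℕ} (hx : x ∈ deg j) (hy : y ∈ deg k) :
    x * y ∈ deg (j + k) := by
  rw [deg, pow_add]; exact Submodule.mul_mem_mul hx hy

theorem mon_mem (S : Finset (Fin 4)) : mon gen S ∈ deg S.card := by
  have h (l : List (Fin 4)) : (l.map gen).prod ∈ deg l.length := by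
    induction l with
    | nil => rw [List.length_nil, deg, pow_zero]; exact Submodule.one_le.1 le_rfl
    | cons μ l ih =>
      rw [List.map_cons, List.prod_cons, List.length_cons, add_comm]
      exact mul_mem_deg (gen_mem μ) ih
  have := h (S.sort (· ≤ ·))
  rwa [Finset.length_sort] at this

theorem deg_le_span (k : ℕ) :
    deg k ≤ Submodule.span ℝ (mon gen '' {S : Finset (Fin 4) | S.card = k}) := by
  induction k with
  | zero =>
    rw [deg, pow_zero, Submodule.one_le]
    exact Submodule.subset_span ⟨∅, by simp, mon_empty _⟩
  | succ k ih =>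
    rw [deg, pow_succ, Submodule.mul_le]
    rintro m hm _ ⟨v, rfl⟩
    rw [ι_eq_sum_gen, Finset.mul_sum]
    refine Submodule.sum_mem _ fun μ _ => ?_
    rw [mul_smul_comm]
    refine Submodule.smul_mem _ _ ?_
    refine Submodule.span_induction (p := fun m _ => m * gen μ ∈ _) ?_ ?_ ?_ ?_ (ih hm)
    · rintro _ ⟨S, hS, rfl⟩
      by_cases h : μ ∈ S
      · rw [mon_mul_of_mem gen_mul_gen gen_mul_self h]; exact Submodule.zero_mem _
      · have h3 : mon gen (insert μ S) ∈
            Submodule.span ℝ (mon gen '' {S : Finset (Fin 4) | S.card = k + 1}) :=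
          Submodule.subset_span ⟨_, by
            rw [Set.mem_ofPred_eq] at hS ⊢
            rw [Finset.card_insert_of_notMem h, hS], rfl⟩
        rcases mon_mul_of_notMem gen_mul_gen h with h1 | h1 <;> rw [h1]
        · exact h3
        · exact Submodule.neg_mem _ h3
    · rw [zero_mul]; exact Submodule.zero_mem _
    · intro x y _ _ hx hy; rw [add_mul]; exact Submodule.add_mem _ hx hy
    · intro r x _ hx; rw [smul_mul_assoc]; exact Submodule.smul_mem _ _ hx

theorem top_le_span_mon : ⊤ ≤ Submodule.span ℝ (Set.range (mon gen)) := by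
  classical
  rintro x -
  have hdeg (k : ℕ) : deg k ≤ Submodule.span ℝ (Set.range (mon gen)) :=
    (deg_le_span k).trans (Submodule.span_mono (Set.image_subset_range _ _))
  rw [← DirectSum.sum_support_decompose (fun i : ℕ => ⋀[ℝ]^i (Fin 4 → ℝ)) x]
  exact Submodule.sum_mem _ fun i _ => hdeg i (SetLike.coe_mem _)

/-- The monomials form a basis of the exterior algebra. -/
noncomputable def monBasis : Module.Basis (Finset (Fin 4)) ℝ Ext4 :=
  basisOfTopLeSpanOfCardEqFinrank (mon gen) top_le_span_mon
    (Module.finrank_eq_card_basis (Pi.basisFun ℝ (Fin 4)).ExteriorAlgebra).symm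

theorem monBasis_apply (S : Finset (Fin 4)) : monBasis S = mon gen S := by
  simp [monBasis]

/-- The coefficient of the top monomial. -/
noncomputable def topCoeff : Ext4 →ₗ[ℝ] ℝ := monBasis.coord Finset.univ

theorem topCoeff_mon (S : Finset (Fin 4)) :
    topCoeff (mon gen S) = if S = Finset.univ then 1 else 0 := by
  rw [topCoeff, Module.Basis.coord_apply, ← monBasis_apply, Module.Basis.repr_self,
    Finsupp.single_apply]

theorem topCoeff_of_mem {k : ℕ} (hk : k < 4) {x : Ext4} (hx : x ∈ deg k) : topCoeff x = 0 := by
  refine Submodule.span_induction (p := fun x _ => topCoeff x = 0) ?_ (map_zero _) ?_ ?_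
    (deg_le_span k hx)
  · rintro _ ⟨S, hS, rfl⟩
    rw [topCoeff_mon, if_neg]
    rintro rfl
    rw [Set.mem_ofPred_eq] at hS
    simp at hS
    omega
  · intro x y _ _ hx hy; rw [map_add, hx, hy, add_zero]
  · intro r x _ hx; rw [map_smul, hx, smul_zero]

theorem eq_zero_of_topCoeff {x : Ext4} (h : ∀ T, topCoeff (x * mon gen T) = 0) : x = 0 := by
  have hx : x = ∑ S, monBasis.repr x S • mon gen S := by
    conv_lhs => rw [← monBasis.sum_repr x]
    simp only [monBasis_apply]
  have key (S : Finset (Fin 4)) : monBasis.repr x S = 0 := by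
    have h1 := h Sᶜ
    rw [hx, Finset.sum_mul, map_sum, Finset.sum_eq_single S] at h1
    · rw [smul_mul_assoc, map_smul] at h1
      rcases mon_mul_mon gen_mul_gen gen_mul_self S Sᶜ with ⟨_, h2 | h2⟩ | ⟨h2, _⟩
      · rw [h2, topCoeff_mon] at h1; simpa using h1
      · rw [h2, map_neg, topCoeff_mon] at h1; simpa using h1
      · exact absurd disjoint_compl_right h2
    · intro T _ hT
      rw [smul_mul_assoc, map_smul]
      rcases mon_mul_mon gen_mul_gen gen_mul_self T Sᶜ with ⟨hd, h2⟩ | ⟨_, h2⟩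
      · have hu : T ∪ Sᶜ ≠ Finset.univ := by
          intro hu
          refine hT (Finset.Subset.antisymm ?_ ?_)
          · intro a ha
            by_contra hS
            exact Finset.disjoint_left.1 hd ha (Finset.mem_compl.2 hS)
          · intro a ha
            have : a ∈ T ∪ Sᶜ := hu ▸ Finset.mem_univ a
            simpa [ha] using this
        rcases h2 with h2 | h2 <;> rw [h2] <;> simp [topCoeff_mon, hu]
      · rw [h2, map_zero, smul_zero]
    · simp
  rw [hx]
  exact Finset.sum_eq_zero fun S _ => by rw [key, zero_smul]

/-- The projection to the elements of degree `k`. -/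
noncomputable def degProj (k : ℕ) : Ext4 →ₗ[ℝ] Ext4 :=
  monBasis.constr ℝ fun S => if S.card = k then mon gen S else 0

theorem degProj_mon (k : ℕ) (S : Finset (Fin 4)) :
    degProj k (mon gen S) = if S.card = k then mon gen S else 0 := by
  rw [← monBasis_apply, degProj, Module.Basis.constr_basis, monBasis_apply]

theorem degProj_mem (k : ℕ) (x : Ext4) : degProj k x ∈ deg k := by
  rw [← monBasis.sum_repr x, map_sum]
  refine Submodule.sum_mem _ fun S _ => ?_
  rw [map_smul, monBasis_apply, degProj_mon]
  refine Submodule.smul_mem _ _ ?_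
  split_ifs with h
  · rw [← h]; exact mon_mem S
  · exact Submodule.zero_mem _

theorem sum_degProj (x : Ext4) : ∑ k ∈ Finset.range 5, degProj k x = x := by
  have h : ∑ k ∈ Finset.range 5, degProj k = LinearMap.id := by
    refine monBasis.ext fun S => ?_
    rw [monBasis_apply, LinearMap.sum_apply, LinearMap.id_apply]
    simp only [degProj_mon]
    rw [Finset.sum_ite_eq, if_pos]
    have := Finset.card_le_univ S
    simp at this ⊢
    omega
  simpa using LinearMap.congr_fun h x

theorem degProj_mul_gen (k : ℕ) (x : Ext4) (μ : Fin 4) :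
    degProj (k + 1) (x * gen μ) = degProj k x * gen μ := by
  have h : (degProj (k + 1)) ∘ₗ LinearMap.mulRight ℝ (gen μ) =
      LinearMap.mulRight ℝ (gen μ) ∘ₗ degProj k := by
    refine monBasis.ext fun S => ?_
    simp only [monBasis_apply, LinearMap.comp_apply, LinearMap.mulRight_apply, degProj_mon]
    by_cases h : μ ∈ S
    · rw [mon_mul_of_mem gen_mul_gen gen_mul_self h, map_zero]
      split_ifs
      · rw [mon_mul_of_mem gen_mul_gen gen_mul_self h]
      · rw [zero_mul]
    · have hc := Finset.card_insert_of_notMem h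
      have h2 : degProj (k + 1) (mon gen (insert μ S)) =
          if S.card = k then mon gen (insert μ S) else 0 := by
        rw [degProj_mon, hc]; simp
      rcases mon_mul_of_notMem gen_mul_gen h with h1 | h1
      · rw [h1, h2, ite_mul, zero_mul, h1]
      · rw [h1, map_neg, h2, ite_mul, zero_mul, h1]
        split_ifs <;> simp
  exact LinearMap.congr_fun h x

instance : Module.Finite ℝ Ext4 := Module.Finite.of_basis monBasis

end Sugra

namespace Sugra

/-! ### Linear algebra of the kernel equations over the exterior algebra -/

/-- The Levi-Civita symbol as an integer. -/
def leviCivitaInt (a b c d : Fin 4) : ℤ :=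
  ((b : ℤ) - a) * (c - a) * (d - a) * (c - b) * (d - b) * (d - c) / 12

theorem leviCivita_eq (a b c d : Fin 4) : leviCivita a b c d = (leviCivitaInt a b c d : ℝ) := by
  have h : Matrix.det (Matrix.of fun i j : Fin 4 => if ![a, b, c, d] i = j then (1 : ℤ) else 0) =
      leviCivitaInt a b c d := by
    rw [Matrix.det_succ_row_zero]
    simp only [Fin.sum_univ_succ, Matrix.det_fin_three]
    revert a b c d
    decide +kernel
  rw [← h, leviCivita, Int.cast_det]
  congr 1
  ext i j
  simp [Matrix.map_apply]

theorem leviCivita_swap (a b c d : Fin 4) : leviCivita a b c d = -leviCivita a c b d := by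
  have h : leviCivitaInt a b c d = -leviCivitaInt a c b d := by
    revert a b c d
    decide +kernel
  rw [leviCivita_eq, leviCivita_eq, h, Int.cast_neg]

theorem leviCivita_contract (a b c d : Fin 4) :
    ∑ m, ∑ n, leviCivita a m n b * leviCivita c m n d =
      2 * ((if a = c then 1 else 0) * (if b = d then 1 else 0) -
        (if a = d then 1 else 0) * (if b = c then 1 else 0)) := by
  have h : ∑ m, ∑ n, leviCivitaInt a m n b * leviCivitaInt c m n d =
      2 * ((if a = c then 1 else 0) * (if b = d then 1 else 0) -
        (if a = d then 1 else 0) * (if b = c then 1 else 0)) := by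
    revert a b c d
    decide +kernel
  simp only [leviCivita_eq]
  exact_mod_cast congrArg (Int.cast (R := ℝ)) h

theorem antisymm_of_swap {A : Type*} [AddCommGroup A] [Module ℝ A] (f : Fin 4 → Fin 4 → A)
    (hf : ∀ b c, f b c = -f c b) (b c : Fin 4) :
    antisymm (fun q : LorentzPair => f q.1.1 q.1.2) b c = f b c := by
  unfold antisymm
  split_ifs with h1 h2
  · rfl
  · exact (hf b c).symm
  · obtain rfl : b = c := by omega
    have h := hf b b
    rw [← add_eq_zero_iff_eq_neg, ← two_smul ℝ] at h
    exact ((smul_eq_zero.1 h).resolve_left (by norm_num)).symm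

theorem exists_eq_sum_mul_gen {k : ℕ} {y : Ext4} (hy : y ∈ deg (k + 1)) :
    ∃ l : Fin 4 → Ext4, (∀ p, l p ∈ deg k) ∧ y = ∑ p, l p * gen p := by
  rw [deg, pow_succ] at hy
  refine Submodule.mul_induction_on hy ?_ ?_
  · rintro m hm _ ⟨v, rfl⟩
    refine ⟨fun p => v p • m, fun p => Submodule.smul_mem _ _ hm, ?_⟩
    rw [ι_eq_sum_gen, Finset.mul_sum]
    simp only [mul_smul_comm, smul_mul_assoc]
  · rintro x y ⟨l, hl, rfl⟩ ⟨l', hl', rfl⟩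
    exact ⟨fun p => l p + l' p, fun p => Submodule.add_mem _ (hl p) (hl' p), by
      simp only [add_mul, Finset.sum_add_distrib]⟩

theorem exists_eq_sum_mul_gen_gen {k : ℕ} {y : Ext4} (hy : y ∈ deg (k + 2)) :
    ∃ l : Fin 4 → Fin 4 → Ext4, (∀ p q, l p q ∈ deg k) ∧
      y = ∑ p, ∑ q, l p q * (gen p * gen q) := by
  obtain ⟨l, hl, rfl⟩ := exists_eq_sum_mul_gen hy
  choose l' hl' h using fun q => exists_eq_sum_mul_gen (hl q)
  refine ⟨fun p q => l' q p, fun p q => hl' q p, ?_⟩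
  rw [Finset.sum_comm]
  refine Finset.sum_congr rfl fun q _ => ?_
  rw [h q, Finset.sum_mul]
  simp only [mul_assoc]

theorem sum_symm_mul_gen_gen (G : Fin 4 → Fin 4 → Ext4) (hG : ∀ m d, G m d = G d m) :
    ∑ d, ∑ m, G m d * (gen m * gen d) = 0 := by
  have h : ∑ d, ∑ m, G m d * (gen m * gen d) = -∑ d, ∑ m, G m d * (gen m * gen d) := by
    conv_lhs => rw [Finset.sum_comm]
    rw [← Finset.sum_neg_distrib]
    refine Finset.sum_congr rfl fun d _ => ?_
    rw [← Finset.sum_neg_distrib]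
    refine Finset.sum_congr rfl fun m _ => ?_
    rw [hG, gen_mul_gen, mul_neg]
  rw [← add_eq_zero_iff_eq_neg, ← two_smul ℝ] at h
  exact (smul_eq_zero.1 h).resolve_left (by norm_num)

/-- The operator through which `ρ` enters the coefficient of `dξ^a`. -/
noncomputable def rhoOp (r : LorentzPair → Ext4) (a : Fin 4) : Ext4 :=
  ∑ b, ∑ c, ∑ d, leviCivita a b c d • (antisymm r b c * gen d)

/-- The operator through which `ψ` enters the coefficient of `dψ^β`. -/
noncomputable def psiOp (s : Fin 4 → Ext4) (β : Fin 4) : Ext4 :=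
  ∑ a, ∑ α, spinMatrix a α β • (s α * gen a)

theorem exists_antisymm_preimage {k : ℕ} {y : Fin 4 → Ext4} (hy : ∀ a, y a ∈ deg (k + 2)) :
    ∃ s : Fin 4 → Fin 4 → Ext4, (∀ a d, s a d ∈ deg (k + 1)) ∧ (∀ a d, s a d = -s d a) ∧
      ∀ a, ∑ d, s a d * gen d = y a := by
  choose l hl h using fun a => exists_eq_sum_mul_gen_gen (hy a)
  set Y : Fin 4 → Fin 4 → Fin 4 → Ext4 := fun a m d => (1 / 2 : ℝ) • (l a m d - l a d m) with hY
  have hYmem (a m d) : Y a m d ∈ deg k :=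
    Submodule.smul_mem _ _ (Submodule.sub_mem _ (hl _ _ _) (hl _ _ _))
  have hYs (a m d) : Y a m d = -Y a d m := by
    simp only [hY]; module
  refine ⟨fun a d => ∑ m, (Y a m d - Y d m a + Y m a d) * gen m, ?_, ?_, ?_⟩
  · intro a d
    exact Submodule.sum_mem _ fun m _ => mul_mem_deg (Submodule.add_mem _
      (Submodule.sub_mem _ (hYmem _ _ _) (hYmem _ _ _)) (hYmem _ _ _)) (gen_mem m)
  · intro a d
    rw [← Finset.sum_neg_distrib]
    refine Finset.sum_congr rfl fun m _ => ?_
    rw [← neg_mul, hYs m d a]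
    congr 1
    abel
  · intro a
    have h0 := sum_symm_mul_gen_gen (fun m d => Y a m d - Y d m a + Y m a d - l a m d) (by
      intro m d
      simp only [hY]
      module)
    simp only [sub_mul _ (l a _ _), Finset.sum_sub_distrib, sub_eq_zero] at h0
    rw [h a, Finset.sum_comm, ← h0]
    simp only [Finset.sum_mul, mul_assoc]

theorem exists_rhoOp_eq {k : ℕ} {y : Fin 4 → Ext4} (hy : ∀ a, y a ∈ deg (k + 2)) :
    ∃ r : LorentzPair → Ext4, (∀ q, r q ∈ deg (k + 1)) ∧ ∀ a, rhoOp r a = y a := by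
  obtain ⟨s, hs, hss, h⟩ := exists_antisymm_preimage hy
  set f : Fin 4 → Fin 4 → Ext4 := fun b c =>
    (1 / 4 : ℝ) • ∑ a, ∑ d, leviCivita a b c d • s a d with hf
  have hfs (b c) : f b c = -f c b := by
    simp only [hf, leviCivita_swap _ b c, neg_smul, Finset.sum_neg_distrib, smul_neg]
  refine ⟨fun q => f q.1.1 q.1.2, fun q => Submodule.smul_mem _ _ (Submodule.sum_mem _ fun a _ =>
    Submodule.sum_mem _ fun d _ => Submodule.smul_mem _ _ (hs a d)), fun a => ?_⟩
  simp only [rhoOp, antisymm_of_swap f hfs]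
  have key (d : Fin 4) : ∑ b, ∑ c, leviCivita a b c d • f b c = s a d := by
    have e1 : ∑ b, ∑ c, leviCivita a b c d • f b c =
        ∑ a', ∑ d', ((1 / 4 : ℝ) * ∑ b, ∑ c, leviCivita a b c d * leviCivita a' b c d') •
          s a' d' := by
      simp only [hf, Finset.smul_sum, Finset.mul_sum, Finset.sum_smul]
      rw [Finset.sum_comm_cycle]
      refine Finset.sum_congr rfl fun a' _ => ?_
      rw [Finset.sum_comm_cycle]
      refine Finset.sum_congr rfl fun d' _ => Finset.sum_congr rfl fun b _ =>
        Finset.sum_congr rfl fun c _ => ?_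
      rw [smul_smul, smul_smul]
      congr 1
      ring
    have e2 (a' d' : Fin 4) : ((1 / 4 : ℝ) * (2 * ((if a = a' then 1 else 0) *
        (if d = d' then 1 else 0) - (if a = d' then 1 else 0) * (if d = a' then 1 else 0)))) •
          s a' d' = (if a = a' then if d = d' then (1 / 2 : ℝ) • s a' d' else 0 else 0) +
            (if d = a' then if a = d' then (-1 / 2 : ℝ) • s a' d' else 0 else 0) := by
      split_ifs <;> norm_num
    rw [e1]
    simp only [leviCivita_contract, e2, Finset.sum_add_distrib, Finset.sum_ite_eq,
      Finset.sum_ite_irrel, Finset.mem_univ, if_true, Finset.sum_const_zero]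
    rw [hss d a]
    module
  rw [← h a]
  have e2 : ∑ b, ∑ c, ∑ d, leviCivita a b c d • (f b c * gen d) =
      ∑ d, (∑ b, ∑ c, leviCivita a b c d • f b c) * gen d := by
    simp only [Finset.sum_mul, smul_mul_assoc]
    rw [Finset.sum_comm_cycle]
  rw [e2]
  simp only [key]

theorem spinMatrix_explicit :
    spinMatrix 0 = !![0, 4, 0, 0; -4, 0, 0, 0; 0, 0, 0, 4; 0, 0, -4, 0] ∧
    spinMatrix 1 = !![0, 0, 0, 4; 0, 0, -4, 0; 0, 4, 0, 0; -4, 0, 0, 0] ∧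
    spinMatrix 2 = !![0, 0, -4, 0; 0, 0, 0, -4; 4, 0, 0, 0; 0, 4, 0, 0] ∧
    spinMatrix 3 = !![0, 4, 0, 0; -4, 0, 0, 0; 0, 0, 0, -4; 0, 0, 4, 0] := by
  obtain ⟨h0, h1, h2, h3⟩ := spinMatrixC_explicit
  refine ⟨?_, ?_, ?_, ?_⟩ <;> ext α β <;> simp only [spinMatrix, h0, h1, h2, h3] <;>
    fin_cases α <;> fin_cases β <;> simp

/-- The monomials of degree three. -/
noncomputable def genTriple : Fin 4 → Ext4 :=
  ![gen 1 * (gen 2 * gen 3), gen 0 * (gen 2 * gen 3), gen 0 * (gen 1 * gen 3),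
    gen 0 * (gen 1 * gen 2)]

theorem mon_eq_genTriple {S : Finset (Fin 4)} (h : S.card = 3) : ∃ i, mon gen S = genTriple i := by
  set t : Fin 4 → List (Fin 4) := ![[1, 2, 3], [0, 2, 3], [0, 1, 3], [0, 1, 2]] with ht
  have h4 : ∀ S : Finset (Fin 4), S.card = 3 → ∃ i, S = (t i).toFinset := by decide
  have h5 : ∀ i, (t i).Nodup ∧ (t i).Pairwise (· ≤ ·) := by decide
  obtain ⟨i, rfl⟩ := h4 S h
  refine ⟨i, ?_⟩
  rw [mon, (List.toFinset_sort (· ≤ ·) (h5 i).1).2 (h5 i).2]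
  fin_cases i <;> simp [genTriple, ht]

theorem exists_eq_sum_mul_genTriple {k : ℕ} {y : Ext4} (hy : y ∈ deg (k + 3)) :
    ∃ l : Fin 4 → Ext4, (∀ i, l i ∈ deg k) ∧ y = ∑ i, l i * genTriple i := by
  rw [deg, pow_add] at hy
  refine Submodule.mul_induction_on hy ?_ ?_
  · rintro m hm n hn
    refine Submodule.span_induction (p := fun n _ => ∃ l : Fin 4 → Ext4, (∀ i, l i ∈ deg k) ∧
      m * n = ∑ i, l i * genTriple i) ?_ ?_ ?_ ?_ (deg_le_span 3 hn)
    · rintro _ ⟨S, hS, rfl⟩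
      obtain ⟨i, hi⟩ := mon_eq_genTriple hS
      refine ⟨Pi.single i m, fun j => ?_, ?_⟩
      · rw [Pi.single_apply]; split_ifs
        exacts [hm, Submodule.zero_mem _]
      · rw [hi, Finset.sum_eq_single i]
        · simp
        · intro j _ hj; simp [hj]
        · simp
    · exact ⟨0, fun i => Submodule.zero_mem _, by simp⟩
    · rintro x y _ _ ⟨l, hl, h⟩ ⟨l', hl', h'⟩
      exact ⟨fun p => l p + l' p, fun p => Submodule.add_mem _ (hl p) (hl' p), by
        simp only [mul_add, h, h', add_mul, Finset.sum_add_distrib]⟩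
    · rintro r x _ ⟨l, hl, h⟩
      exact ⟨fun p => r • l p, fun p => Submodule.smul_mem _ _ (hl p), by
        simp only [mul_smul_comm, h, smul_mul_assoc, Finset.smul_sum]⟩
  · rintro x y ⟨l, hl, rfl⟩ ⟨l', hl', rfl⟩
    exact ⟨fun p => l p + l' p, fun p => Submodule.add_mem _ (hl p) (hl' p), by
      simp only [add_mul, Finset.sum_add_distrib]⟩

/-- The coefficients of a preimage under `psiOp` of the element with coefficients `l` in the
monomials of degree three. -/
noncomputable def psiCoeff (l : Fin 4 → Fin 4 → Ext4) : Fin 4 → Fin 4 → Ext4 :=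
  ![![(1 / 8 : ℝ) • (-l 0 0 + l 0 3 + l 2 1 - l 3 2), (1 / 4 : ℝ) • (l 1 3), (1 / 8 : ℝ) • (-l 0 1 + l 1 2 + l 2 0 + l 2 3), (1 / 8 : ℝ) • (l 0 2 + l 1 1 + l 3 0 + l 3 3)],
    ![(1 / 8 : ℝ) • (-l 1 0 + l 1 3 + l 2 2 + l 3 1), (1 / 4 : ℝ) • (-l 0 3), (1 / 8 : ℝ) • (-l 0 2 - l 1 1 + l 3 0 + l 3 3), (1 / 8 : ℝ) • (-l 0 1 + l 1 2 - l 2 0 - l 2 3)],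
    ![(1 / 8 : ℝ) • (-l 0 1 - l 1 2 + l 2 0 + l 2 3), (1 / 4 : ℝ) • (l 3 3), (1 / 8 : ℝ) • (-l 0 0 + l 0 3 + l 2 1 + l 3 2), (1 / 8 : ℝ) • (l 1 0 - l 1 3 - l 2 2 + l 3 1)],
    ![(1 / 8 : ℝ) • (l 0 2 - l 1 1 + l 3 0 + l 3 3), (1 / 4 : ℝ) • (-l 2 3), (1 / 8 : ℝ) • (-l 1 0 + l 1 3 - l 2 2 + l 3 1), (1 / 8 : ℝ) • (-l 0 0 + l 0 3 - l 2 1 - l 3 2)]]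

/-- The element with coefficients `x` in the monomials `θ^0θ^3`, `θ^1θ^2`, `θ^1θ^3`, `θ^2θ^3`. -/
noncomputable def pairSum (x : Fin 4 → Ext4) : Ext4 :=
  x 0 * (gen 0 * gen 3) + x 1 * (gen 1 * gen 2) + x 2 * (gen 1 * gen 3) + x 3 * (gen 2 * gen 3)

theorem gen_triple_mul :
    gen 0 * (gen 3 * gen 0) = 0 ∧ gen 0 * (gen 3 * gen 1) = -genTriple 2 ∧
    gen 0 * (gen 3 * gen 2) = -genTriple 1 ∧ gen 0 * (gen 3 * gen 3) = 0 ∧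
    gen 1 * (gen 2 * gen 0) = genTriple 3 ∧ gen 1 * (gen 2 * gen 1) = 0 ∧
    gen 1 * (gen 2 * gen 2) = 0 ∧ gen 1 * (gen 2 * gen 3) = genTriple 0 ∧
    gen 1 * (gen 3 * gen 0) = genTriple 2 ∧ gen 1 * (gen 3 * gen 1) = 0 ∧
    gen 1 * (gen 3 * gen 2) = -genTriple 0 ∧ gen 1 * (gen 3 * gen 3) = 0 ∧
    gen 2 * (gen 3 * gen 0) = genTriple 1 ∧ gen 2 * (gen 3 * gen 1) = genTriple 0 ∧
    gen 2 * (gen 3 * gen 2) = 0 ∧ gen 2 * (gen 3 * gen 3) = 0 := by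
  have hz (x y : Fin 4) : gen x * (gen y * gen x) = 0 := by
    rw [gen_mul_gen y x, mul_neg, ← mul_assoc, gen_mul_self, zero_mul, neg_zero]
  have hr (x y z : Fin 4) : gen x * (gen y * gen z) = gen z * (gen x * gen y) := by
    rw [gen_mul_gen y z, mul_neg, ← mul_assoc, gen_mul_gen x z, neg_mul, neg_neg, mul_assoc]
  have hs (x y z : Fin 4) : gen x * (gen y * gen z) = -(gen x * (gen z * gen y)) := by
    rw [gen_mul_gen y z, mul_neg]
  refine ⟨hz _ _, hs _ _ _, hs _ _ _, ?_, hr _ _ _, hz _ _, ?_, rfl, hr _ _ _, hz _ _, hs _ _ _, ?_,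
    hr _ _ _, hr _ _ _ |>.trans rfl, hz _ _, ?_⟩ <;> rw [gen_mul_self, mul_zero]

theorem pairSum_mul_gen (x : Fin 4 → Ext4) :
    pairSum x * gen 0 = x 1 * genTriple 3 + x 2 * genTriple 2 + x 3 * genTriple 1 ∧
    pairSum x * gen 1 = -(x 0 * genTriple 2) + x 3 * genTriple 0 ∧
    pairSum x * gen 2 = -(x 0 * genTriple 1) - x 2 * genTriple 0 ∧
    pairSum x * gen 3 = x 1 * genTriple 0 := by
  obtain ⟨t1, t2, t3, t4, t5, t6, t7, t8, t9, t10, t11, t12, t13, t14, t15, t16⟩ := gen_triple_mul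
  refine ⟨?_, ?_, ?_, ?_⟩ <;>
    simp only [pairSum, add_mul, mul_assoc, t1, t2, t3, t4, t5, t6, t7, t8, t9, t10, t11, t12, t13,
      t14, t15, t16, mul_neg, mul_zero, add_zero, zero_add, sub_eq_add_neg]

theorem psiOp_pairSum (l : Fin 4 → Fin 4 → Ext4) (β : Fin 4) :
    psiOp (fun α => pairSum (psiCoeff l α)) β = ∑ i, l β i * genTriple i := by
  obtain ⟨h0, h1, h2, h3⟩ := spinMatrix_explicit
  have e (x : Fin 4 → Fin 4 → Ext4) : psiOp (fun α => pairSum (x α)) β =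
      (∑ α, (spinMatrix 1 α β • x α 3 - spinMatrix 2 α β • x α 2 + spinMatrix 3 α β • x α 1)) *
        genTriple 0 +
      (∑ α, (spinMatrix 0 α β • x α 3 - spinMatrix 2 α β • x α 0)) * genTriple 1 +
      (∑ α, (spinMatrix 0 α β • x α 2 - spinMatrix 1 α β • x α 0)) * genTriple 2 +
      (∑ α, spinMatrix 0 α β • x α 1) * genTriple 3 := by
    rw [psiOp, Finset.sum_comm]
    simp only [Finset.sum_mul, ← Finset.sum_add_distrib]
    refine Finset.sum_congr rfl fun α _ => ?_
    obtain ⟨g0, g1, g2, g3⟩ := pairSum_mul_gen (x α)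
    rw [Fin.sum_univ_four, g0, g1, g2, g3]
    simp only [smul_add, smul_sub, smul_neg, add_mul, sub_mul, smul_mul_assoc]
    abel
  rw [e, Fin.sum_univ_four (fun i => l β i * genTriple i)]
  have hc : (∑ α, (spinMatrix 1 α β • psiCoeff l α 3 - spinMatrix 2 α β • psiCoeff l α 2 +
        spinMatrix 3 α β • psiCoeff l α 1)) = l β 0 ∧
      (∑ α, (spinMatrix 0 α β • psiCoeff l α 3 - spinMatrix 2 α β • psiCoeff l α 0)) = l β 1 ∧
      (∑ α, (spinMatrix 0 α β • psiCoeff l α 2 - spinMatrix 1 α β • psiCoeff l α 0)) = l β 2 ∧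
      (∑ α, spinMatrix 0 α β • psiCoeff l α 1) = l β 3 := by
    rw [h0, h1, h2, h3]
    simp only [Fin.sum_univ_four, psiCoeff]
    fin_cases β <;> refine ⟨?_, ?_, ?_, ?_⟩ <;> simp <;> module
  rw [hc.1, hc.2.1, hc.2.2.1, hc.2.2.2]

theorem psiCoeff_mem {p : Submodule ℝ Ext4} {l : Fin 4 → Fin 4 → Ext4} (hl : ∀ β i, l β i ∈ p)
    (α j : Fin 4) : psiCoeff l α j ∈ p := by
  fin_cases α <;> fin_cases j <;> refine Submodule.smul_mem _ _ ?_ <;>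
    repeat first
      | exact hl _ _
      | refine Submodule.add_mem _ ?_ ?_
      | refine Submodule.sub_mem _ ?_ ?_
      | refine Submodule.neg_mem _ ?_

theorem exists_psiOp_eq {k : ℕ} {y : Fin 4 → Ext4} (hy : ∀ β, y β ∈ deg (k + 3)) :
    ∃ s : Fin 4 → Ext4, (∀ α, s α ∈ deg (k + 2)) ∧ ∀ β, psiOp s β = y β := by
  choose l hl h using fun β => exists_eq_sum_mul_genTriple (hy β)
  refine ⟨fun α => pairSum (psiCoeff l α), fun α => ?_, fun β => by rw [psiOp_pairSum, h β]⟩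
  have ht (p q j : Fin 4) : psiCoeff l α j * (gen p * gen q) ∈ deg (k + 2) :=
    mul_mem_deg (psiCoeff_mem hl α j) (mul_mem_deg (gen_mem p) (gen_mem q))
  exact Submodule.add_mem _ (Submodule.add_mem _ (Submodule.add_mem _ (ht _ _ _) (ht _ _ _))
    (ht _ _ _)) (ht _ _ _)

end Sugra

namespace Sugra

/-! ### Solutions of the kernel equations over the exterior algebra -/

theorem mul_gen_of_mem {k : ℕ} {x : Ext4} (hx : x ∈ deg k) (μ : Fin 4) :
    gen μ * x = (-1 : ℝ) ^ k • (x * gen μ) := by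
  refine Submodule.span_induction
    (p := fun x _ => gen μ * x = (-1 : ℝ) ^ k • (x * gen μ)) ?_ ?_ ?_ ?_ (deg_le_span k hx)
  · rintro _ ⟨S, hS, rfl⟩
    rw [Set.mem_ofPred_eq] at hS
    rw [mon, ← hS, ← Finset.length_sort (s := S) (· ≤ ·)]
    generalize S.sort (· ≤ ·) = l
    induction l with
    | nil => simp
    | cons ν l ih =>
      rw [List.map_cons, List.prod_cons, ← mul_assoc, gen_mul_gen, neg_mul, mul_assoc, ih,
        List.length_cons, pow_succ, mul_smul_comm, mul_neg_one, neg_smul, mul_assoc]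
  · simp
  · intro x y _ _ hx hy; rw [mul_add, add_mul, hx, hy, smul_add]
  · intro r x _ hx; rw [mul_smul_comm, smul_mul_assoc, hx, smul_comm]

theorem antisymm_mem {p : Submodule ℝ Ext4} {r : LorentzPair → Ext4} (hr : ∀ q, r q ∈ p)
    (b c : Fin 4) : antisymm r b c ∈ p := by
  unfold antisymm
  split_ifs
  exacts [hr _, Submodule.neg_mem _ (hr _), Submodule.zero_mem _]

theorem mul_gen_gen_eq_zero_of_eqRho {w : TargetCoord → Ext4} (hw : ∀ b c, eqRho gen w b c = 0)
    (a p q : Fin 4) : w (xi a) * (gen p * gen q) = 0 := by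
  obtain ⟨r, hr, h⟩ := exists_rhoOp_eq (k := 0) (y := Pi.single a (gen p * gen q)) (by
    intro a'
    rw [Pi.single_apply]
    split_ifs
    exacts [mul_mem_deg (j := 1) (k := 1) (gen_mem p) (gen_mem q), Submodule.zero_mem _])
  have e1 : w (xi a) * (gen p * gen q) = ∑ a', w (xi a') * rhoOp r a' := by
    simp only [h]
    rw [Finset.sum_eq_single a]
    · rw [Pi.single_eq_same]
    · intro b _ hb; rw [Pi.single_eq_of_ne hb, mul_zero]
    · simp
  have e2 : ∑ a', w (xi a') * rhoOp r a' = -∑ b, ∑ c, eqRho gen w b c * antisymm r b c := by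
    simp only [rhoOp, eqRho, Finset.mul_sum, Finset.sum_mul, mul_smul_comm, smul_mul_assoc, mul_assoc,
      mul_gen_of_mem (antisymm_mem hr _ _), zero_add, pow_one, neg_smul, one_smul, mul_neg, smul_neg,
      Finset.sum_neg_distrib, neg_neg]
    rw [Finset.sum_comm]
    refine Finset.sum_congr rfl fun b _ => ?_
    rw [Finset.sum_comm]
  rw [e1, e2]
  simp only [hw, zero_mul, Finset.sum_const_zero, neg_zero]

theorem mul_genTriple_eq_zero_of_psiOp {u : Fin 4 → Ext4} (hu : ∀ β, psiOp u β = 0)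
    (α p q r : Fin 4) : u α * (gen p * (gen q * gen r)) = 0 := by
  obtain ⟨s, hs, h⟩ := exists_psiOp_eq (k := 0) (y := Pi.single α (gen p * (gen q * gen r))) (by
    intro a'
    rw [Pi.single_apply]
    split_ifs
    exacts [mul_mem_deg (j := 1) (k := 2) (gen_mem p)
      (mul_mem_deg (j := 1) (k := 1) (gen_mem q) (gen_mem r)), Submodule.zero_mem _])
  have e1 : u α * (gen p * (gen q * gen r)) = ∑ β, u β * psiOp s β := by
    simp only [h]
    rw [Finset.sum_eq_single α]
    · rw [Pi.single_eq_same]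
    · intro b _ hb; rw [Pi.single_eq_of_ne hb, mul_zero]
    · simp
  have e2 : ∑ β, u β * psiOp s β = -∑ β, psiOp u β * s β := by
    have hc (a α : Fin 4) : gen a * s α = s α * gen a := by
      rw [mul_gen_of_mem (hs α)]; norm_num
    simp only [psiOp, Finset.mul_sum, Finset.sum_mul, mul_smul_comm, smul_mul_assoc, mul_assoc, hc,
      ← Finset.sum_neg_distrib]
    rw [Finset.sum_comm, Finset.sum_comm (f := fun β a => ∑ α, -(spinMatrix a α β •
      (u α * (s β * gen a))))]
    refine Finset.sum_congr rfl fun a _ => ?_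
    rw [Finset.sum_comm]
    refine Finset.sum_congr rfl fun γ _ => Finset.sum_congr rfl fun β _ => ?_
    rw [spinMatrix_swap a γ β, neg_smul]
  rw [e1, e2]
  simp only [hu, zero_mul, Finset.sum_const_zero, neg_zero]

theorem eq_zero_of_mul_gen_gen {k : ℕ} (hk : k ≤ 2) {x : Ext4} (hx : x ∈ deg k)
    (h : ∀ p q, x * (gen p * gen q) = 0) : x = 0 := by
  refine eq_zero_of_topCoeff fun T => ?_
  by_cases hT : T.card ≤ 1
  · exact topCoeff_of_mem (by omega) (mul_mem_deg hx (mon_mem T))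
  · have hl : (T.sort (· ≤ ·)).length = T.card := Finset.length_sort _
    rw [mon]
    generalize T.sort (· ≤ ·) = l at *
    match l, hl with
    | [], hl => simp at hl; omega
    | [_], hl => simp at hl; omega
    | p :: q :: l, _ =>
      rw [List.map_cons, List.map_cons, List.prod_cons, List.prod_cons, ← mul_assoc (gen p),
        ← mul_assoc, h, zero_mul, map_zero]

theorem eq_zero_of_mul_gen_gen_gen {k : ℕ} (hk : k ≤ 1) {x : Ext4} (hx : x ∈ deg k)
    (h : ∀ p q r, x * (gen p * (gen q * gen r)) = 0) : x = 0 := by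
  refine eq_zero_of_topCoeff fun T => ?_
  by_cases hT : T.card ≤ 2
  · exact topCoeff_of_mem (by omega) (mul_mem_deg hx (mon_mem T))
  · have hl : (T.sort (· ≤ ·)).length = T.card := Finset.length_sort _
    rw [mon]
    generalize T.sort (· ≤ ·) = l at *
    match l, hl with
    | [], hl => simp at hl; omega
    | [_], hl => simp at hl; omega
    | [_, _], hl => simp at hl; omega
    | p :: q :: r :: l, _ =>
      rw [List.map_cons, List.map_cons, List.map_cons, List.prod_cons, List.prod_cons,
        List.prod_cons, ← mul_assoc (gen q), ← mul_assoc (gen p), ← mul_assoc, h, zero_mul, map_zero]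

/-- The solutions of the kernel equations over the exterior algebra, at vanishing `ψ`. -/
noncomputable def solutions : Submodule ℝ (TargetCoord → Ext4) where
  carrier := {w | (∀ b c, eqRho gen w b c = 0) ∧ (∀ a, rhoOp (fun q => w (rho q)) a = 0) ∧
    ∀ β, psiOp (fun α => w (psi α)) β = 0}
  add_mem' := by
    rintro v w ⟨h1, h2, h3⟩ ⟨h1', h2', h3'⟩
    refine ⟨fun b c => ?_, fun a => ?_, fun β => ?_⟩
    · have := congrArg₂ (· + ·) (h1 b c) (h1' b c)
      simpa only [eqRho, Pi.add_apply, add_mul, smul_add, Finset.sum_add_distrib, add_zero] using this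
    · have := congrArg₂ (· + ·) (h2 a) (h2' a)
      simpa only [rhoOp, Pi.add_apply, antisymm_add, add_mul, smul_add, Finset.sum_add_distrib,
        add_zero] using this
    · have := congrArg₂ (· + ·) (h3 β) (h3' β)
      simpa only [psiOp, Pi.add_apply, add_mul, smul_add, Finset.sum_add_distrib, add_zero] using this
  zero_mem' := by
    refine ⟨fun b c => ?_, fun a => ?_, fun β => ?_⟩
    · simp [eqRho]
    · simp [rhoOp, antisymm]
    · simp [psiOp]
  smul_mem' := by
    rintro r w ⟨h1, h2, h3⟩
    refine ⟨fun b c => ?_, fun a => ?_, fun β => ?_⟩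
    · have := congrArg (r • ·) (h1 b c)
      simpa only [eqRho, Pi.smul_apply, smul_mul_assoc, smul_comm _ r, ← Finset.smul_sum,
        smul_zero] using this
    · have h := map_antisymm (DistribSMul.toAddMonoidHom Ext4 r) (fun q => w (rho q))
      have := congrArg (r • ·) (h2 a)
      simp only [DistribSMul.toAddMonoidHom_apply] at h
      simpa only [rhoOp, Pi.smul_apply, ← h, smul_mul_assoc, smul_comm _ r, ← Finset.smul_sum,
        smul_zero] using this
    · have := congrArg (r • ·) (h3 β)
      simpa only [psiOp, Pi.smul_apply, smul_mul_assoc, smul_comm _ r, ← Finset.smul_sum,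
        smul_zero] using this

/-- The sector of a coordinate: `0` for `ξ`, `1` for `ρ` and `2` for `ψ`. -/
def sector : TargetCoord → Fin 3 := Sum.elim (fun _ => 0) (Sum.elim (fun _ => 1) (fun _ => 2))

/-- `w` is concentrated in one sector and one degree. -/
def IsPure (σ : Fin 3) (k : ℕ) (w : TargetCoord → Ext4) : Prop :=
  (∀ I, sector I ≠ σ → w I = 0) ∧ ∀ I, w I ∈ deg k

/-- The part of `w` in a given sector and degree. -/
noncomputable def purePart (σ : Fin 3) (k : ℕ) (w : TargetCoord → Ext4) : TargetCoord → Ext4 :=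
  fun I => if sector I = σ then degProj k (w I) else 0

theorem isPure_purePart (σ : Fin 3) (k : ℕ) (w : TargetCoord → Ext4) :
    IsPure σ k (purePart σ k w) := by
  refine ⟨fun I hI => if_neg hI, fun I => ?_⟩
  unfold purePart
  split_ifs
  exacts [degProj_mem _ _, Submodule.zero_mem _]

theorem sum_purePart (w : TargetCoord → Ext4) :
    ∑ σ : Fin 3, ∑ k ∈ Finset.range 5, purePart σ k w = w := by
  funext I
  simp only [Finset.sum_apply, purePart, Finset.sum_ite_irrel, Finset.sum_const_zero,
    Finset.sum_ite_eq, Finset.mem_univ, if_true, sum_degProj]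

theorem purePart_mem {w : TargetCoord → Ext4} (hw : w ∈ solutions) (σ : Fin 3) (k : ℕ) :
    purePart σ k w ∈ solutions := by
  obtain ⟨h1, h2, h3⟩ := hw
  refine ⟨fun b c => ?_, fun a => ?_, fun β => ?_⟩
  · have h := congrArg (degProj (k + 1)) (h1 b c)
    by_cases hσ : 0 = σ
    · simpa [eqRho, purePart, sector, hσ, degProj_mul_gen] using h
    · simp [eqRho, purePart, sector, hσ]
  · have h := congrArg (degProj (k + 1)) (h2 a)
    have hz : antisymm (fun _ : LorentzPair => (0 : Ext4)) = 0 := by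
      funext b c; simp [antisymm]
    have hm := map_antisymm (degProj k).toAddMonoidHom (fun q => w (rho q))
    simp only [LinearMap.toAddMonoidHom_coe] at hm
    by_cases hσ : 1 = σ
    · simpa [rhoOp, purePart, sector, hσ, degProj_mul_gen, ← hm] using h
    · simp [rhoOp, purePart, sector, hσ, hz]
  · have h := congrArg (degProj (k + 1)) (h3 β)
    by_cases hσ : 2 = σ
    · simpa [psiOp, purePart, sector, hσ, degProj_mul_gen] using h
    · simp [psiOp, purePart, sector, hσ]

/-- The pure solutions. -/
def pureSolutions : Set (TargetCoord → Ext4) := {w | w ∈ solutions ∧ ∃ σ k, IsPure σ k w}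

theorem span_pureSolutions : Submodule.span ℝ pureSolutions = solutions := by
  refine le_antisymm (Submodule.span_le.2 fun w hw => hw.1) fun w hw => ?_
  rw [← sum_purePart w]
  exact Submodule.sum_mem _ fun σ _ => Submodule.sum_mem _ fun k _ =>
    Submodule.subset_span ⟨purePart_mem hw σ k, σ, k, isPure_purePart σ k w⟩

theorem exists_pure_basis : ∃ (n : ℕ) (w : Fin n → TargetCoord → Ext4),
    (∀ i, w i ∈ pureSolutions) ∧ LinearIndependent ℝ w ∧
      Submodule.span ℝ (Set.range w) = solutions := by
  obtain ⟨b, hb, hspan, hli⟩ := exists_linearIndependent ℝ pureSolutions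
  have : Finite b := hli.finite
  obtain ⟨n, ⟨e⟩⟩ := Finite.exists_equiv_fin b
  refine ⟨n, fun i => (e.symm i : TargetCoord → Ext4), fun i => hb (e.symm i).2,
    hli.comp _ e.symm.injective, ?_⟩
  rw [← span_pureSolutions, ← hspan]
  congr 1
  ext x
  constructor
  · rintro ⟨i, rfl⟩; exact (e.symm i).2
  · intro hx; exact ⟨e ⟨x, hx⟩, by simp⟩

/-- `x` is homogeneous of bidegree `v` when the generators have bidegree `(1, 1)`. -/
def HasBidegree (v : ℤ × ZMod 2) (x : Ext4) : Prop :=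
  x = 0 ∨ ∃ m : ℕ, x ∈ deg m ∧ ((m : ℤ), (m : ZMod 2)) = v

/-- Pure solutions extend to solutions for nonvanishing `ψ`, with explicit bidegrees. -/
theorem exists_corrections {w : TargetCoord → Ext4} (hw : w ∈ pureSolutions) :
    ∃ (v : ℤ × ZMod 2) (s : Fin 4 → Fin 4 → Ext4) (r : Fin 4 → LorentzPair → Ext4)
      (r' : Fin 4 → Fin 4 → LorentzPair → Ext4),
      (∀ α' β, psiOp (s α') β = -((1 / 2 : ℝ) • ∑ a, spinMatrix a α' β • w (xi a))) ∧
      (∀ α' a, rhoOp (r α') a = ∑ β, spinMatrix a α' β • w (psi β)) ∧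
      (∀ α' α'' a, rhoOp (r' α' α'') a = ∑ β, spinMatrix a α'' β • s α' β) ∧
      (∀ I, HasBidegree ((1, targetParity I) + v) (w I)) ∧
      (∀ α' α, HasBidegree v (s α' α)) ∧ (∀ α' q, HasBidegree (v + (0, 1)) (r α' q)) ∧
      ∀ α' α'' q, HasBidegree (v + (-1, 1)) (r' α' α'' q) := by
  obtain ⟨⟨h1, h2, h3⟩, σ, k, hsec, hdeg⟩ := hw
  have z : rhoOp (fun _ => 0) = 0 := by
    funext a; simp [rhoOp, antisymm]
  have z' : psiOp (fun _ => 0) = 0 := by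
    funext a; simp [psiOp]
  have hs0 (a : Fin 4) (h : σ ≠ 0) : w (xi a) = 0 := hsec _ (by simpa [sector] using h.symm)
  have hs1 (q : LorentzPair) (h : σ ≠ 1) : w (rho q) = 0 := hsec _ (by simpa [sector] using h.symm)
  have hs2 (α : Fin 4) (h : σ ≠ 2) : w (psi α) = 0 := hsec _ (by simpa [sector] using h.symm)
  have hc : σ = 0 ∨ σ = 1 ∨ σ = 2 := (by decide : ∀ σ : Fin 3, σ = 0 ∨ σ = 1 ∨ σ = 2) σ
  by_cases hw0 : w = 0
  · subst hw0
    exact ⟨0, fun _ _ => 0, fun _ _ => 0, fun _ _ _ => 0, by simp [z'], by simp [z], by simp [z],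
      fun _ => Or.inl rfl, fun _ _ => Or.inl rfl, fun _ _ => Or.inl rfl, fun _ _ _ => Or.inl rfl⟩
  rcases hc with rfl | rfl | rfl
  · have hk : 3 ≤ k := by
      by_contra hk
      refine hw0 (funext fun I => ?_)
      by_cases hI : sector I = 0
      · obtain ⟨a, rfl⟩ : ∃ a, I = xi a := by
          rcases I with a | q | α
          · exact ⟨a, rfl⟩
          · simp [sector] at hI
          · simp [sector] at hI
        exact eq_zero_of_mul_gen_gen (by omega) (hdeg _) (mul_gen_gen_eq_zero_of_eqRho h1 a)
      · exact hsec I hI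
    obtain ⟨j, rfl⟩ := Nat.exists_eq_add_of_le' hk
    choose s hs hs' using fun α' => exists_psiOp_eq (k := j)
      (y := fun β => -((1 / 2 : ℝ) • ∑ a, spinMatrix a α' β • w (xi a))) (fun β =>
        Submodule.neg_mem _ (Submodule.smul_mem _ _ (Submodule.sum_mem _ fun a _ =>
          Submodule.smul_mem _ _ (hdeg _))))
    choose r' hr hr' using fun α' α'' => exists_rhoOp_eq (k := j)
      (y := fun a => ∑ β, spinMatrix a α'' β • s α' β) (fun a =>
        Submodule.sum_mem _ fun β _ => Submodule.smul_mem _ _ (hs _ _))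
    have p2 : (2 : ZMod 2) = 0 := rfl
    have p3 : (3 : ZMod 2) = 1 := rfl
    refine ⟨(j + 2, j), s, fun _ _ => 0, r', hs', by simp [z, hs2], hr', fun I => ?_,
      fun α' α => Or.inr ⟨_, hs α' α, by simp [p2]⟩, fun _ _ => Or.inl rfl,
      fun α' α'' q => Or.inr ⟨_, hr α' α'' q, by simp; ring⟩⟩
    rcases I with a | q | α
    · exact Or.inr ⟨_, hdeg _, by simp [targetParity, p3]; constructor <;> ring⟩
    · exact Or.inl (hs1 q (by decide))
    · exact Or.inl (hs2 α (by decide))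
  · refine ⟨(k - 1, k - 1), fun _ _ => 0, fun _ _ => 0, fun _ _ _ => 0, by simp [z', hs0],
      by simp [z, hs2], by simp [z], fun I => ?_, fun _ _ => Or.inl rfl, fun _ _ => Or.inl rfl,
      fun _ _ _ => Or.inl rfl⟩
    rcases I with a | q | α
    · exact Or.inl (hs0 a (by decide))
    · exact Or.inr ⟨_, hdeg _, by simp [targetParity]⟩
    · exact Or.inl (hs2 α (by decide))
  · have hk : 2 ≤ k := by
      by_contra hk
      refine hw0 (funext fun I => ?_)
      by_cases hI : sector I = 2
      · obtain ⟨a, rfl⟩ : ∃ a, I = psi a := by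
          rcases I with a | q | α
          · simp [sector] at hI
          · simp [sector] at hI
          · exact ⟨α, rfl⟩
        exact eq_zero_of_mul_gen_gen_gen (by omega) (hdeg _)
          (mul_genTriple_eq_zero_of_psiOp (u := fun α => w (psi α)) h3 a)
      · exact hsec I hI
    obtain ⟨j, rfl⟩ := Nat.exists_eq_add_of_le' hk
    choose r hr hr' using fun α' => exists_rhoOp_eq (k := j)
      (y := fun a => ∑ β, spinMatrix a α' β • w (psi β)) (fun a =>
        Submodule.sum_mem _ fun β _ => Submodule.smul_mem _ _ (hdeg _))
    have p2 : (2 : ZMod 2) = 0 := rfl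
    refine ⟨(j + 1, j), fun _ _ => 0, r, fun _ _ _ => 0, by simp [z', hs0], hr', by simp [z],
      fun I => ?_, fun _ _ => Or.inl rfl, fun α' q => Or.inr ⟨_, hr α' q, by simp⟩,
      fun _ _ _ => Or.inl rfl⟩
    rcases I with a | q | α
    · exact Or.inl (hs0 a (by decide))
    · exact Or.inl (hs1 q (by decide))
    · exact Or.inr ⟨_, hdeg _, by simp [targetParity, p2]; ring⟩

end Sugra

namespace Sugra

/-! ### Homogeneous functions and superfunctions of `θ` -/

variable {U : Opens Body}

/-- The coefficients all of whose terms have odd part of bidegree `w`. -/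
noncomputable def coeffPart (U : Opens Body) (w : ℤ × ZMod 2) :
    Submodule ℝ (Smooth U ⊗[ℝ] ExteriorAlgebra ℝ (OddCoord → ℝ)) :=
  LinearMap.range (LinearMap.lTensor (Smooth U) (oddPart w).subtype)

theorem tmul_mem_coeffPart {w : ℤ × ZMod 2} (s : Smooth U)
    {y : ExteriorAlgebra ℝ (OddCoord → ℝ)} (hy : y ∈ oddPart w) : s ⊗ₜ y ∈ coeffPart U w :=
  ⟨s ⊗ₜ ⟨y, hy⟩, rfl⟩

theorem coeffPart_induction {w : ℤ × ZMod 2}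
    {p : Smooth U ⊗[ℝ] ExteriorAlgebra ℝ (OddCoord → ℝ) → Prop} (h0 : p 0)
    (hadd : ∀ a b, p a → p b → p (a + b))
    (ht : ∀ (s : Smooth U) (l : List OddCoord), (l.map fun x => wt x.1).sum = w →
      p (s ⊗ₜ (l.map fun x => ExteriorAlgebra.ι ℝ (Pi.single x (1 : ℝ))).prod))
    {a} (ha : a ∈ coeffPart U w) : p a := by
  obtain ⟨z, rfl⟩ := ha
  induction z using TensorProduct.induction_on with
  | zero => rwa [map_zero]
  | add z z' hz hz' => rw [map_add]; exact hadd _ _ hz hz'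
  | tmul s y =>
    obtain ⟨y, hy⟩ := y
    change p (s ⊗ₜ y)
    revert s
    refine Submodule.span_induction (p := fun y _ => ∀ s, p (s ⊗ₜ y)) ?_ ?_ ?_ ?_ hy
    · rintro _ ⟨l, hl, rfl⟩ s
      exact ht s l hl
    · intro s; rwa [TensorProduct.tmul_zero]
    · intro x y _ _ hx hy s; rw [TensorProduct.tmul_add]; exact hadd _ _ (hx s) (hy s)
    · intro r x _ hx s
      have h := hx (r • s)
      rw [← TensorProduct.smul_tmul'] at h
      rw [TensorProduct.tmul_smul]
      exact h

theorem list_prod_mem_oddPart (l : List OddCoord) :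
    (l.map fun x => ExteriorAlgebra.ι ℝ (Pi.single x (1 : ℝ))).prod ∈
      oddPart (l.map fun x => wt x.1).sum :=
  Submodule.subset_span ⟨l, rfl, rfl⟩

theorem one_mem_oddPart : 1 ∈ oddPart 0 := by
  simpa using list_prod_mem_oddPart []

theorem one_mem_coeffPart : 1 ∈ coeffPart U 0 := tmul_mem_coeffPart 1 one_mem_oddPart

theorem mul_mem_coeffPart {v w : ℤ × ZMod 2} {a b : Smooth U ⊗[ℝ] ExteriorAlgebra ℝ (OddCoord → ℝ)}
    (ha : a ∈ coeffPart U v) (hb : b ∈ coeffPart U w) : a * b ∈ coeffPart U (v + w) := by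
  refine coeffPart_induction (p := fun a => a * b ∈ _) ?_ ?_ ?_ ha
  · rw [zero_mul]; exact Submodule.zero_mem _
  · intro a a' h h'; rw [add_mul]; exact Submodule.add_mem _ h h'
  · intro s l hl
    refine coeffPart_induction (p := fun b => _ * b ∈ coeffPart U (v + w)) ?_ ?_ ?_ hb
    · rw [mul_zero]; exact Submodule.zero_mem _
    · intro a a' h h'; rw [mul_add]; exact Submodule.add_mem _ h h'
    · intro t l' hl'
      rw [Algebra.TensorProduct.tmul_mul_tmul]
      refine tmul_mem_coeffPart _ ?_
      have := list_prod_mem_oddPart (l ++ l')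
      rwa [List.map_append, List.map_append, List.prod_append, List.sum_append, hl, hl'] at this

/-- The bidegree of a monomial in the even coordinates of nonzero ghost degree. -/
noncomputable def monWt (m : FormalCoord →₀ ℕ) : ℤ × ZMod 2 := m.sum fun x k => k • wt x.1

theorem monWt_add (m n : FormalCoord →₀ ℕ) : monWt (m + n) = monWt m + monWt n :=
  Finsupp.sum_add_index' (fun _ => zero_smul _ _) (fun _ _ _ => add_smul _ _ _)

theorem monWt_snd (m : FormalCoord →₀ ℕ) : (monWt m).2 = 0 := by
  rw [monWt, Finsupp.sum, Prod.snd_sum]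
  refine Finset.sum_eq_zero fun x _ => ?_
  rw [Prod.smul_snd, wt, x.2.2, smul_zero]

namespace IsHomogeneousFun

variable {f g : Fun U} {v w : ℤ × ZMod 2}

theorem mem (hf : IsHomogeneousFun f w) (m : FormalCoord →₀ ℕ) :
    MvPowerSeries.coeff m f ∈ coeffPart U (w - monWt m) := hf m

theorem zero : IsHomogeneousFun (0 : Fun U) w := fun m => by
  rw [map_zero]; exact Submodule.zero_mem _

theorem add (hf : IsHomogeneousFun f w) (hg : IsHomogeneousFun g w) :
    IsHomogeneousFun (f + g) w := fun m => by
  rw [map_add]; exact Submodule.add_mem _ (hf m) (hg m)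

theorem neg (hf : IsHomogeneousFun f w) : IsHomogeneousFun (-f) w := fun m => by
  rw [map_neg]; exact Submodule.neg_mem _ (hf m)

theorem sgn_smul (hf : IsHomogeneousFun f w) (e : ZMod 2) : IsHomogeneousFun (sgn e • f) w := by
  rcases ZMod2_cases e with rfl | rfl
  · rwa [sgn_zero, one_smul]
  · rw [sgn_one, neg_smul, one_smul]; exact hf.neg

theorem smul (hf : IsHomogeneousFun f w) (r : ℝ) : IsHomogeneousFun (r • f) w := fun m =>
  Submodule.smul_mem _ r (hf m)

theorem mul (hf : IsHomogeneousFun f v) (hg : IsHomogeneousFun g w) :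
    IsHomogeneousFun (f * g) (v + w) := fun m => by
  classical
  rw [MvPowerSeries.coeff_mul]
  refine Submodule.sum_mem _ fun x hx => ?_
  have h := mul_mem_coeffPart (hf.mem x.1) (hg.mem x.2)
  rw [Finset.HasAntidiagonal.mem_antidiagonal] at hx
  have e : v - monWt x.1 + (w - monWt x.2) = v + w - monWt m := by
    rw [← hx, monWt_add]; abel
  rw [e] at h
  exact h

theorem C {b : Smooth U ⊗[ℝ] ExteriorAlgebra ℝ (OddCoord → ℝ)} (hb : b ∈ coeffPart U w) :
    IsHomogeneousFun (MvPowerSeries.C b : Fun U) w := fun m => by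
  classical
  rw [MvPowerSeries.coeff_C]
  split_ifs with h
  · subst h
    rw [Finsupp.sum_zero_index, sub_zero]
    exact hb
  · exact Submodule.zero_mem _

theorem one : IsHomogeneousFun (1 : Fun U) 0 := by
  rw [← map_one (MvPowerSeries.C)]
  exact C one_mem_coeffPart

theorem coord (x : Coord) : IsHomogeneousFun (coord U x) (wt x) := by
  classical
  by_cases h : par x = 0
  · by_cases h' : gh x = 0
    · rw [Sugra.coord, dif_pos h, dif_pos h']
      have hw : wt x = 0 := by rw [wt, h, h']; rfl
      rw [hw]
      exact C (tmul_mem_coeffPart _ one_mem_oddPart)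
    · rw [Sugra.coord, dif_pos h, dif_neg h']
      intro m
      rw [MvPowerSeries.coeff_X]
      split_ifs with hm
      · rw [hm, Finsupp.sum_single_index (by simp), one_smul, sub_self]
        exact one_mem_coeffPart
      · exact Submodule.zero_mem _
  · rw [Sugra.coord, dif_neg h]
    refine C (tmul_mem_coeffPart _ ?_)
    simpa using list_prod_mem_oddPart [⟨x, h⟩]

theorem invol_ofFun (hf : IsHomogeneousFun f w) : invol U (ofFun U f) = sgn w.2 • ofFun U f := by
  have key (v : ℤ × ZMod 2) (b) (hb : b ∈ coeffPart U v) :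
      coeffInvol U (coeffIncl U b) = sgn v.2 • coeffIncl U b := by
    refine coeffPart_induction (p := fun b => coeffInvol U (coeffIncl U b) = sgn v.2 • coeffIncl U b)
      ?_ ?_ ?_ hb
    · simp
    · intro a b ha hb
      rw [map_add, map_add, ha, hb, zsmul_add]
    · intro s l hl
      have h1 (y) : coeffIncl U (s ⊗ₜ y) = s ⊗ₜ ExteriorAlgebra.map oddIncl y := rfl
      rw [h1, coeffInvol_tmul, ← hl]
      have h2 : CliffordAlgebra.involute (Q := (0 : QuadraticForm ℝ (OddGen → ℝ)))
          (ExteriorAlgebra.map oddIncl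
            (l.map fun x => ExteriorAlgebra.ι ℝ (Pi.single x (1 : ℝ))).prod) =
          sgn (l.map fun x => wt x.1).sum.2 • (ExteriorAlgebra.map oddIncl
            (l.map fun x => ExteriorAlgebra.ι ℝ (Pi.single x (1 : ℝ))).prod) := by
        clear hl
        induction l with
        | nil => simp [sgn_zero]
        | cons x l ih =>
          have hx : (wt x.1).2 = 1 := (ZMod2_cases _).resolve_left x.2
          have h3 : CliffordAlgebra.involute (Q := (0 : QuadraticForm ℝ (OddGen → ℝ)))
              (ExteriorAlgebra.map oddIncl (ExteriorAlgebra.ι ℝ (Pi.single x (1 : ℝ)))) =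
              -(ExteriorAlgebra.map oddIncl (ExteriorAlgebra.ι ℝ (Pi.single x (1 : ℝ)))) := by
            rw [ExteriorAlgebra.map_apply_ι]
            exact CliffordAlgebra.involute_ι _
          rw [List.map_cons, List.prod_cons, map_mul, map_mul, ih, h3, List.map_cons, List.sum_cons,
            Prod.snd_add, hx, sgn_add, sgn_one, mul_smul, neg_smul, one_smul, mul_smul_comm, neg_mul,
            smul_neg]
      rw [h2, TensorProduct.tmul_smul]
  have hmap : MvPowerSeries.map (coeffInvol U).toRingHom
      (MvPowerSeries.map (coeffIncl U).toRingHom f) =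
      sgn w.2 • MvPowerSeries.map (coeffIncl U).toRingHom f := by
    ext m
    refine (key _ _ (hf.mem m)).trans ?_
    rw [Prod.snd_sub, monWt_snd, sub_zero]
    rcases ZMod2_cases w.2 with h | h <;> simp only [h, sgn_zero, sgn_one, one_smul, neg_smul]
    · rfl
    · rw [map_neg]; rfl
  rw [ofFun_apply, invol, MvPowerSeries.map_C, hmap, map_zsmul]

end IsHomogeneousFun

theorem ofFun_smul (r : ℝ) (f : Fun U) : ofFun U (r • f) = r • ofFun U f := by
  classical
  rw [ofFun_apply, ofFun_apply]
  ext1 m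
  change _ = r • MvPowerSeries.coeff m (MvPowerSeries.C (σ := OddCoord)
    (R := MvPowerSeries FormalCoord (CoeffRing U)) _)
  rw [MvPowerSeries.coeff_C, MvPowerSeries.coeff_C]
  split_ifs
  · ext n
    exact map_smul (coeffIncl U) r (MvPowerSeries.coeff n f)
  · exact (smul_zero r).symm

theorem theta_mul_theta (μ ν : Fin 4) : theta U μ * theta U ν = -(theta U ν * theta U μ) := by
  have h := (HasParity.oddGen (U := U) (Sum.inr (Sum.inr μ))).comm
    (HasParity.oddGen (U := U) (Sum.inr (Sum.inr ν)))
  rwa [mul_one, sgn_one, neg_smul, one_smul] at h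

theorem mul_self_eq_zero_of_anticomm {A : Type*} [Ring A] [Algebra ℝ A] {a : A}
    (h : a * a = -(a * a)) : a * a = 0 := by
  rw [← add_eq_zero_iff_eq_neg, ← two_smul ℝ] at h
  exact (smul_eq_zero.1 h).resolve_left (by norm_num)

theorem theta_mul_self (μ : Fin 4) : theta U μ * theta U μ = 0 :=
  mul_self_eq_zero_of_anticomm (theta_mul_theta μ μ)

theorem thetaMon_eq_mon (S : Finset (Fin 4)) : thetaMon U S = mon (theta U) S := rfl

/-- The bidegree `(k, k)`. -/
def diag (k : ℕ) : ℤ × ZMod 2 := (k, k)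

theorem diag_zero : diag 0 = 0 := rfl

theorem diag_add (j k : ℕ) : diag (j + k) = diag j + diag k := by simp [diag]

/-- The superfunctions of `θ` of bidegree `w` with coefficients in the functions on `F̄`. -/
noncomputable def superfun (U : Opens Body) (w : ℤ × ZMod 2) : Submodule ℝ (Form U) where
  carrier := {F | ∃ f : Finset (Fin 4) → Fun U,
    (∀ S, IsHomogeneousFun (f S) (w - diag S.card)) ∧ F = ∑ S, ofFun U (f S) * thetaMon U S}
  add_mem' := by
    rintro _ _ ⟨f, hf, rfl⟩ ⟨g, hg, rfl⟩
    exact ⟨fun S => f S + g S, fun S => (hf S).add (hg S), by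
      simp only [map_add, add_mul, Finset.sum_add_distrib]⟩
  zero_mem' := ⟨fun _ => 0, fun _ => IsHomogeneousFun.zero, by simp⟩
  smul_mem' := by
    rintro r _ ⟨f, hf, rfl⟩
    exact ⟨fun S => r • f S, fun S => (hf S).smul r, by
      simp only [ofFun_smul, smul_mul_assoc, Finset.smul_sum]⟩

theorem ofFun_mul_thetaMon_mem {w : ℤ × ZMod 2} {f : Fun U} {S : Finset (Fin 4)}
    (hf : IsHomogeneousFun f (w - diag S.card)) : ofFun U f * thetaMon U S ∈ superfun U w := by
  classical
  refine ⟨Pi.single S f, fun T => ?_, ?_⟩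
  · by_cases h : T = S
    · subst h; rwa [Pi.single_eq_same]
    · rw [Pi.single_eq_of_ne h]; exact IsHomogeneousFun.zero
  · rw [Finset.sum_eq_single S]
    · rw [Pi.single_eq_same]
    · intro T _ h; rw [Pi.single_eq_of_ne h, map_zero, zero_mul]
    · simp

theorem one_mem_superfun : 1 ∈ superfun U 0 := by
  have h := ofFun_mul_thetaMon_mem (U := U) (w := 0) (f := 1) (S := ∅) (by
    rw [Finset.card_empty, diag_zero, sub_zero]; exact IsHomogeneousFun.one)
  rwa [map_one, one_mul, thetaMon_eq_mon, mon_empty] at h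

theorem mul_mem_superfun {v w : ℤ × ZMod 2} {F G : Form U} (hF : F ∈ superfun U v)
    (hG : G ∈ superfun U w) : F * G ∈ superfun U (v + w) := by
  obtain ⟨f, hf, rfl⟩ := hF
  obtain ⟨g, hg, rfl⟩ := hG
  rw [Finset.sum_mul]
  refine Submodule.sum_mem _ fun S _ => ?_
  rw [Finset.mul_sum]
  refine Submodule.sum_mem _ fun T _ => ?_
  have hc : ∃ e : ZMod 2, thetaMon U S * ofFun U (g T) = ofFun U (sgn e • g T) * thetaMon U S := by
    rw [(HasParity.thetaMon S).mul_comm]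
    rcases ZMod2_cases (S.card : ZMod 2) with h | h <;> rw [h]
    · exact ⟨0, by rw [sg_zero, sgn_zero, one_smul]⟩
    · exact ⟨_, by rw [sg_one, (hg T).invol_ofFun, map_zsmul]⟩
  obtain ⟨e, he⟩ := hc
  have h1 : ofFun U (f S) * thetaMon U S * (ofFun U (g T) * thetaMon U T) =
      ofFun U (f S * sgn e • g T) * (thetaMon U S * thetaMon U T) := by
    rw [map_mul, mul_assoc, ← mul_assoc (thetaMon U S), he]
    simp only [mul_assoc]
  rw [h1]
  have hh := (hf S).mul ((hg T).sgn_smul e)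
  rcases mon_mul_mon (theta_mul_theta (U := U)) theta_mul_self S T with ⟨hd, h⟩ | ⟨_, h⟩
  · have hw : v - diag S.card + (w - diag T.card) = v + w - diag (S ∪ T).card := by
      rw [Finset.card_union_of_disjoint hd, diag_add]; abel
    rw [hw] at hh
    have hm := ofFun_mul_thetaMon_mem hh
    simp only [thetaMon_eq_mon] at hm ⊢
    rcases h with h | h <;> rw [h]
    · exact hm
    · exact (congrArg (· ∈ superfun U (v + w)) (mul_neg _ _)).mpr (Submodule.neg_mem _ hm)
  · simp only [thetaMon_eq_mon]
    rw [h, mul_zero]; exact Submodule.zero_mem _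

theorem ev_mem_superfun (I : TargetCoord) : ev U I ∈ superfun U (1, targetParity I) := by
  refine ⟨fun S => coord U (I, S), fun S => ?_, rfl⟩
  have h := IsHomogeneousFun.coord (U := U) (I, S)
  have e : wt (I, S) = (1, targetParity I) - diag S.card := by
    simp only [wt, gh, par, diag, Prod.mk_sub_mk, CharTwo.sub_eq_add]
  rwa [e] at h

/-! ### Lifting solutions to vector fields -/

theorem sum_smul_mul_self {A : Type*} [Ring A] [Algebra ℝ A] {e : Fin 4 → A}
    (he : ∀ a b, e a * e b = -(e b * e a)) (v : Fin 4 → ℝ) :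
    (∑ a, v a • e a) * ∑ a, v a • e a = 0 := by
  refine mul_self_eq_zero_of_anticomm ?_
  simp only [Finset.sum_mul, Finset.mul_sum, smul_mul_assoc, mul_smul_comm, Finset.smul_sum,
    smul_smul]
  conv_lhs => rw [Finset.sum_comm]
  rw [← Finset.sum_neg_distrib]
  refine Finset.sum_congr rfl fun a _ => ?_
  rw [← Finset.sum_neg_distrib]
  refine Finset.sum_congr rfl fun b _ => ?_
  rw [he, mul_comm, smul_neg]

theorem ev_xi_mul (a b : Fin 4) : ev U (xi a) * ev U (xi b) = -(ev U (xi b) * ev U (xi a)) := by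
  have h := (HasParity.ev (U := U) (xi a)).comm (HasParity.ev (U := U) (xi b))
  simpa [targetParity, sgn_one] using h

/-- The homomorphism sending the generators to the superfunctions `ξ^a`. -/
noncomputable def frameHom (U : Opens Body) : Ext4 →ₐ[ℝ] Form U :=
  ExteriorAlgebra.lift ℝ ⟨∑ a, (LinearMap.proj a : (Fin 4 → ℝ) →ₗ[ℝ] ℝ).smulRight (ev U (xi a)), by
    intro v
    simp only [LinearMap.sum_apply, LinearMap.smulRight_apply, LinearMap.proj_apply]
    exact sum_smul_mul_self ev_xi_mul v⟩

theorem frameHom_gen (a : Fin 4) : frameHom U (gen a) = ev U (xi a) := by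
  rw [frameHom, gen, ExteriorAlgebra.lift_ι_apply]
  rw [LinearMap.sum_apply, Finset.sum_eq_single a]
  · simp
  · intro b _ hb; simp [hb]
  · simp

theorem frameHom_mem {k : ℕ} {x : Ext4} (hx : x ∈ deg k) : frameHom U x ∈ superfun U (diag k) := by
  refine Submodule.span_induction (p := fun x _ => frameHom U x ∈ superfun U (diag k)) ?_ ?_ ?_ ?_
    (deg_le_span k hx)
  · rintro _ ⟨S, hS, rfl⟩
    rw [Set.mem_ofPred_eq] at hS
    rw [map_mon, mon, ← hS, ← Finset.length_sort (s := S) (· ≤ ·)]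
    generalize S.sort (· ≤ ·) = l
    induction l with
    | nil => rw [List.length_nil, diag_zero]; exact one_mem_superfun
    | cons μ l ih =>
      rw [List.map_cons, List.prod_cons, List.length_cons, add_comm, diag_add, frameHom_gen]
      refine mul_mem_superfun ?_ ih
      simpa [diag, targetParity] using ev_mem_superfun (U := U) (xi μ)
  · rw [map_zero]; exact Submodule.zero_mem _
  · intro x y _ _ hx hy; rw [map_add]; exact Submodule.add_mem _ hx hy
  · intro r x _ hx; rw [map_smul]; exact Submodule.smul_mem _ _ hx

theorem HasBidegree.frameHom_mem {v : ℤ × ZMod 2} {x : Ext4} (hx : HasBidegree v x) :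
    frameHom U x ∈ superfun U v := by
  rcases hx with rfl | ⟨m, hm, rfl⟩
  · rw [map_zero]; exact Submodule.zero_mem _
  · exact Sugra.frameHom_mem hm

theorem superfun_cast {v w : ℤ × ZMod 2} {F : Form U} (hF : F ∈ superfun U v) (h : v = w) :
    F ∈ superfun U w := h ▸ hF

end Sugra

namespace Sugra

/-! ### Lifts of pure solutions -/

section Lift

variable {A : Type*} [Ring A] [Algebra ℝ A]

/-- The operator `rhoOp` for arbitrary elements `ξ^a`. -/
noncomputable def rhoOpIn (ξ : Fin 4 → A) (r : LorentzPair → A) (a : Fin 4) : A :=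
  ∑ b, ∑ c, ∑ d, leviCivita a b c d • (antisymm r b c * ξ d)

/-- The operator `psiOp` for arbitrary elements `ξ^a`. -/
noncomputable def psiOpIn (ξ : Fin 4 → A) (s : Fin 4 → A) (β : Fin 4) : A :=
  ∑ a, ∑ α, spinMatrix a α β • (s α * ξ a)

theorem rhoOpIn_add (ξ : Fin 4 → A) (r r' : LorentzPair → A) (a : Fin 4) :
    rhoOpIn ξ (fun q => r q + r' q) a = rhoOpIn ξ r a + rhoOpIn ξ r' a := by
  simp only [rhoOpIn, antisymm_add, add_mul, smul_add, Finset.sum_add_distrib]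

theorem rhoOpIn_sum {ι : Type*} (ξ : Fin 4 → A) (t : Finset ι) (r : ι → LorentzPair → A)
    (a : Fin 4) : rhoOpIn ξ (fun q => ∑ i ∈ t, r i q) a = ∑ i ∈ t, rhoOpIn ξ (r i) a := by
  classical
  induction t using Finset.induction_on with
  | empty => simp [rhoOpIn, antisymm]
  | insert i t hi ih => simp only [Finset.sum_insert hi, rhoOpIn_add, ih]

theorem rhoOpIn_mul (ξ : Fin 4 → A) (r : LorentzPair → A) {y : A} (hy : ∀ d, y * ξ d = ξ d * y)
    (a : Fin 4) : rhoOpIn ξ (fun q => r q * y) a = rhoOpIn ξ r a * y := by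
  simp only [rhoOpIn, ← antisymm_mul, Finset.sum_mul, smul_mul_assoc, mul_assoc, hy]

theorem psiOpIn_add (ξ : Fin 4 → A) (s s' : Fin 4 → A) (β : Fin 4) :
    psiOpIn ξ (fun α => s α + s' α) β = psiOpIn ξ s β + psiOpIn ξ s' β := by
  simp only [psiOpIn, add_mul, smul_add, Finset.sum_add_distrib]

theorem psiOpIn_sum {ι : Type*} (ξ : Fin 4 → A) (t : Finset ι) (s : ι → Fin 4 → A)
    (β : Fin 4) : psiOpIn ξ (fun α => ∑ i ∈ t, s i α) β = ∑ i ∈ t, psiOpIn ξ (s i) β := by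
  classical
  induction t using Finset.induction_on with
  | empty => simp [psiOpIn]
  | insert i t hi ih => simp only [Finset.sum_insert hi, psiOpIn_add, ih]

theorem psiOpIn_mul (ξ : Fin 4 → A) (s : Fin 4 → A) {y : A} (hy : ∀ d, y * ξ d = ξ d * y)
    (β : Fin 4) : psiOpIn ξ (fun α => s α * y) β = psiOpIn ξ s β * y := by
  simp only [psiOpIn, Finset.sum_mul, smul_mul_assoc, mul_assoc, hy]

theorem rhoOpIn_map (Φ : Ext4 →ₐ[ℝ] A) (r : LorentzPair → Ext4) (a : Fin 4) :
    rhoOpIn (fun d => Φ (gen d)) (fun q => Φ (r q)) a = Φ (rhoOp r a) := by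
  have h (b c : Fin 4) : antisymm (fun q => Φ (r q)) b c = Φ (antisymm r b c) :=
    (map_antisymm (Φ : Ext4 →+* A).toAddMonoidHom r b c).symm
  simp only [rhoOpIn, rhoOp, h, map_sum, map_smul, map_mul]

theorem psiOpIn_map (Φ : Ext4 →ₐ[ℝ] A) (s : Fin 4 → Ext4) (β : Fin 4) :
    psiOpIn (fun d => Φ (gen d)) (fun α => Φ (s α)) β = Φ (psiOp s β) := by
  simp only [psiOpIn, psiOp, map_sum, map_smul, map_mul]

/-- The extension of a pure solution `w` by corrections linear and quadratic in `ψ`. -/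
noncomputable def liftSolution (Φ : Ext4 →ₐ[ℝ] A) (ψ : Fin 4 → A) (w : TargetCoord → Ext4)
    (s : Fin 4 → Fin 4 → Ext4) (r : Fin 4 → LorentzPair → Ext4)
    (r' : Fin 4 → Fin 4 → LorentzPair → Ext4) : TargetCoord → A :=
  Sum.elim (fun a => Φ (w (xi a))) (Sum.elim
    (fun q => Φ (w (rho q)) + ∑ α', Φ (r α' q) * ψ α' +
      ∑ α', ∑ α'', Φ (r' α' α'' q) * (ψ α' * ψ α''))
    (fun α => Φ (w (psi α)) + ∑ α', Φ (s α' α) * ψ α'))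

theorem liftSolution_spec (Φ : Ext4 →ₐ[ℝ] A) {ψ : Fin 4 → A}
    (hψ : ∀ α a, ψ α * Φ (gen a) = Φ (gen a) * ψ α)
    {w : TargetCoord → Ext4} (hw : w ∈ solutions)
    {s : Fin 4 → Fin 4 → Ext4} {r : Fin 4 → LorentzPair → Ext4}
    {r' : Fin 4 → Fin 4 → LorentzPair → Ext4}
    (hs : ∀ α' β, psiOp (s α') β = -((1 / 2 : ℝ) • ∑ a, spinMatrix a α' β • w (xi a)))
    (hr : ∀ α' a, rhoOp (r α') a = ∑ β, spinMatrix a α' β • w (psi β))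
    (hr' : ∀ α' α'' a, rhoOp (r' α' α'') a = ∑ β, spinMatrix a α'' β • s α' β) :
    (∀ b c, eqRho (fun a => Φ (gen a)) (liftSolution Φ ψ w s r r') b c = 0) ∧
    (∀ a, eqXi (fun a => Φ (gen a)) ψ (liftSolution Φ ψ w s r r') a = 0) ∧
    ∀ β, eqPsi (fun a => Φ (gen a)) ψ (liftSolution Φ ψ w s r r') β = 0 := by
  obtain ⟨h1, h2, h3⟩ := hw
  have hψψ (α α' a : Fin 4) : ψ α * ψ α' * Φ (gen a) = Φ (gen a) * (ψ α * ψ α') := by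
    rw [mul_assoc, hψ, ← mul_assoc, hψ, mul_assoc]
  refine ⟨fun b c => ?_, fun a => ?_, fun β => ?_⟩
  · have h := congrArg Φ (h1 b c)
    simp only [eqRho, map_sum, map_smul, map_mul, map_zero] at h
    exact h
  · have e1 : eqXi (fun a => Φ (gen a)) ψ (liftSolution Φ ψ w s r r') a =
        rhoOpIn (fun a => Φ (gen a)) (fun q => Φ (w (rho q)) + ∑ α', Φ (r α' q) * ψ α' +
          ∑ α', ∑ α'', Φ (r' α' α'' q) * (ψ α' * ψ α'')) a -
        ∑ α, ∑ β, spinMatrix a α β • ((Φ (w (psi β)) + ∑ α', Φ (s α' β) * ψ α') * ψ α) := rfl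
    rw [e1, rhoOpIn_add, rhoOpIn_add, rhoOpIn_sum, rhoOpIn_sum, rhoOpIn_map, h2, map_zero, zero_add]
    have e2 (α' : Fin 4) : rhoOpIn (fun a => Φ (gen a)) (fun q => Φ (r α' q) * ψ α') a =
        ∑ β, spinMatrix a α' β • (Φ (w (psi β)) * ψ α') := by
      rw [rhoOpIn_mul _ _ (hψ α'), rhoOpIn_map, hr]
      simp only [map_sum, map_smul, Finset.sum_mul, smul_mul_assoc]
    have e3 (α' : Fin 4) : rhoOpIn (fun a => Φ (gen a))
        (fun q => ∑ α'', Φ (r' α' α'' q) * (ψ α' * ψ α'')) a =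
        ∑ α'', ∑ β, spinMatrix a α'' β • (Φ (s α' β) * ψ α' * ψ α'') := by
      rw [rhoOpIn_sum]
      refine Finset.sum_congr rfl fun α'' _ => ?_
      rw [rhoOpIn_mul _ _ (hψψ α' α''), rhoOpIn_map, hr']
      simp only [map_sum, map_smul, Finset.sum_mul, smul_mul_assoc, mul_assoc]
    simp only [e2, e3, add_mul, smul_add, Finset.sum_add_distrib, Finset.sum_mul, Finset.smul_sum]
    rw [add_sub_add_left_eq_sub, sub_eq_zero, Finset.sum_comm]
    refine Finset.sum_congr rfl fun α _ => ?_
    rw [Finset.sum_comm]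
  · have e1 : eqPsi (fun a => Φ (gen a)) ψ (liftSolution Φ ψ w s r r') β =
        -((2 : ℝ) • psiOpIn (fun a => Φ (gen a)) (fun α => Φ (w (psi α)) +
          ∑ α', Φ (s α' α) * ψ α') β) -
        ∑ a, ∑ α, spinMatrix a α β • (Φ (w (xi a)) * ψ α) := rfl
    have e2 (α' : Fin 4) : psiOpIn (fun a => Φ (gen a)) (fun α => Φ (s α' α) * ψ α') β =
        -((1 / 2 : ℝ) • ∑ a, spinMatrix a α' β • (Φ (w (xi a)) * ψ α')) := by
      rw [psiOpIn_mul _ _ (hψ α'), psiOpIn_map, hs]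
      simp only [map_neg, map_sum, map_smul, Finset.sum_mul, smul_mul_assoc, neg_mul]
    rw [e1, psiOpIn_add, psiOpIn_sum, psiOpIn_map, h3, map_zero, zero_add]
    simp only [e2, Finset.sum_neg_distrib, smul_neg, neg_neg, ← Finset.smul_sum, smul_smul]
    norm_num
    rw [sub_eq_zero, Finset.sum_comm]

end Lift

variable {U : Opens Body}

theorem exists_field_of_pureSolution (U : Opens Body) {w : TargetCoord → Ext4}
    (hw : w ∈ pureSolutions) :
    ∃ V : VectorField U, (∃ v, IsHomogeneousField V v) ∧ V ∈ kernel U ∧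
      ∃ s r r', superfield V = liftSolution (frameHom U) (fun α => ev U (psi α)) w s r r' := by
  obtain ⟨v, s, r, r', hs, hr, hr', bw, bs, br, br'⟩ := exists_corrections hw
  have hψ (α a : Fin 4) : ev U (psi α) * frameHom U (gen a) =
      frameHom U (gen a) * ev U (psi α) := by
    rw [frameHom_gen, (HasParity.ev (psi α)).mul_comm]
    rfl
  have hmem (I : TargetCoord) : liftSolution (frameHom U) (fun α => ev U (psi α)) w s r r' I ∈
      superfun U ((1, targetParity I) + v) := by
    have hev (α : Fin 4) : ev U (psi α) ∈ superfun U (1, 0) := ev_mem_superfun (psi α)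
    rcases I with a | q | α
    · exact (bw (xi a)).frameHom_mem
    · refine Submodule.add_mem _ (Submodule.add_mem _ (bw (rho q)).frameHom_mem
        (Submodule.sum_mem _ fun α' _ => ?_))
        (Submodule.sum_mem _ fun α' _ => Submodule.sum_mem _ fun α'' _ => ?_)
      · refine superfun_cast (mul_mem_superfun (br α' q).frameHom_mem (hev α')) ?_
        simp [targetParity, Prod.ext_iff, add_comm]
      · refine superfun_cast (mul_mem_superfun (br' α' α'' q).frameHom_mem
          (mul_mem_superfun (hev α') (hev α''))) ?_
        simp [targetParity, Prod.ext_iff]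
        constructor <;> ring
    · refine Submodule.add_mem _ (bw (psi α)).frameHom_mem
        (Submodule.sum_mem _ fun α' _ => ?_)
      refine superfun_cast (mul_mem_superfun (bs α' α).frameHom_mem (hev α')) ?_
      simp [targetParity, add_comm]
  choose f hf hfe using hmem
  have hsf : superfield (U := U) (fun x => f x.1 x.2) =
      liftSolution (frameHom U) (fun α => ev U (psi α)) w s r r' := funext fun I => (hfe I).symm
  obtain ⟨k1, k2, k3⟩ := liftSolution_spec (frameHom U) hψ hw.1 hs hr hr'
  simp only [frameHom_gen] at k1 k2 k3
  refine ⟨fun x => f x.1 x.2, ⟨v, ?_⟩, ?_, s, r, r', hsf⟩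
  · rintro ⟨I, S⟩
    have h := hf I S
    have e : (1, targetParity I) + v - diag S.card = wt (I, S) + v := by
      simp only [wt, gh, par, diag, Prod.ext_iff, Prod.fst_sub, Prod.snd_sub, Prod.fst_add,
        Prod.snd_add, CharTwo.sub_eq_add]
      constructor <;> ring
    rwa [e] at h
  · refine mem_kernel_of_eq_zero _ ?_ ?_ ?_
    · rw [hsf]; exact k1
    · rw [hsf]; exact k2
    · rw [hsf]; exact k3

end Sugra

namespace Sugra

/-! ### Values at points of the body -/

variable {U : Opens Body}

theorem oddDeriv_smul (j : OddGen) (r : ℝ) (f : Form U) :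
    oddDeriv j (r • f) = r • oddDeriv j f := by
  ext m n
  exact (coeffDeriv U _).map_smul r _

theorem berezin_smul (r : ℝ) (f : Form U) : berezin (r • f) = r • berezin f := by
  simp only [berezin, oddDeriv_smul]

theorem oddDeriv_theta (μ ν : Fin 4) :
    oddDeriv (Sum.inr (Sum.inr μ)) (theta U ν) = if μ = ν then 1 else 0 := by
  rw [theta, oddDeriv_oddGen]
  simp

theorem oddDeriv_one (j : OddGen) : oddDeriv j (1 : Form U) = 0 := by
  have h := oddDeriv_C_C (U := U) j 1
  rw [coeffDeriv_one] at h
  simpa only [map_one, map_zero] using h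

theorem oddDeriv_thetaMon_of_notMem {μ : Fin 4} {S : Finset (Fin 4)} (h : μ ∉ S) :
    oddDeriv (Sum.inr (Sum.inr μ)) (thetaMon U S) = 0 := by
  have h' : μ ∉ S.sort (· ≤ ·) := by simpa using h
  rw [thetaMon]
  revert h'
  generalize S.sort (· ≤ ·) = l
  intro h'
  induction l with
  | nil => exact oddDeriv_one _
  | cons ν l ih =>
    rw [List.mem_cons, not_or] at h'
    rw [List.map_cons, List.prod_cons, oddDeriv_mul, oddDeriv_theta, if_neg h'.1, ih h'.2, zero_mul,
      mul_zero, add_zero]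

theorem berezin_eq_zero_of_oddDeriv {f : Form U} {μ : Fin 4}
    (h : oddDeriv (Sum.inr (Sum.inr μ)) f = 0) : berezin f = 0 := by
  unfold berezin
  fin_cases μ
  · rw [show oddDeriv (Sum.inr (Sum.inr 0)) f = 0 from h]
    simp only [oddDeriv_zero]
  · rw [oddDeriv_comm _ (Sum.inr (Sum.inr 0)), show oddDeriv (Sum.inr (Sum.inr 1)) f = 0 from h]
    simp only [oddDeriv_zero, neg_zero]
  · rw [oddDeriv_comm _ (Sum.inr (Sum.inr 1)), oddDeriv_comm _ (Sum.inr (Sum.inr 0)),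
      show oddDeriv (Sum.inr (Sum.inr 2)) f = 0 from h]
    simp only [oddDeriv_zero, neg_zero]
  · rw [oddDeriv_comm _ (Sum.inr (Sum.inr 2)), oddDeriv_comm _ (Sum.inr (Sum.inr 1)),
      oddDeriv_comm _ (Sum.inr (Sum.inr 0)), show oddDeriv (Sum.inr (Sum.inr 3)) f = 0 from h]
    simp only [oddDeriv_zero, neg_zero]

theorem berezin_thetaMon (S : Finset (Fin 4)) :
    berezin (thetaMon U S) = if S = Finset.univ then 1 else 0 := by
  split_ifs with h
  · subst h
    have hl : (Finset.univ : Finset (Fin 4)).sort (· ≤ ·) = [0, 1, 2, 3] := by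
      have h1 : (Finset.univ : Finset (Fin 4)) = [0, 1, 2, 3].toFinset := by decide
      rw [h1, (List.toFinset_sort (· ≤ ·) (by decide)).2 (by decide)]
    have e : thetaMon U Finset.univ = theta U 0 * (theta U 1 * (theta U 2 * theta U 3)) := by
      rw [thetaMon, hl]
      simp
    have h01 : (0 : Fin 4) ≠ 1 := by decide
    have h02 : (0 : Fin 4) ≠ 2 := by decide
    have h03 : (0 : Fin 4) ≠ 3 := by decide
    have h12 : (1 : Fin 4) ≠ 2 := by decide
    have h13 : (1 : Fin 4) ≠ 3 := by decide
    have h23 : (2 : Fin 4) ≠ 3 := by decide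
    rw [berezin, e]
    simp only [oddDeriv_mul, oddDeriv_theta, if_pos, if_neg h01, if_neg h02, if_neg h03,
      if_neg h12, if_neg h13, if_neg h23, one_mul, zero_mul, mul_zero, add_zero]
  · obtain ⟨μ, hμ⟩ : ∃ μ, μ ∉ S := by
      by_contra hc
      push Not at hc
      exact h (Finset.eq_univ_iff_forall.2 hc)
    exact berezin_eq_zero_of_oddDeriv (oddDeriv_thetaMon_of_notMem hμ)

theorem berezin_invol (f : Form U) : berezin (invol U f) = invol U (berezin f) := by
  simp only [berezin, oddDeriv_invol, oddDeriv_neg, neg_neg]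

theorem berezin_sg (e : ZMod 2) (f : Form U) : berezin (sg U e f) = sg U e (berezin f) := by
  rcases ZMod2_cases e with rfl | rfl
  · simp only [sg_zero]
  · simp only [sg_one, berezin_invol]

theorem sg_smul_one (e : ZMod 2) (r : ℝ) : sg U e (r • (1 : Form U)) = r • (1 : Form U) := by
  have h : invol U (r • (1 : Form U)) = r • (1 : Form U) := by
    have e1 : r • (1 : Form U) = ofFun U (r • (1 : Fun U)) := by rw [ofFun_smul, map_one]
    have h := (IsHomogeneousFun.one.smul r).invol_ofFun (U := U)
    rw [← e1] at h
    simpa only [Prod.snd_zero, sgn_zero, one_smul] using h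
  rcases ZMod2_cases e with rfl | rfl
  · rw [sg_zero]
  · rw [sg_one, h]

/-- The homomorphism sending the generators to `θ^μ`. -/
noncomputable def thetaHom (U : Opens Body) : Ext4 →ₐ[ℝ] Form U :=
  ExteriorAlgebra.lift ℝ ⟨∑ a, (LinearMap.proj a : (Fin 4 → ℝ) →ₗ[ℝ] ℝ).smulRight (theta U a), by
    intro v
    simp only [LinearMap.sum_apply, LinearMap.smulRight_apply, LinearMap.proj_apply]
    exact sum_smul_mul_self theta_mul_theta v⟩

theorem thetaHom_gen (a : Fin 4) : thetaHom U (gen a) = theta U a := by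
  rw [thetaHom, gen, ExteriorAlgebra.lift_ι_apply]
  rw [LinearMap.sum_apply, Finset.sum_eq_single a]
  · simp
  · intro b _ hb; simp [hb]
  · simp

theorem thetaHom_mon (S : Finset (Fin 4)) : thetaHom U (mon gen S) = thetaMon U S := by
  rw [map_mon]
  simp only [thetaHom_gen]
  rfl

theorem berezin_thetaHom (x : Ext4) : berezin (thetaHom U x) = topCoeff x • (1 : Form U) := by
  rw [← monBasis.sum_repr x]
  simp only [map_sum, map_smul, berezin_sum, berezin_smul, monBasis_apply, thetaHom_mon,
    berezin_thetaMon, topCoeff_mon, Finset.sum_smul, smul_assoc]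
  refine Finset.sum_congr rfl fun S _ => ?_
  congr 1
  split_ifs
  · rw [one_smul]
  · rw [zero_smul]

theorem oddDeriv_dcoord (μ : Fin 4) (x : Coord) :
    oddDeriv (Sum.inr (Sum.inr μ)) (dcoord U x) = 0 := by
  by_cases h : par x = 0
  · rw [dcoord, dif_pos h, oddDeriv_oddGen, if_neg (by simp)]
  · rw [dcoord, dif_neg h, oddDeriv_X]

theorem mul_sgn_smul_smul_one {A : Type*} [Ring A] [Algebra ℝ A] (e : ZMod 2) (r : ℝ) (y : A) :
    y * (sgn e • (r • (1 : A))) = ((sgn e : ℝ) * r) • y := by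
  rw [mul_smul_comm, mul_smul_comm, mul_one, mul_smul, Int.cast_smul_eq_zsmul]

theorem mul_sgn_smul_sgn_smul {A : Type*} [Ring A] (e : ZMod 2) (x y : A) :
    x * y = sgn e • (x * (sgn e • y)) := by
  rw [mul_smul_comm, smul_smul, sgn_mul_self, one_smul]

theorem berezin_thetaHom_mul_dcoord (x : Ext4) (y : Coord) :
    berezin (thetaHom U x * (dcoord U y * thetaMon U y.2)) =
      (sgn ((par y + 1) * (y.2.card : ZMod 2)) * topCoeff (x * mon gen y.2)) • dcoord U y := by
  have h1 : thetaHom U x * dcoord U y = dcoord U y * sg U (par y + 1) (thetaHom U x) := by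
    rw [(HasParity.dcoord y).mul_comm, ← sg_add, CharTwo.add_self_eq_zero, sg_zero]
  have h2 : sg U (par y + 1) (thetaHom U x) * thetaMon U y.2 =
      sgn ((par y + 1) * (y.2.card : ZMod 2)) •
        sg U (par y + 1) (thetaHom U (x * mon gen y.2)) := by
    rw [map_mul, map_mul, thetaHom_mon, (HasParity.thetaMon y.2).sg_eq]
    exact mul_sgn_smul_sgn_smul _ _ _
  have h3 (e : ZMod 2) (f : Form U) : berezin (sgn e • f) = sgn e • berezin f := by
    rcases ZMod2_cases e with rfl | rfl
    · simp only [sgn_zero, one_smul]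
    · simp only [sgn_one, neg_smul, one_smul, berezin, oddDeriv_neg]
  rw [← mul_assoc, h1, mul_assoc, h2, berezin_mul_of_oddDeriv_eq_zero
    (fun μ => oddDeriv_dcoord μ y), h3, berezin_sg, berezin_thetaHom, sg_smul_one]
  exact mul_sgn_smul_smul_one (A := Form U) _ _ _

/-! #### Evaluation of forms at a point -/

variable (p : U)

/-- The map killing the odd coordinates and retaining the other odd generators. -/
noncomputable def killOdd : (OddGen → ℝ) →ₗ[ℝ] (OddGen → ℝ) :=
  LinearMap.pi (Sum.elim (fun _ => 0) (fun j => (LinearMap.proj (Sum.inr j) : (OddGen → ℝ) →ₗ[ℝ] ℝ)))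

/-- The evaluation of coefficients of forms at a point of the body. -/
noncomputable def coeffEval : CoeffRing U →ₐ[ℝ] ExteriorAlgebra ℝ (OddGen → ℝ) :=
  (Algebra.TensorProduct.lid ℝ (ExteriorAlgebra ℝ (OddGen → ℝ))).toAlgHom.comp
    (Algebra.TensorProduct.map (smoothEval p) (ExteriorAlgebra.map killOdd))

theorem coeffEval_tmul (s : Smooth U) (a : ExteriorAlgebra ℝ (OddGen → ℝ)) :
    coeffEval p (s ⊗ₜ a) = smoothEval p s • ExteriorAlgebra.map killOdd a := rfl

theorem coeff_formEval (m : OddCoord →₀ ℕ) (f : Form U) :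
    MvPowerSeries.coeff m (formEval p f) =
      coeffEval p (MvPowerSeries.constantCoeff (MvPowerSeries.coeff m f)) := rfl

theorem formEval_smul (r : ℝ) (f : Form U) : formEval p (r • f) = r • formEval p f := by
  ext1 m
  exact map_smul (coeffEval p) r (MvPowerSeries.constantCoeff (MvPowerSeries.coeff m f))

/-- The evaluation of forms as an algebra homomorphism. -/
noncomputable def formEvalHom : Form U →ₐ[ℝ] PointForm :=
  { formEval p with
    commutes' := fun r => by
      have h := formEval_smul p r 1
      rw [map_one, ← Algebra.algebraMap_eq_smul_one] at h
      exact h.trans (Algebra.algebraMap_eq_smul_one r).symm }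

theorem formEvalHom_apply (f : Form U) : formEvalHom p f = formEval p f := rfl

theorem extDeriv_killOdd (j : EvenCoord ⊕ Fin 4) (a : ExteriorAlgebra ℝ (OddGen → ℝ)) :
    extDeriv (Sum.inr j) (ExteriorAlgebra.map killOdd a) =
      ExteriorAlgebra.map killOdd (extDeriv (Sum.inr j) a) := by
  refine (contractLeft_map killOdd _ a).trans ?_
  rfl

theorem formEval_oddDeriv (j : EvenCoord ⊕ Fin 4) (f : Form U) :
    formEval p (oddDeriv (Sum.inr j) f) =
      mapCoeff (extDeriv (Sum.inr j)).toAddMonoidHom (formEval p f) := by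
  have h (b : CoeffRing U) :
      coeffEval p (coeffDeriv U (Sum.inr j) b) = extDeriv (Sum.inr j) (coeffEval p b) := by
    induction b using TensorProduct.induction_on with
    | zero => simp
    | add a b ha hb => simp only [map_add, ha, hb]
    | tmul s a =>
      rw [coeffDeriv_tmul, coeffEval_tmul, coeffEval_tmul, map_smul, extDeriv_killOdd]
  ext1 m
  exact h _

theorem formEval_berezin_congr {f g : Form U} (h : formEval p f = formEval p g) :
    formEval p (berezin f) = formEval p (berezin g) := by
  simp only [berezin, formEval_oddDeriv, h]

theorem coeffEval_coeffIncl (b : Smooth U ⊗[ℝ] ExteriorAlgebra ℝ (OddCoord → ℝ)) :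
    coeffEval p (coeffIncl U b) = algebraMap ℝ _ (Algebra.TensorProduct.lift (smoothEval p)
      ExteriorAlgebra.algebraMapInv (fun _ _ => Commute.all _ _) b) := by
  have h0 : (ExteriorAlgebra.map killOdd).comp (ExteriorAlgebra.map oddIncl) =
      (Algebra.ofId ℝ (ExteriorAlgebra ℝ (OddGen → ℝ))).comp
        (ExteriorAlgebra.algebraMapInv (R := ℝ) (M := OddCoord → ℝ)) := by
    refine ExteriorAlgebra.hom_ext (LinearMap.ext fun v => ?_)
    have h1 : killOdd (oddIncl v) = 0 := by
      ext j
      rcases j with j | j <;> simp [killOdd, oddIncl]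
    simp [h1, ExteriorAlgebra.algebraMapInv]
  induction b using TensorProduct.induction_on with
  | zero => simp
  | add a b ha hb => simp only [map_add, ha, hb]
  | tmul s a =>
    have h1 : ExteriorAlgebra.map killOdd (ExteriorAlgebra.map oddIncl a) =
      algebraMap ℝ _ (ExteriorAlgebra.algebraMapInv a) := AlgHom.congr_fun h0 a
    rw [show coeffIncl U (s ⊗ₜ a) = s ⊗ₜ ExteriorAlgebra.map oddIncl a from rfl, coeffEval_tmul, h1,
      Algebra.TensorProduct.lift_tmul, map_mul, Algebra.smul_def]

theorem formEval_ofFun (f : Fun U) : formEval p (ofFun U f) = funEval p f • (1 : PointForm) := by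
  classical
  ext1 m
  have h1 : MvPowerSeries.coeff m (funEval p f • (1 : PointForm)) =
      funEval p f • MvPowerSeries.coeff m (1 : PointForm) := rfl
  rw [coeff_formEval, ofFun_apply, MvPowerSeries.coeff_C, h1, MvPowerSeries.coeff_one]
  split_ifs
  · rw [← Algebra.algebraMap_eq_smul_one]
    exact coeffEval_coeffIncl p (MvPowerSeries.constantCoeff f)
  · simp

/-- The inclusion of the algebra generated by the `θ^μ` in the forms at a point. -/
noncomputable def thetaPoint : Ext4 →ₐ[ℝ] PointForm := (formEvalHom p).comp (thetaHom U)

theorem thetaPoint_injective : Function.Injective (thetaPoint p) := by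
  rw [injective_iff_map_eq_zero]
  intro x hx
  refine eq_zero_of_topCoeff fun T => ?_
  have h1 : formEval p (thetaHom U (x * mon gen T)) = formEval p 0 := by
    have : thetaPoint p (x * mon gen T) = 0 := by rw [map_mul, hx, zero_mul]
    rw [map_zero]
    exact this
  have h2 := formEval_berezin_congr p h1
  rw [berezin_thetaHom, formEval_smul, berezin_zero, map_zero, map_one] at h2
  exact (smul_eq_zero.1 h2).resolve_right one_ne_zero

/-- The superfunction of a tangent vector. -/
noncomputable def tangentSuper : Tangent →ₗ[ℝ] (TargetCoord → Ext4) where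
  toFun v I := ∑ S, v (I, S) • mon gen S
  map_add' v w := by
    funext I
    simp only [Pi.add_apply, add_smul, Finset.sum_add_distrib]
  map_smul' r v := by
    funext I
    simp only [Pi.smul_apply, smul_eq_mul, mul_smul, Finset.smul_sum, RingHom.id_apply]

theorem tangentSuper_injective : Function.Injective tangentSuper := by
  rw [injective_iff_map_eq_zero]
  intro v hv
  funext ⟨I, S⟩
  have h := congrFun hv I
  change ∑ S, v (I, S) • mon gen S = 0 at h
  simp only [← monBasis_apply] at h
  exact Fintype.linearIndependent_iff.1 monBasis.linearIndependent _ h S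

theorem formEval_superfield (V : VectorField U) (I : TargetCoord) :
    formEval p (superfield V I) = thetaPoint p (tangentSuper (fieldEval p V) I) := by
  change _ = thetaPoint p (∑ S, fieldEval p V (I, S) • mon gen S)
  simp only [superfield, map_sum, map_mul, formEval_ofFun, map_smul]
  refine Finset.sum_congr rfl fun S _ => ?_
  rw [thetaPoint, AlgHom.comp_apply, thetaHom_mon, formEvalHom_apply, smul_mul_assoc, one_mul]
  rfl

end Sugra

namespace Sugra

/-! ### The kernel at a point of the body -/

section Equations

variable {A B : Type*} [Ring A] [Algebra ℝ A] [Ring B] [Algebra ℝ B]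

theorem sum_lorentzPair {M : Type*} [AddCommMonoid M] (f : LorentzPair → M) :
    ∑ q, f q = ∑ b, ∑ c, if h : b < c then f ⟨(b, c), h⟩ else 0 := by
  have h1 : ∑ q, f q = ∑ q : LorentzPair,
      (fun s : Fin 4 × Fin 4 => if h : s.1 < s.2 then f ⟨s, h⟩ else 0) q.1 :=
    Finset.sum_congr rfl fun q _ => by simp only [dif_pos q.2]
  rw [h1, ← Finset.sum_subtype (Finset.univ.filter fun s : Fin 4 × Fin 4 => s.1 < s.2) (by simp)
    (fun s : Fin 4 × Fin 4 => if h : s.1 < s.2 then f ⟨s, h⟩ else 0), Finset.sum_filter,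
    ← Fintype.sum_prod_type']
  refine Finset.sum_congr rfl fun s _ => ?_
  split_ifs <;> rfl

theorem sum_mul_antisymm {A : Type*} [Ring A] (R : Fin 4 → Fin 4 → A) (t : LorentzPair → A) :
    ∑ b, ∑ c, R b c * antisymm t b c = ∑ q : LorentzPair, (R q.1.1 q.1.2 - R q.1.2 q.1.1) * t q := by
  have h (b c : Fin 4) : antisymm t b c = (if h : b < c then t ⟨(b, c), h⟩ else 0) -
      if h : c < b then t ⟨(c, b), h⟩ else 0 := by
    unfold antisymm
    by_cases h1 : b < c
    · rw [dif_pos h1, dif_pos h1, dif_neg h1.asymm, sub_zero]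
    · rw [dif_neg h1, dif_neg h1]
      split_ifs
      · rw [zero_sub]
      · rw [sub_zero]
  have h2 (f g : Fin 4 → Fin 4 → A) : ∑ b, ∑ c, (f b c - g b c) = ∑ b, ∑ c, (f b c - g c b) := by
    simp only [Finset.sum_sub_distrib]
    rw [Finset.sum_comm (f := g)]
  rw [sum_lorentzPair]
  simp only [h, mul_sub]
  rw [h2]
  refine Finset.sum_congr rfl fun b _ => Finset.sum_congr rfl fun c _ => ?_
  split_ifs <;> simp [sub_mul]

/-- The coefficient of `dΨ^I` in `i_V ω^F`. -/
noncomputable def eqCoeff (ξ ψ : Fin 4 → A) (V : TargetCoord → A) : TargetCoord → A :=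
  Sum.elim (eqXi ξ ψ V) (Sum.elim
    (fun q => eqRho ξ V q.1.1 q.1.2 - eqRho ξ V q.1.2 q.1.1) (eqPsi ξ ψ V))

theorem map_eqCoeff (f : A →ₐ[ℝ] B) (ξ ψ : Fin 4 → A) (V : TargetCoord → A) (I : TargetCoord) :
    f (eqCoeff ξ ψ V I) =
      eqCoeff (fun a => f (ξ a)) (fun α => f (ψ α)) (fun J => f (V J)) I := by
  have h (r : LorentzPair → A) (b c : Fin 4) :
      f (antisymm r b c) = antisymm (fun q => f (r q)) b c :=
    map_antisymm (f : A →+* B).toAddMonoidHom r b c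
  rcases I with a | q | β
  · simp only [eqCoeff, Sum.elim_inl, eqXi, map_sub, map_sum, map_smul, map_mul, h]
  · simp only [eqCoeff, Sum.elim_inr, Sum.elim_inl, eqRho, map_sub, map_sum, map_smul, map_mul]
  · simp only [eqCoeff, Sum.elim_inr, eqPsi, map_sub, map_neg, map_sum, map_smul, map_mul]

theorem mem_solutions_iff (w : TargetCoord → Ext4) :
    w ∈ solutions ↔ ∀ I, eqCoeff gen 0 w I = 0 := by
  have h1 (a : Fin 4) : eqCoeff gen 0 w (xi a) = rhoOp (fun q => w (rho q)) a := by
    simp only [eqCoeff, Sum.elim_inl, eqXi, Pi.zero_apply, mul_zero, smul_zero,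
      Finset.sum_const_zero, sub_zero, rhoOp]
  have h2 (q : LorentzPair) : eqCoeff gen 0 w (rho q) = (2 : ℝ) • eqRho gen w q.1.1 q.1.2 := by
    simp only [eqCoeff, Sum.elim_inr, Sum.elim_inl, eqRho, leviCivita_swap _ q.1.2 q.1.1, neg_smul,
      Finset.sum_neg_distrib, sub_neg_eq_add, two_smul]
  have h3 (β : Fin 4) : eqCoeff gen 0 w (psi β) = -((2 : ℝ) • psiOp (fun α => w (psi α)) β) := by
    simp only [eqCoeff, Sum.elim_inr, eqPsi, Pi.zero_apply, mul_zero, smul_zero,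
      Finset.sum_const_zero, sub_zero, psiOp]
  have h4 (b c : Fin 4) : eqRho gen w c b = -eqRho gen w b c := by
    simp only [eqRho, leviCivita_swap _ c b, neg_smul, Finset.sum_neg_distrib]
  constructor
  · rintro ⟨k1, k2, k3⟩ (a | q | β)
    · rw [h1, k2]
    · rw [h2, k1, smul_zero]
    · rw [h3, k3, smul_zero, neg_zero]
  · intro h
    have k (b c : Fin 4) (hbc : b < c) : eqRho gen w b c = 0 := by
      have := h (rho ⟨(b, c), hbc⟩)
      rw [h2] at this
      exact (smul_eq_zero.1 this).resolve_left two_ne_zero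
    refine ⟨fun b c => ?_, fun a => ?_, fun β => ?_⟩
    · rcases lt_trichotomy b c with hbc | rfl | hbc
      · exact k b c hbc
      · have h5 : (2 : ℝ) • eqRho gen w b b = 0 := by
          rw [two_smul]
          nth_rewrite 2 [h4]
          exact add_neg_cancel _
        exact (smul_eq_zero.1 h5).resolve_left two_ne_zero
      · rw [h4, k c b hbc, neg_zero]
    · rw [← h1, h]
    · have := h (psi β)
      rw [h3, neg_eq_zero] at this
      exact (smul_eq_zero.1 this).resolve_left two_ne_zero

end Equations

variable {U : Opens Body}

theorem interior_omegaF_eq_sum (V : VectorField U) :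
    interior V (omegaF (ev U) (evd U)) =
      ∑ I, eqCoeff (fun a => ev U (xi a)) (fun α => ev U (psi α)) (superfield V) I * evd U I := by
  rw [interior_omegaF, sum_mul_antisymm, Fintype.sum_sum_type, Fintype.sum_sum_type,
    add_comm (∑ q : LorentzPair, _), add_assoc]
  rfl

theorem berezin_sum_thetaHom_mul_evd (E : TargetCoord → Ext4) :
    berezin (∑ I, thetaHom U (E I) * evd U I) = ∑ y : Coord,
      (sgn ((par y + 1) * (y.2.card : ZMod 2)) * topCoeff (E y.1 * mon gen y.2)) • dcoord U y := by
  simp only [evd, Finset.mul_sum, berezin_sum]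
  rw [Fintype.sum_prod_type]
  refine Finset.sum_congr rfl fun I _ => Finset.sum_congr rfl fun S _ => ?_
  exact berezin_thetaHom_mul_dcoord (E I) (I, S)

variable (p : U)

theorem formEval_formDeriv_eq_zero {f : Form U} (h : formEval p f = 0) (x : Coord) :
    formEval p (formDeriv x f) = 0 := by
  by_cases hx : par x = 0
  · rw [formDeriv_of_even hx, formEval_oddDeriv, h, map_zero]
  · rw [formDeriv_of_odd hx]
    ext1 m
    have h1 := congrArg (MvPowerSeries.coeff (m + Finsupp.single ⟨x, hx⟩ 1)) h
    have h2 := coeff_formEval p m (f.pderivFun ⟨x, hx⟩)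
    rw [coeff_formEval] at h1
    rw [h2, MvPowerSeries.coeff_pderivFun, map_mul, map_mul, h1, map_zero, zero_mul, map_zero]

theorem eq_zero_of_sum_smul_dcoord {c : Coord → ℝ}
    (h : formEval p (∑ y, c y • dcoord U y) = 0) (x : Coord) : c x = 0 := by
  have h1 := formEval_formDeriv_eq_zero p h x
  rw [formDeriv_sum, Finset.sum_eq_single x] at h1
  · rw [formDeriv_smul, formDeriv_dcoord, if_pos rfl, formEval_smul, map_one] at h1
    exact (smul_eq_zero.1 h1).resolve_right one_ne_zero
  · intro y _ hy
    rw [formDeriv_smul, formDeriv_dcoord, if_neg hy.symm]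
    exact smul_zero _
  · simp

theorem funEval_coord (x : Coord) :
    funEval p (coord U x) = if h : gh x = 0 ∧ par x = 0 then (p : Body) ⟨x, h⟩ else 0 := by
  by_cases h : par x = 0
  · by_cases h' : gh x = 0
    · rw [coord, dif_pos h, dif_pos h', dif_pos ⟨h', h⟩]
      have h1 : funEval p (MvPowerSeries.C (bodyCoord U ⟨x, h', h⟩ ⊗ₜ[ℝ] 1)) =
          smoothEval p (bodyCoord U ⟨x, h', h⟩) := by
        simp [funEval]
      exact h1
    · rw [coord, dif_pos h, dif_neg h', dif_neg fun h1 => h' h1.1]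
      simp [funEval]
  · rw [coord, dif_neg h, dif_neg fun h1 => h h1.2]
    simp [funEval, ExteriorAlgebra.algebraMapInv]

theorem formEval_ev_psi (α : Fin 4) : formEval p (ev U (psi α)) = 0 := by
  rw [ev, map_sum]
  refine Finset.sum_eq_zero fun S _ => ?_
  rw [map_mul, formEval_ofFun, funEval_coord, dif_neg, zero_smul, zero_mul]
  rintro ⟨h1, h2⟩
  have h3 : S.card = 1 := by
    simp only [gh] at h1
    omega
  simp [par, targetParity, h3] at h2

/-- The action of the frame on the exterior algebra. -/
noncomputable def frameMap (p : Body) : Ext4 →ₐ[ℝ] Ext4 :=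
  ExteriorAlgebra.map (Matrix.toLin' (frame p).transpose)

theorem frameMap_gen (p : Body) (a : Fin 4) : frameMap p (gen a) = ∑ μ, frame p a μ • gen μ := by
  rw [frameMap, gen, ExteriorAlgebra.map_apply_ι, ι_eq_sum_gen]
  simp

theorem frameMap_bijective {p : Body} (hp : p ∈ admissible) : Function.Bijective (frameMap p) := by
  have h : IsUnit (frame p).transpose := by
    rw [Matrix.isUnit_transpose, Matrix.isUnit_iff_isUnit_det]
    exact isUnit_iff_ne_zero.2 hp
  have h1 : Function.Injective (Matrix.toLin' (frame p).transpose) :=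
    Matrix.mulVec_injective_of_isUnit h
  exact ⟨ExteriorAlgebra.map_injective_field (LinearMap.ker_eq_bot.2 h1),
    ExteriorAlgebra.map_surjective_iff.2 (LinearMap.injective_iff_surjective.1 h1)⟩

theorem formEval_ev_xi (a : Fin 4) :
    formEval p (ev U (xi a)) = thetaPoint p (frameMap p (gen a)) := by
  rw [ev, map_sum, frameMap_gen, map_sum]
  have h1 (μ : Fin 4) : thetaPoint p (frame p a μ • gen μ) =
      formEval p (ofFun U (coord U (xi a, {μ})) * thetaMon U {μ}) := by
    rw [map_mul, formEval_ofFun, funEval_coord, dif_pos (body_xi a μ), map_smul, smul_mul_assoc,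
      one_mul, thetaPoint, AlgHom.comp_apply, thetaHom_gen, formEvalHom_apply, thetaMon,
      Finset.sort_singleton, List.map_singleton, List.prod_singleton]
    rfl
  simp only [h1]
  rw [← Finset.sum_image (s := Finset.univ) (g := fun μ : Fin 4 => ({μ} : Finset (Fin 4)))
    (f := fun S => formEval p (ofFun U (coord U (xi a, S)) * thetaMon U S))
    (fun _ _ _ _ h => Finset.singleton_injective h)]
  refine (Finset.sum_subset (Finset.subset_univ _) fun S _ hS => ?_).symm
  rw [map_mul, formEval_ofFun, funEval_coord, dif_neg, zero_smul, zero_mul]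
  rintro ⟨h1, -⟩
  have h3 : S.card = 1 := by
    simp only [gh] at h1
    omega
  obtain ⟨μ, rfl⟩ := Finset.card_eq_one.1 h3
  exact hS (Finset.mem_image_of_mem _ (Finset.mem_univ _))

theorem formEval_frameHom (x : Ext4) :
    formEval p (frameHom U x) = thetaPoint p (frameMap p x) := by
  have h : (formEvalHom p).comp (frameHom U) = (thetaPoint p).comp (frameMap p) := by
    refine ExteriorAlgebra.hom_ext (LinearMap.pi_ext' fun a => LinearMap.ext_ring ?_)
    change formEval p (frameHom U (gen a)) = thetaPoint p (frameMap p (gen a))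
    rw [frameHom_gen, formEval_ev_xi]
  exact AlgHom.congr_fun h x

theorem tangentSuper_of_liftSolution {V : VectorField U} {w : TargetCoord → Ext4}
    {s : Fin 4 → Fin 4 → Ext4} {r : Fin 4 → LorentzPair → Ext4}
    {r' : Fin 4 → Fin 4 → LorentzPair → Ext4}
    (h : superfield V = liftSolution (frameHom U) (fun α => ev U (psi α)) w s r r')
    (I : TargetCoord) : tangentSuper (fieldEval p V) I = frameMap p (w I) := by
  apply thetaPoint_injective p
  rw [← formEval_superfield, h, ← formEval_frameHom]
  rcases I with a | q | α
  · rfl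
  · simp only [liftSolution, Sum.elim_inr, Sum.elim_inl, map_add, map_sum, map_mul, formEval_ev_psi,
      mul_zero, Finset.sum_const_zero, add_zero]
  · simp only [liftSolution, Sum.elim_inr, map_add, map_sum, map_mul, formEval_ev_psi,
      mul_zero, Finset.sum_const_zero, add_zero]

theorem formEval_interior_omegaBar (V : VectorField U) {w : TargetCoord → Ext4}
    (hw : ∀ I, tangentSuper (fieldEval p V) I = frameMap p (w I)) :
    formEval p (interior V (omegaBar U)) = formEval p (∑ y : Coord,
      (sgn ((par y + 1) * (y.2.card : ZMod 2)) *
        topCoeff (frameMap p (eqCoeff gen 0 w y.1) * mon gen y.2)) • dcoord U y) := by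
  rw [interior_omegaBar, interior_omegaF_eq_sum, ← berezin_sum_thetaHom_mul_evd
    (fun I => frameMap p (eqCoeff gen 0 w I))]
  refine formEval_berezin_congr p ?_
  rw [map_sum, map_sum]
  refine Finset.sum_congr rfl fun I _ => ?_
  rw [map_mul, map_mul]
  congr 1
  change formEvalHom p _ = (thetaPoint p).comp (frameMap p) _
  rw [map_eqCoeff, map_eqCoeff]
  congr 1
  · funext a
    exact formEval_ev_xi p a
  · funext α
    rw [Pi.zero_apply, map_zero]
    exact formEval_ev_psi p α
  · funext J
    rw [formEvalHom_apply, formEval_superfield, hw]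
    rfl

theorem fieldEval_mem_kernelAt_iff (V : VectorField U) :
    fieldEval p V ∈ kernelAt p ↔ formEval p (interior V (omegaBar U)) = 0 := by
  have h : formEval p (interior V (omegaBar U)) =
      ∑ x, fieldEval p V x • formEval p (formDeriv x (omegaBar U)) := by
    simp only [interior, map_sum, map_mul, formEval_ofFun, smul_mul_assoc, one_mul]
    rfl
  rw [h]
  rfl

theorem exists_fieldEval_eq (v : Tangent) : ∃ V : VectorField U, fieldEval p V = v := by
  refine ⟨fun x => v x • 1, funext fun x => ?_⟩
  have h : (v x • (1 : Fun U)) = algebraMap ℝ (Fun U) (v x) := (Algebra.algebraMap_eq_smul_one _).symm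
  rw [fieldEval, h]
  simp [funEval, MvPowerSeries.algebraMap_apply]

theorem mem_kernelAt_iff (hp : (p : Body) ∈ admissible) {v : Tangent} {w : TargetCoord → Ext4}
    (hw : ∀ I, tangentSuper v I = frameMap p (w I)) : v ∈ kernelAt p ↔ w ∈ solutions := by
  obtain ⟨V, rfl⟩ := exists_fieldEval_eq p v
  rw [fieldEval_mem_kernelAt_iff, formEval_interior_omegaBar p V hw, mem_solutions_iff]
  constructor
  · intro h I
    apply (frameMap_bijective hp).1
    rw [map_zero]
    refine eq_zero_of_topCoeff fun T => ?_
    have h1 := eq_zero_of_sum_smul_dcoord p h (I, T)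
    refine (mul_eq_zero.1 h1).resolve_left ?_
    unfold sgn
    split_ifs <;> norm_num
  · intro h
    rw [map_sum]
    refine Finset.sum_eq_zero fun y _ => ?_
    rw [h, map_zero, zero_mul, map_zero, mul_zero, zero_smul, map_zero]

end Sugra

namespace Sugra

/-! ### Linear independence over the functions -/

section LinearIndependence

variable {A K : Type*} [Ring A] [Field K]

theorem linearIndependent_sub_smul {M : Type*} [AddCommGroup M] [Module K M] {n : ℕ}
    {v : Fin (n + 1) → M} (hv : LinearIndependent K v) (r : Fin n → K) :
    LinearIndependent K (fun i => v i.succ - r i • v 0) := by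
  rw [Fintype.linearIndependent_iff] at hv ⊢
  intro g hg i
  have h := hv (Fin.cons (-∑ i, g i * r i) g) (by
    rw [Fin.sum_univ_succ]
    simp only [Fin.cons_zero, Fin.cons_succ, neg_smul, Finset.sum_smul, mul_smul]
    simp only [smul_sub, Finset.sum_sub_distrib] at hg
    rw [neg_add_eq_sub]
    exact hg) i.succ
  simpa using h

/-- Vectors over a ring are linearly independent if their images over the residue field are. -/
theorem linearIndependent_of_residue {X : Type*} (ε : A →+* K)
    (hε : ∀ a, ε a ≠ 0 → IsUnit a) {n : ℕ} (V : Fin n → X → A)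
    (hV : LinearIndependent K (fun i x => ε (V i x))) : LinearIndependent A V := by
  induction n with
  | zero => exact linearIndependent_empty_type
  | succ n ih =>
    obtain ⟨x₀, hx₀⟩ : ∃ x, ε (V 0 x) ≠ 0 := by
      by_contra! h
      exact hV.ne_zero 0 (funext h)
    obtain ⟨u, hu⟩ := hε _ hx₀
    have h0 : LinearIndependent A (fun i : Fin n => V i.succ - (V i.succ x₀ * ↑u⁻¹) • V 0) := by
      refine ih _ ?_
      have h1 := linearIndependent_sub_smul hV (fun i => ε (V i.succ x₀ * ↑u⁻¹))
      have h2 : (fun (i : Fin n) x => ε ((V i.succ - (V i.succ x₀ * ↑u⁻¹) • V 0) x)) = fun i =>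
          (fun x => ε (V i.succ x)) - ε (V i.succ x₀ * ↑u⁻¹) • fun x => ε (V 0 x) := by
        funext i x
        simp
      rw [h2]
      exact h1
    rw [Fintype.linearIndependent_iff] at h0 ⊢
    intro c hc
    rw [Fin.sum_univ_succ] at hc
    have hc₀ : c 0 = -∑ i : Fin n, c i.succ * (V i.succ x₀ * ↑u⁻¹) := by
      have h1 := congrFun hc x₀
      simp only [Pi.add_apply, Finset.sum_apply, Pi.smul_apply, smul_eq_mul, Pi.zero_apply] at h1
      have h2 := congrArg (· * (↑u⁻¹ : A)) h1
      simp only [add_mul, Finset.sum_mul, zero_mul, mul_assoc, ← hu, u.mul_inv, mul_one] at h2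
      exact eq_neg_of_add_eq_zero_left h2
    have h1 := h0 (fun i => c i.succ) (by
      rw [← hc, hc₀, neg_smul, Finset.sum_smul, neg_add_eq_sub, ← Finset.sum_sub_distrib]
      simp only [smul_sub, smul_smul])
    refine Fin.cases ?_ h1
    rw [hc₀]
    simp only [h1, zero_mul, Finset.sum_const_zero, neg_zero]

theorem isUnit_add_of_mem_span {G : Set A} (hG : ∀ g ∈ G, ∀ b, g * b * g = 0) {x : A}
    (hx : x ∈ Submodule.span A G) {u : A} (hu : IsUnit u) : IsUnit (u + x) := by
  induction hx using Submodule.closure_induction generalizing u with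
  | zero => rwa [add_zero]
  | add x y _ _ hx hy => rw [← add_assoc]; exact hy (hx hu)
  | smul_mem b g hg =>
    obtain ⟨u, rfl⟩ := hu
    have h1 : (u : A) + b • g = u * (1 + ↑u⁻¹ * b * g) := by
      rw [mul_add, mul_one, mul_assoc, u.mul_inv_cancel_left, smul_eq_mul]
    rw [h1]
    refine u.isUnit.mul (IsNilpotent.isUnit_one_add ⟨2, ?_⟩)
    rw [sq, mul_assoc, ← mul_assoc g, hG g hg, mul_zero]

end LinearIndependence

theorem ι_mul_mul_ι {M : Type*} [AddCommGroup M] [Module ℝ M] (v : M) (b : ExteriorAlgebra ℝ M) :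
    ExteriorAlgebra.ι ℝ v * b * ExteriorAlgebra.ι ℝ v = 0 := by
  rw [ι_mul_eq_involute_mul, mul_assoc, ExteriorAlgebra.ι_sq_zero, mul_zero]

theorem isUnit_of_algebraMapInv {M : Type*} [AddCommGroup M] [Module ℝ M] {a : ExteriorAlgebra ℝ M}
    (ha : ExteriorAlgebra.algebraMapInv a ≠ 0) : IsUnit a := by
  have h1 (a : ExteriorAlgebra ℝ M) : a - algebraMap ℝ _ (ExteriorAlgebra.algebraMapInv a) ∈
      Submodule.span (ExteriorAlgebra ℝ M) (Set.range (ExteriorAlgebra.ι ℝ (M := M))) := by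
    induction a using ExteriorAlgebra.induction with
    | algebraMap r => simp [ExteriorAlgebra.algebraMapInv]
    | ι v =>
      simpa [ExteriorAlgebra.algebraMapInv] using Submodule.subset_span (Set.mem_range_self v)
    | add a b ha hb =>
      rw [map_add, map_add, add_sub_add_comm]
      exact Submodule.add_mem _ ha hb
    | mul a b ha hb =>
      have e : a * b - algebraMap ℝ _ (ExteriorAlgebra.algebraMapInv (a * b)) =
          a • (b - algebraMap ℝ _ (ExteriorAlgebra.algebraMapInv b)) +
          algebraMap ℝ (ExteriorAlgebra ℝ M) (ExteriorAlgebra.algebraMapInv b) •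
            (a - algebraMap ℝ _ (ExteriorAlgebra.algebraMapInv a)) := by
        simp only [smul_eq_mul, map_mul, mul_sub, Algebra.commutes (ExteriorAlgebra.algebraMapInv b)]
        noncomm_ring
      rw [e]
      exact Submodule.add_mem _ (Submodule.smul_mem _ _ hb) (Submodule.smul_mem _ _ ha)
  have h2 := isUnit_add_of_mem_span (by rintro _ ⟨v, rfl⟩ b; exact ι_mul_mul_ι v b) (h1 a)
    ((isUnit_iff_ne_zero.2 ha).map (algebraMap ℝ (ExteriorAlgebra ℝ M)))
  rwa [add_sub_cancel] at h2

variable {U : Opens Body}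

/-- The formal expansion of functions at a point of the body. -/
noncomputable def expansion (p : U) :
    Fun U →+* MvPowerSeries FormalCoord (ExteriorAlgebra ℝ (OddCoord → ℝ)) :=
  MvPowerSeries.map ((Algebra.TensorProduct.lid ℝ _).toAlgHom.comp
    (Algebra.TensorProduct.map (smoothEval p) (AlgHom.id ℝ _))).toRingHom

theorem algebraMapInv_expansion (p : U) (f : Fun U) :
    ExteriorAlgebra.algebraMapInv (MvPowerSeries.constantCoeff (expansion p f)) = funEval p f := by
  have h (b : Smooth U ⊗[ℝ] ExteriorAlgebra ℝ (OddCoord → ℝ)) :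
      ExteriorAlgebra.algebraMapInv ((Algebra.TensorProduct.lid ℝ _).toAlgHom.comp
        (Algebra.TensorProduct.map (smoothEval p) (AlgHom.id ℝ _)) b) =
      Algebra.TensorProduct.lift (smoothEval p) ExteriorAlgebra.algebraMapInv
        (fun _ _ => Commute.all _ _) b := by
    induction b using TensorProduct.induction_on with
    | zero => simp only [map_zero]
    | add a b ha hb => simp only [map_add, ha, hb]
    | tmul s a => simp
  exact h (MvPowerSeries.constantCoeff f)

theorem eq_zero_of_expansion {f : Fun U} (h : ∀ p, expansion p f = 0) : f = 0 := by
  ext m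
  have h1 (p : U) := congrArg (MvPowerSeries.coeff m) (h p)
  simp only [expansion, MvPowerSeries.coeff_map, map_zero] at h1 ⊢
  generalize MvPowerSeries.coeff m f = b at h1
  let B := Module.Free.chooseBasis ℝ (ExteriorAlgebra ℝ (OddCoord → ℝ))
  let B' := B.baseChange (Smooth U)
  have h2 (p : U) (b : Smooth U ⊗[ℝ] ExteriorAlgebra ℝ (OddCoord → ℝ)) (i) :
      smoothEval p (B'.repr b i) = B.repr ((Algebra.TensorProduct.lid ℝ _).toAlgHom.comp
        (Algebra.TensorProduct.map (smoothEval p) (AlgHom.id ℝ _)) b) i := by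
    induction b using TensorProduct.induction_on with
    | zero => simp only [map_zero, Finsupp.zero_apply]
    | add a b ha hb => simp only [map_add, Finsupp.add_apply, ha, hb]
    | tmul s a =>
      have e1 : B'.repr (s ⊗ₜ a) i = B.repr a i • s := B.baseChange_repr_tmul _ _ _ _
      have e2 : (Algebra.TensorProduct.lid ℝ _).toAlgHom.comp (Algebra.TensorProduct.map
        (smoothEval p) (AlgHom.id ℝ _)) (s ⊗ₜ[ℝ] a) = smoothEval p s • a := rfl
      rw [e1, e2, map_smul, map_smul, Finsupp.smul_apply, smul_eq_mul, smul_eq_mul, mul_comm]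
  refine B'.ext_elem fun i => ?_
  rw [map_zero, Finsupp.zero_apply]
  refine ContMDiffMap.ext fun p => ?_
  have h3 := h2 p b i
  have h4 := h1 p
  change ((Algebra.TensorProduct.lid ℝ _).toAlgHom.comp
        (Algebra.TensorProduct.map (smoothEval p) (AlgHom.id ℝ _)) b) = 0 at h4
  rw [h4, map_zero, Finsupp.zero_apply] at h3
  exact h3

theorem linearIndependent_of_fieldEval {n : ℕ} {V : Fin n → VectorField U}
    (h : ∀ p : U, LinearIndependent ℝ (fun i => fieldEval p (V i))) :
    LinearIndependent (Fun U) V := by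
  rw [Fintype.linearIndependent_iff]
  intro c hc i
  refine eq_zero_of_expansion fun p => ?_
  have h1 := linearIndependent_of_residue
    ((ExteriorAlgebra.algebraMapInv : ExteriorAlgebra ℝ (OddCoord → ℝ) →ₐ[ℝ] ℝ).toRingHom.comp
      MvPowerSeries.constantCoeff) (A := MvPowerSeries FormalCoord (ExteriorAlgebra ℝ (OddCoord → ℝ)))
    (fun a ha => MvPowerSeries.isUnit_iff_constantCoeff.2 (isUnit_of_algebraMapInv ha))
    (fun i x => expansion p (V i x)) (by
      have h2 : (fun i x => ExteriorAlgebra.algebraMapInv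
          (MvPowerSeries.constantCoeff (expansion p (V i x)))) = fun i => fieldEval p (V i) := by
        funext i x
        exact algebraMapInv_expansion p (V i x)
      have h3 := h p
      rw [← h2] at h3
      exact h3)
  rw [Fintype.linearIndependent_iff] at h1
  refine h1 (fun i => expansion p (c i)) (funext fun x => ?_) i
  have h2 := congrArg (expansion p) (congrFun hc x)
  simpa only [Finset.sum_apply, Pi.smul_apply, smul_eq_mul, map_sum, map_mul, Pi.zero_apply,
    map_zero] using h2

theorem Distribution.res_self (D : Distribution U) : D.res le_rfl = D := by
  have h (f : Fun U) : funRes (le_refl U) f = f := by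
    have h1 : Algebra.TensorProduct.map (smoothRes (le_refl U))
        (AlgHom.id ℝ (ExteriorAlgebra ℝ (OddCoord → ℝ))) = AlgHom.id ℝ _ := by
      rw [show smoothRes (le_refl U) = AlgHom.id ℝ (Smooth U) from rfl,
        Algebra.TensorProduct.map_id]
    rw [funRes, h1]
    exact congrFun (congrArg DFunLike.coe MvPowerSeries.map_id) f
  simp only [Distribution.res, h, Set.image_id', Submodule.span_eq]

theorem funEval_algebraMap (p : U) (r : ℝ) : funEval p (algebraMap ℝ (Fun U) r) = r := by
  simp [funEval, MvPowerSeries.algebraMap_apply]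

end Sugra

theorem mainTheorem3 :
    ∃ K' : Sugra.Distribution Sugra.admissible,
      K' ≤ Sugra.kernel Sugra.admissible ∧ K'.IsRegular ∧
        ∀ p : Sugra.admissible,
          Sugra.fieldEval p '' (K' : Set (Sugra.VectorField Sugra.admissible)) =
            (Sugra.kernelAt p : Set Sugra.Tangent) := by
  open Sugra in
  obtain ⟨n, w, hw, hli, hspan⟩ := exists_pure_basis
  choose V hV hVk hVs using fun i => exists_field_of_pureSolution admissible (hw i)
  have hval (p : admissible) (i : Fin n) (I : TargetCoord) :
      tangentSuper (fieldEval p (V i)) I = frameMap p (w i I) := by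
    obtain ⟨s, r, r', h⟩ := hVs i
    exact tangentSuper_of_liftSolution p h I
  have hK : Submodule.span (Fun admissible) (Set.range V) ≤ kernel admissible := by
    rw [Submodule.span_le]
    rintro _ ⟨i, rfl⟩
    exact hVk i
  refine ⟨Submodule.span _ (Set.range V), hK, fun p hp => ⟨admissible, le_rfl, hp, n, V, hV, ?_,
    (Distribution.res_self _).symm⟩, fun p => Set.Subset.antisymm ?_ ?_⟩
  · refine linearIndependent_of_fieldEval fun p => ?_
    rw [Fintype.linearIndependent_iff] at hli ⊢
    intro c hc
    refine hli c (funext fun I => (frameMap_bijective p.2).1 ?_)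
    have h := congrFun (congrArg tangentSuper hc) I
    simpa only [map_sum, map_smul, Finset.sum_apply, Pi.smul_apply, hval, map_zero,
      Pi.zero_apply] using h
  · rintro _ ⟨X, hX, rfl⟩
    refine (fieldEval_mem_kernelAt_iff p X).2 ?_
    rw [show interior X (omegaBar admissible) = 0 from hK hX, map_zero]
  · intro v hv
    choose u hu using fun I => (frameMap_bijective p.2).2 (tangentSuper v I)
    have h1 : u ∈ Submodule.span ℝ (Set.range w) := by
      rw [hspan]
      exact (mem_kernelAt_iff p p.2 fun I => (hu I).symm).1 hv
    obtain ⟨c, hc⟩ := (Submodule.mem_span_range_iff_exists_fun ℝ).1 h1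
    refine ⟨∑ i, algebraMap ℝ (Fun admissible) (c i) • V i, Submodule.sum_mem _ fun i _ =>
      Submodule.smul_mem _ _ (Submodule.subset_span ⟨i, rfl⟩), ?_⟩
    have h2 : fieldEval p (∑ i, algebraMap ℝ (Fun admissible) (c i) • V i) =
        ∑ i, c i • fieldEval p (V i) := by
      funext x
      simp only [fieldEval, Finset.sum_apply, Pi.smul_apply, smul_eq_mul, map_sum, map_mul,
        funEval_algebraMap]
    apply tangentSuper_injective
    funext I
    rw [h2, ← hu I, ← hc]
    simp only [map_sum, map_smul, Finset.sum_apply, Pi.smul_apply, hval]
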